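/- Let $\beta>0$, $\alpha_o,\varepsilon\in\mathbb{R}$ be constants. For functions on $\mathbb{R}$ let $\hat f(k)=\frac{1}{\sqrt{2\pi}}\int_{\mathbb{R}}f(x)e^{-ikx}\,dx$, let $\mathcal{H}$ (the Hilbert transform) and $\Lambda$ be the Fourier multipliers $\widehat{\mathcal{H}f}(k)=-i\,\mathrm{sgn}(k)\hat f(k)$ and $\widehat{\Lambda f}(k)=|k|\hat f(k)$, let $[\mathcal{H},f]g=\mathcal{H}(fg)-f\,\mathcal{H}g$, and let $H^s(\mathbb{R})$ be the space of $h\in L^2(\mathbb{R})$ with $\|h\|_{H^s}^2=\int_{\mathbb{R}}(1+|k|^{2s})|\hat h(k)|^2\,dk<\infty$. For all real-valued initial data $(f_0,f_1)\in H^{4.5}(\mathbb{R})\times H^{3}(\mathbb{R})$ there exists $T^*>0$ such that the equation $$f_{tt}=-\Lambda f-\beta\Lambda^3 f+\alpha_o\Lambda f_{tx}+\varepsilon\left[-\mathcal{H}\left((\mathcal{H}f_t)^2\right)+[\mathcal{H},f]\Lambda f\right]_x\qquad\text{on }\mathbb{R}\times(0,T^*)$$ with $f(\cdot,0)=f_0$,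 $f_t(\cdot,0)=f_1$ has exactly one real-valued solution with $$(f,f_t)\in L^\infty(0,T^*;H^{4.5}(\mathbb{R}))\times L^\infty(0,T^*;H^{3}(\mathbb{R})).$$ Here the time derivatives and the initial conditions are understood in the weak sense: for every $\varphi\in C_c^\infty((-\infty,T^*))$, as identities in $L^2(\mathbb{R})$, $\int_0^{T^*}\varphi' f\,dt=-\varphi(0)f_0-\int_0^{T^*}\varphi f_t\,dt$ and $\int_0^{T^*}\varphi' f_t\,dt=-\varphi(0)f_1-\int_0^{T^*}\varphi F\,dt$, where $F$ is the right-hand side of the equation; solutions that agree for almost every $t$ are identified. -/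

import Mathlib

open MeasureTheory Set
open scoped FourierTransform ENNReal NNReal ContDiff

noncomputable section

namespace OddWaves

/-- `L²(ℝ)` with complex values; real-valuedness is imposed separately by `IsRealValued`. -/
abbrev L2 : Type := Lp ℂ 2 (volume : Measure ℝ)

/-- The function is real-valued almost everywhere. -/
def IsRealValued (u : L2) : Prop := ∀ᵐ x : ℝ, (u x).im = 0

/-- The (possibly infinite) norm of `u ∈ L²(ℝ)` in `H^s(ℝ)`, the square root of
`∫ (1 + |k|^{2s}) |û(k)|² dk`. Mathlib's transform is `∫ e^{-2πixξ} u(x) dx`, so that the angular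
frequency is `k = 2πξ`. With `û(k) = (2π)^{-1/2} ∫ e^{-ikx} u(x) dx` the two integrals agree. -/
def hsNorm (s : ℝ) (u : L2) : ℝ≥0∞ :=
  eLpNorm (fun ξ : ℝ => (Real.sqrt (1 + |2 * Real.pi * ξ| ^ (2 * s)) : ℂ) * (𝓕 u : L2) ξ) 2 volume

/-- `u ∈ H^s(ℝ)`. -/
def MemHs (s : ℝ) (u : L2) : Prop := hsNorm s u < ⊤

open Classical in
/-- The Fourier multiplier with symbol `m` (a function of Mathlib's frequency `ξ = k / 2π`), with
its maximal domain `{u ∈ L² : m û ∈ L²}`. The value `0` off that domain is a convention. -/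
def multiplier (m : ℝ → ℂ) (u : L2) : L2 :=
  if h : MemLp (fun ξ : ℝ => m ξ * (𝓕 u : L2) ξ) 2 volume then 𝓕⁻ (h.toLp _ : L2) else 0

/-- The Hilbert transform, with symbol `-i sgn k`. -/
def hilbert (u : L2) : L2 := multiplier (fun ξ => -Complex.I * (Real.sign ξ : ℂ)) u

/-- The power `Λ^n`, with symbol `|k|^n`. -/
def lam (n : ℕ) (u : L2) : L2 := multiplier (fun ξ => ((|2 * Real.pi * ξ| ^ n : ℝ) : ℂ)) u

/-- The space derivative, with symbol `i k`. -/
def dx (u : L2) : L2 := multiplier (fun ξ => Complex.I * ((2 * Real.pi * ξ : ℝ) : ℂ)) u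

open Classical in
/-- The pointwise product of two functions, when it is in `L²`. The value `0` otherwise is a
convention. -/
def mul (u v : L2) : L2 :=
  if h : MemLp (fun x : ℝ => u x * v x) 2 volume then h.toLp _ else 0

/-- The commutator `[T, f] g = T (f g) - f T g`. -/
def comm (T : L2 → L2) (f g : L2) : L2 := T (mul f g) - mul f (T g)

/-- The right-hand side
`-Λf - βΛ³f + α Λ g_x + ε [ -H((H g)²) + [H, f] Λ f ]_x`
of the equation, for `f ∈ H^{9/2}` and `g = f_t ∈ H³`. For such `f` and `g` all multipliers and
products below are taken inside their domains. -/
def rhs (α β ε : ℝ) (f g : L2) : L2 :=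
  -lam 1 f - β • lam 3 f + α • lam 1 (dx g)
    + ε • dx (-hilbert (mul (hilbert g) (hilbert g)) + comm hilbert f (lam 1 f))

/-- `u ∈ L^∞(0, T; H^s(ℝ))`. -/
def MemLinftyHs (T s : ℝ) (u : ℝ → L2) : Prop :=
  AEStronglyMeasurable u (volume.restrict (Ioo 0 T)) ∧
    ∃ C : ℝ≥0, ∀ᵐ t ∂(volume.restrict (Ioo 0 T)), hsNorm s (u t) ≤ C

/-- On `(0, T)` the function `v` is the weak time derivative of `u`, and `u` has the initial value
`u₀`: `∫₀ᵀ φ' u dt = - φ(0) u₀ - ∫₀ᵀ φ v dt` in `L²(ℝ)` for all `φ ∈ C_c^∞((-∞, T))`. -/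
def HasWeakTimeDeriv (T : ℝ) (u₀ : L2) (u v : ℝ → L2) : Prop :=
  ∀ φ : ℝ → ℝ, ContDiff ℝ ∞ φ → HasCompactSupport φ → tsupport φ ⊆ Iio T →
    ∫ t in Ioo 0 T, deriv φ t • u t = -(φ 0 • u₀) - ∫ t in Ioo 0 T, φ t • v t

/-- `(f, g)` with `g = f_t` is a real-valued solution, in
`L^∞(0, T; H^{9/2}(ℝ)) × L^∞(0, T; H³(ℝ))`, of
`f_tt = -Λf - βΛ³f + α Λ f_tx + ε [ -H((H f_t)²) + [H, f] Λ f ]_x`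
on `(0, T)` with `f(0) = f₀` and `f_t(0) = f₁`. -/
structure IsSolution (α β ε T : ℝ) (f₀ f₁ : L2) (f g : ℝ → L2) : Prop where
  real_valued : ∀ᵐ t ∂(volume.restrict (Ioo 0 T)), IsRealValued (f t)
  mem_f : MemLinftyHs T (9 / 2) f
  mem_g : MemLinftyHs T 3 g
  deriv_f : HasWeakTimeDeriv T f₀ f g
  integrable_rhs : IntegrableOn (fun t => rhs α β ε (f t) (g t)) (Ioo 0 T)
  deriv_g : HasWeakTimeDeriv T f₁ g (fun t => rhs α β ε (f t) (g t))

end OddWaves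

end

/-! On the Fourier side put `θ = (1 + |ξ|)⁻¹`, `κ = |2πξ|` and `μ = √(1 + κ + |β| κ³)`, and write
`f̂ = μ⁻¹ θ³ A`, `f̂_t = θ³ B`. Since `β > 0`, the pair `(f, f_t)` lies in `H^{9/2} × H³` exactly
when `A` and `B` lie in `L²`. Because `Λ + βΛ³ = μ² - 1`, the equation becomes a first-order system
`(Θ x)' = flow x` for `x = (A, B)`, where `Θ` is multiplication by `θ³`. The linear part is skew in
the energy norm, up to a bounded term. The flow loses derivatives, so this is a quasilinear problem
and no fixed point argument applies in the smooth norm.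

Three properties replace it (`IsQuasilinear`). The first is an energy estimate in the smooth norm
for the equation truncated at frequency `n`, uniform in `n` (`inner_accel_le`). The second is a
one-sided Lipschitz estimate for differences in the rough norm `‖Θ x‖` (`inner_accel_sub_le`). The
third is continuity of the flow for the rough norm on bounded sets (`exists_norm_flow_sub_le`,
`norm_symH_θ_le`). The truncated equations are ordinary differential equations. The energy estimate
bounds them on a common time interval, the difference estimate makes them Cauchy in the rough norm,
and rough continuity lets the integrated equation pass to the limit (`exists_solution`). The
difference estimate and Gronwall's inequality give uniqueness (`unique`).

Both estimates rest on cancellations in the quadratic terms. In `H((Hg)²)_x` one derivative of the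
highest-frequency factor seems to be lost. The coefficient is real, however, so only the kernel
symmetrized in the two outer frequencies matters, and there the derivative moves to the coefficient:
see `abs_inner_bil_le` with `abs_sign_mul_abs_sub_le` for differences, and with `abs_mainKer_add_le`
for the energy. In `([H, f] Λf)_x` the factor `k (sgn k - sgn l)` forces input and output
frequencies of opposite signs, so that `|k| ≤ |k - l|` and all outer derivatives fall on `f`. The
additional 3/2 derivatives which surface tension gives to `f` then suffice (`exists_κ_le`).

All bilinear operators are convolutions with kernels bounded by `C (θ (k - l) + θ l)`, which are
controlled by Young's inequality because `θ ∈ L²`. Finally, the weak formulation in time is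
equivalent to the integrated equation (`ae_eq_integral_of_hasWeakTimeDeriv`), and functions in the
Sobolev classes correspond to bounded phase-space trajectories (`IsSolution.exists_phase`,
`isSolution_of_phase`). -/

noncomputable section

namespace OddWaves

open Filter Topology

section


/-! ### Primitives of bounded vector-valued functions and Gronwall's inequality -/

section Primitive

variable {E : Type*} [NormedAddCommGroup E]

lemma intervalIntegrable_of_ae_bound {v : ℝ → E} {T M : ℝ} (hT : 0 ≤ T)
    (hm : AEStronglyMeasurable v (volume.restrict (Ioo 0 T)))
    (hv : ∀ᵐ t ∂(volume.restrict (Ioo 0 T)), ‖v t‖ ≤ M) :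
    IntervalIntegrable v volume 0 T := by
  rw [intervalIntegrable_iff_integrableOn_Ioo_of_le hT]
  exact Integrable.of_bound hm M hv

lemma intervalIntegrable_sub {v : ℝ → E} {T s t : ℝ} (h : IntervalIntegrable v volume 0 T)
    (hs : s ∈ Icc 0 T) (ht : t ∈ Icc 0 T) : IntervalIntegrable v volume s t := by
  refine h.mono_set ?_
  rw [uIcc_of_le (hs.1.trans hs.2)]
  exact uIcc_subset_Icc hs ht

variable [NormedSpace ℝ E]

/-- Solutions satisfy the equation only almost everywhere in time. Absolute continuity is stable
under products and still allows a function to be recovered from its almost everywhere derivative. -/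
lemma absolutelyContinuous_primitive {v : ℝ → E} {T M : ℝ} (hT : 0 ≤ T)
    (hm : AEStronglyMeasurable v (volume.restrict (Ioo 0 T)))
    (hv : ∀ᵐ t ∂(volume.restrict (Ioo 0 T)), ‖v t‖ ≤ M) :
    AbsolutelyContinuousOnInterval (fun t => ∫ s in (0 : ℝ)..t, v s) 0 T := by
  have hi := intervalIntegrable_of_ae_bound hT hm hv
  refine LipschitzOnWith.absolutelyContinuousOnInterval (K := M.toNNReal) ?_
  rw [uIcc_of_le hT]
  have hv' : ∀ᵐ t ∂volume, t ∈ Ioc 0 T → ‖v t‖ ≤ M := by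
    rw [ae_restrict_iff' measurableSet_Ioo] at hv
    filter_upwards [hv, (measure_eq_zero_iff_ae_notMem.mp (measure_singleton T))] with t h1 h2 h3
    exact h1 ⟨h3.1, lt_of_le_of_ne h3.2 (by simpa using h2)⟩
  refine LipschitzOnWith.of_dist_le_mul fun x hx y hy => ?_
  rw [dist_eq_norm, intervalIntegral.integral_interval_sub_left
    (intervalIntegrable_sub hi ⟨le_rfl, hT⟩ hx) (intervalIntegrable_sub hi ⟨le_rfl, hT⟩ hy),
    Real.dist_eq]
  have := intervalIntegral.norm_integral_le_of_norm_le_const_ae (f := v) (a := y) (b := x)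
    (C := M.toNNReal) (by
      filter_upwards [hv'] with t ht hxy
      refine (ht ?_).trans (Real.le_coe_toNNReal M)
      rcases mem_uIoc.mp hxy with h | h
      · exact ⟨hy.1.trans_lt h.1, h.2.trans hx.2⟩
      · exact ⟨hx.1.trans_lt h.1, h.2.trans hy.2⟩)
  simpa using this

lemma ae_hasDerivAt_primitive [CompleteSpace E] {v : ℝ → E} {T : ℝ} (hT : 0 ≤ T)
    (hi : IntervalIntegrable v volume 0 T) :
    ∀ᵐ x, x ∈ Icc 0 T → HasDerivAt (fun t => ∫ s in (0 : ℝ)..t, v s) (v x) x := by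
  filter_upwards [hi.ae_hasDerivAt_integral] with x hx h
  exact hx (by rwa [uIcc_of_le hT]) 0 (by simp)

lemma absolutelyContinuous_of_contDiff {φ : ℝ → ℝ} (h : ContDiff ℝ 1 φ) (a b : ℝ) :
    AbsolutelyContinuousOnInterval φ a b := by
  have hd := (h.continuous_deriv le_rfl)
  obtain ⟨C, hC⟩ := (isCompact_uIcc (a := a) (b := b)).exists_bound_of_continuousOn hd.continuousOn
  refine LipschitzOnWith.absolutelyContinuousOnInterval (K := C.toNNReal) ?_
  refine (convex_uIcc a b).lipschitzOnWith_of_nnnorm_deriv_le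
    (fun x _ => (h.differentiable one_ne_zero) x) fun x hx => ?_
  rw [← NNReal.coe_le_coe]
  exact (hC x hx).trans (Real.le_coe_toNNReal C)

/-- The function `exp (-K t) q t` is absolutely continuous with derivative `≤ 0` almost everywhere,
hence does not exceed its initial value. -/
lemma le_exp_mul_of_absolutelyContinuous {q q' : ℝ → ℝ} {T K : ℝ}
    (hq : AbsolutelyContinuousOnInterval q 0 T)
    (hd : ∀ᵐ x, x ∈ Icc 0 T → HasDerivAt q (q' x) x ∧ q' x ≤ K * q x) {t : ℝ} (ht : t ∈ Icc 0 T) :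
    q t ≤ q 0 * Real.exp (K * t) := by
  set p : ℝ → ℝ := fun t => Real.exp (-K * t) * q t with hp
  have hpa : AbsolutelyContinuousOnInterval p 0 t := by
    refine AbsolutelyContinuousOnInterval.fun_mul
      (absolutelyContinuous_of_contDiff (by fun_prop) _ _) (hq.mono ?_)
    rw [uIcc_of_le ht.1, uIcc_of_le (ht.1.trans ht.2)]
    exact Icc_subset_Icc_right ht.2
  have h1 : ∫ x in (0 : ℝ)..t, deriv p x ≤ 0 := by
    rw [intervalIntegral.integral_of_le ht.1]
    refine setIntegral_nonpos_ae measurableSet_Ioc ?_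
    filter_upwards [hd] with x hx hx2
    obtain ⟨h2, h3⟩ := hx ⟨hx2.1.le, hx2.2.trans ht.2⟩
    have h4 : HasDerivAt (fun t => Real.exp (-K * t)) (Real.exp (-K * x) * (-K)) x := by
      simpa using ((hasDerivAt_id x).const_mul (-K)).exp
    rw [show deriv p x = _ from (h4.mul h2).deriv]
    have := Real.exp_pos (-K * x)
    nlinarith
  rw [hpa.integral_deriv_eq_sub] at h1
  have h2 : Real.exp (-K * t) * q t ≤ q 0 := by simpa [hp] using h1
  have h3 : Real.exp (-K * t) * Real.exp (K * t) = 1 := by rw [← Real.exp_add]; simp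
  calc q t = (Real.exp (-K * t) * q t) * Real.exp (K * t) := by linear_combination (-q t) * h3
    _ ≤ _ := by gcongr

end Primitive

/-! ### Energy inequalities in a Hilbert space and the radial retraction -/

section Energy

variable {H : Type*} [NormedAddCommGroup H] [InnerProductSpace ℝ H]

/-- A primitive `D` with `⟪D, D'⟫ ≤ C ‖D‖²` and `D 0 = 0` vanishes. -/
lemma primitive_eq_zero [CompleteSpace H] {v : ℝ → H} {T M C : ℝ} (hT : 0 ≤ T)
    (hm : AEStronglyMeasurable v (volume.restrict (Ioo 0 T)))
    (hv : ∀ᵐ t ∂(volume.restrict (Ioo 0 T)), ‖v t‖ ≤ M)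
    (hC : ∀ᵐ t ∂(volume.restrict (Ioo 0 T)),
      inner ℝ (∫ s in (0 : ℝ)..t, v s) (v t) ≤ C * ‖∫ s in (0 : ℝ)..t, v s‖ ^ 2)
    {t : ℝ} (ht : t ∈ Icc 0 T) : ∫ s in (0 : ℝ)..t, v s = 0 := by
  set D : ℝ → H := fun t => ∫ s in (0 : ℝ)..t, v s with hD
  have hDa : AbsolutelyContinuousOnInterval D 0 T := absolutelyContinuous_primitive hT hm hv
  -- The norm is 1-Lipschitz, so it does not enlarge the sums of increments in the definition of
  -- absolute continuity.
  have hn : AbsolutelyContinuousOnInterval (fun t => ‖D t‖) 0 T := by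
    refine squeeze_zero (fun _ => Finset.sum_nonneg fun _ _ => dist_nonneg) (fun E => ?_) hDa
    exact Finset.sum_le_sum fun i _ => by
      simpa [Real.dist_eq, dist_eq_norm] using abs_norm_sub_norm_le (D (E.2 i).1) (D (E.2 i).2)
  have hq : AbsolutelyContinuousOnInterval (fun t => ‖D t‖ ^ 2) 0 T := by
    simpa [pow_two] using hn.fun_mul hn
  have key := le_exp_mul_of_absolutelyContinuous (K := 2 * C)
    (q' := fun x => 2 * inner ℝ (D x) (v x)) hq (by
      rw [ae_restrict_iff' measurableSet_Ioo] at hC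
      filter_upwards [hC, ae_hasDerivAt_primitive hT (intervalIntegrable_of_ae_bound hT hm hv),
        measure_eq_zero_iff_ae_notMem.mp (measure_singleton T),
        measure_eq_zero_iff_ae_notMem.mp (measure_singleton (0 : ℝ))] with x h1 h2 h3 h4 hx
      refine ⟨(h2 hx).norm_sq, ?_⟩
      have := h1 ⟨lt_of_le_of_ne hx.1 fun h => h4 (by simp [h]),
        lt_of_le_of_ne hx.2 (by simpa using h3)⟩
      linarith) ht
  have h0 : D 0 = 0 := by simp [hD]
  rw [h0] at key
  simp only [norm_zero, ne_eq, OfNat.ofNat_ne_zero, not_false_eq_true, zero_pow, zero_mul] at key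
  have : ‖D t‖ = 0 := by nlinarith [norm_nonneg (D t)]
  exact norm_eq_zero.mp this

/-- This version serves the truncated equations, whose solutions are differentiable everywhere; `ε`
carries the truncation error. -/
lemma norm_sq_le_gronwallBound {x x' : ℝ → H} {T δ K ε : ℝ}
    (hx : ∀ t ∈ Icc 0 T, HasDerivAt x (x' t) t) (h0 : ‖x 0‖ ^ 2 ≤ δ)
    (hb : ∀ t ∈ Icc 0 T, 2 * inner ℝ (x t) (x' t) ≤ K * ‖x t‖ ^ 2 + ε) {t : ℝ}
    (ht : t ∈ Icc 0 T) : ‖x t‖ ^ 2 ≤ gronwallBound δ K ε t := by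
  have h1 : ∀ t ∈ Icc 0 T, HasDerivAt (fun t => ‖x t‖ ^ 2) (2 * inner ℝ (x t) (x' t)) t :=
    fun t ht => (hx t ht).norm_sq
  simpa using le_gronwallBound_of_liminf_deriv_right_le
    (f' := fun t => 2 * inner ℝ (x t) (x' t))
    (fun t ht => (h1 t ht).continuousAt.continuousWithinAt)
    (fun t ht r hr => ((h1 t ⟨ht.1, ht.2.le⟩).hasDerivWithinAt.liminf_right_slope_le hr).mono
      fun z hz => by simpa [slope_def_field, div_eq_inv_mul] using hz) h0
    (fun t ht => hb t ⟨ht.1, ht.2.le⟩) t ht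

/-- The radial retraction onto the ball of radius `R`. -/
def radial (R : ℝ) (x : H) : H := (R / max R ‖x‖) • x

lemma radial_of_le {R : ℝ} (hR : 0 < R) {x : H} (hx : ‖x‖ ≤ R) : radial R x = x := by
  simp [radial, max_eq_left hx, div_self hR.ne']

lemma norm_radial_le {R : ℝ} (hR : 0 < R) (x : H) : ‖radial R x‖ ≤ R := by
  have hp : 0 < max R ‖x‖ := lt_max_of_lt_left hR
  rw [radial, norm_smul, Real.norm_of_nonneg (by positivity), div_mul_eq_mul_div, div_le_iff₀ hp]
  gcongr
  exact le_max_right _ _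

/-- The difference splits into a contracted `x - y` and a change of the scaling factor times `y`.
Each is at most `‖x - y‖`, the second because `max R ‖·‖` is 1-Lipschitz. A global Lipschitz
constant makes the truncated equations solvable for all times. -/
lemma radial_lipschitz {R : ℝ} (hR : 0 < R) (x y : H) :
    ‖radial R x - radial R y‖ ≤ 2 * ‖x - y‖ := by
  have hp : 0 < max R ‖x‖ := lt_max_of_lt_left hR
  have hq : 0 < max R ‖y‖ := lt_max_of_lt_left hR
  have h1 : radial R x - radial R y =
      (R / max R ‖x‖) • (x - y) + (R / max R ‖x‖ - R / max R ‖y‖) • y := by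
    simp only [radial, smul_sub, sub_smul]; abel
  have h2 : |R / max R ‖x‖ - R / max R ‖y‖| * ‖y‖ ≤ ‖x - y‖ := by
    have e : R / max R ‖x‖ - R / max R ‖y‖ =
        R * (max R ‖y‖ - max R ‖x‖) / (max R ‖x‖ * max R ‖y‖) := by
      field_simp
    have h3 : |max R ‖y‖ - max R ‖x‖| ≤ ‖x - y‖ := by
      have := abs_max_sub_max_le_max R ‖y‖ R ‖x‖
      simp only [sub_self, abs_zero] at this
      refine this.trans (max_le (norm_nonneg _) ?_)
      rw [norm_sub_rev]
      exact abs_norm_sub_norm_le y x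
    rw [e, abs_div, abs_mul, abs_of_pos hR, abs_of_pos (mul_pos hp hq), div_mul_eq_mul_div,
      div_le_iff₀ (mul_pos hp hq)]
    calc R * |max R ‖y‖ - max R ‖x‖| * ‖y‖ ≤ max R ‖x‖ * ‖x - y‖ * max R ‖y‖ := by
          gcongr
          · exact le_max_left _ _
          · exact le_max_right _ _
      _ = _ := by ring
  have h4 : R / max R ‖x‖ ≤ 1 := (div_le_one hp).mpr (le_max_left _ _)
  rw [h1]
  refine (norm_add_le _ _).trans ?_
  rw [norm_smul, norm_smul, Real.norm_eq_abs, Real.norm_eq_abs, abs_of_pos (div_pos hR hp)]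
  nlinarith [norm_nonneg (x - y)]

end Energy

end

/-! ### Abstract quasilinear evolution equations: uniqueness and Galerkin existence -/

section


variable {H : Type*} [NormedAddCommGroup H] [InnerProductSpace ℝ H]

/-- An evolution equation `(Θ U)' = G U` with loss of derivatives in a Hilbert space of smooth
states `U`, where `Θ` is the embedding into the rough states, `P n` are truncations and
`W n = P n Θ⁻¹`. The equation is monotone in the rough norm and has an energy estimate in the
smooth norm, uniformly in the truncation. -/
structure IsQuasilinear (Θ : H →L[ℝ] H) (P W : ℕ → H →L[ℝ] H) (G : H → H) : Prop where
  norm_P_le : ∀ n x, ‖P n x‖ ≤ ‖x‖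
  P_symm : ∀ n x y, inner ℝ (P n x) y = inner ℝ x (P n y)
  P_tendsto : ∀ x, Tendsto (fun n => P n x) atTop (𝓝 x)
  P_W : ∀ m n, m ≤ n → ∀ x, P m (W n x) = W m x
  P_P : ∀ n x, P n (P n x) = P n x
  Θ_W : ∀ n x, Θ (W n x) = P n x
  W_Θ : ∀ n x, W n (Θ x) = P n x
  tail : ∀ (n : ℕ) x, ‖Θ x - P n (Θ x)‖ ≤ ‖x‖ / (n + 1)
  lip : ∀ R, ∃ K : ℝ, ∀ x y, ‖x‖ ≤ R → ‖y‖ ≤ R → ‖G x - G y‖ ≤ K * ‖x - y‖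
  weak : ∀ R, ∀ η > 0, ∃ C : ℝ, ∀ x y, ‖x‖ ≤ R → ‖y‖ ≤ R → ‖G x - G y‖ ≤ η + C * ‖Θ (x - y)‖
  mono : ∀ R, ∃ C : ℝ, ∀ x y, ‖x‖ ≤ R → ‖y‖ ≤ R →
    inner ℝ (Θ (x - y)) (G x - G y) ≤ C * ‖Θ (x - y)‖ ^ 2
  energy : ∀ R, ∃ C : ℝ, ∀ n x, ‖x‖ ≤ R → P n x = x → inner ℝ x (W n (G x)) ≤ C * ‖x‖ ^ 2

namespace IsQuasilinear

variable {Θ : H →L[ℝ] H} {P W : ℕ → H →L[ℝ] H} {G : H → H} (h : IsQuasilinear Θ P W G)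

include h

lemma Θ_injective : Function.Injective Θ := by
  intro x y hxy
  refine tendsto_nhds_unique (h.P_tendsto x) ?_
  simp_rw [← h.W_Θ, hxy, h.W_Θ]
  exact h.P_tendsto y

/-- This keeps smooth bounds under rough limits. The `W n u` are orthogonal truncations of one
another, so by Pythagoras `‖W n u - W m u‖²` is an increment of the monotone bounded sequence `‖W n
u‖²`. Hence they converge, and `Θ` maps the limit to `lim P n u = u`. -/
lemma exists_Θ_eq [CompleteSpace H] {u : H} {R : ℝ} (hu : ∀ n, ‖W n u‖ ≤ R) :
    ∃ x, Θ x = u ∧ ‖x‖ ≤ R := by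
  have key : ∀ m n, m ≤ n → ‖W n u - W m u‖ ^ 2 = ‖W n u‖ ^ 2 - ‖W m u‖ ^ 2 := by
    intro m n hmn
    have h1 : inner ℝ (W n u) (W m u) = ‖W m u‖ ^ 2 := by
      rw [← h.P_W m m le_rfl, ← h.P_symm, h.P_W m n hmn, h.P_W m m le_rfl,
        real_inner_self_eq_norm_sq]
    rw [norm_sub_sq_real, h1]
    ring
  have hmono : Monotone fun n => ‖W n u‖ ^ 2 := fun m n hmn => by
    have := key m n hmn
    simp only
    nlinarith [sq_nonneg ‖W n u - W m u‖]
  have hbdd : BddAbove (range fun n => ‖W n u‖ ^ 2) := by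
    refine ⟨R ^ 2, ?_⟩
    rintro _ ⟨n, rfl⟩
    exact pow_le_pow_left₀ (norm_nonneg _) (hu n) 2
  have hc := (tendsto_atTop_ciSup hmono hbdd).cauchySeq
  have hcau : CauchySeq fun n => W n u := by
    rw [Metric.cauchySeq_iff'] at hc ⊢
    intro ε hε
    obtain ⟨N, hN⟩ := hc (ε ^ 2) (by positivity)
    refine ⟨N, fun n hn => ?_⟩
    have h1 := hN n hn
    rw [Real.dist_eq, ← key N n hn, abs_of_nonneg (by positivity)] at h1
    rw [dist_eq_norm]
    exact lt_of_pow_lt_pow_left₀ 2 hε.le h1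
  obtain ⟨x, hx⟩ := cauchySeq_tendsto_of_complete hcau
  refine ⟨x, ?_, le_of_tendsto hx.norm (Eventually.of_forall hu)⟩
  refine tendsto_nhds_unique ((Θ.continuous.tendsto x).comp hx) ?_
  simpa [Function.comp_def, h.Θ_W] using h.P_tendsto u

lemma exists_bound (R : ℝ) : ∃ M : ℝ, 0 ≤ M ∧ ∀ x, ‖x‖ ≤ R → ‖G x‖ ≤ M := by
  obtain ⟨K, hK⟩ := h.lip R
  refine ⟨|K| * |R| + ‖G 0‖, by positivity, fun x hx => ?_⟩
  have hR : 0 ≤ R := (norm_nonneg x).trans hx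
  have h1 := hK x 0 hx (by simpa using hR)
  have h2 : ‖G x‖ ≤ ‖G x - G 0‖ + ‖G 0‖ := by
    simpa using norm_add_le (G x - G 0) (G 0)
  have h3 : K * ‖x - 0‖ ≤ |K| * |R| := by
    rw [sub_zero, abs_of_nonneg hR]
    exact mul_le_mul (le_abs_self K) hx (norm_nonneg _) (abs_nonneg _)
  linarith

lemma continuous : Continuous G := by
  rw [continuous_iff_continuousAt]
  intro x
  obtain ⟨K, hK⟩ := h.lip (‖x‖ + 1)
  have hc : ContinuousAt (fun y => K * ‖y - x‖) x := by fun_prop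
  have h0 : Tendsto (fun y => K * ‖y - x‖) (𝓝 x) (𝓝 0) := by simpa using hc.tendsto
  rw [ContinuousAt, tendsto_iff_norm_sub_tendsto_zero]
  refine squeeze_zero' (Eventually.of_forall fun _ => norm_nonneg _) ?_ h0
  filter_upwards [Metric.ball_mem_nhds x one_pos] with y hy
  refine hK y x ?_ (by linarith)
  have := norm_sub_norm_le y x
  rw [Metric.mem_ball, dist_eq_norm] at hy
  linarith

/-- Uniqueness of bounded solutions of the integrated equation. -/
theorem unique [CompleteSpace H] {T R : ℝ} (hT : 0 ≤ T) {u₀ : H} {x y : ℝ → H}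
    (hxm : AEStronglyMeasurable x (volume.restrict (Ioo 0 T)))
    (hym : AEStronglyMeasurable y (volume.restrict (Ioo 0 T)))
    (hxR : ∀ᵐ t ∂(volume.restrict (Ioo 0 T)), ‖x t‖ ≤ R)
    (hyR : ∀ᵐ t ∂(volume.restrict (Ioo 0 T)), ‖y t‖ ≤ R)
    (hx : ∀ᵐ t ∂(volume.restrict (Ioo 0 T)), Θ (x t) = u₀ + ∫ s in (0 : ℝ)..t, G (x s))
    (hy : ∀ᵐ t ∂(volume.restrict (Ioo 0 T)), Θ (y t) = u₀ + ∫ s in (0 : ℝ)..t, G (y s)) :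
    x =ᵐ[volume.restrict (Ioo 0 T)] y := by
  have hG := h.continuous
  obtain ⟨M, hM0, hM⟩ := h.exists_bound R
  obtain ⟨C, hC⟩ := h.mono R
  have hGx : AEStronglyMeasurable (fun t => G (x t)) (volume.restrict (Ioo 0 T)) :=
    hG.comp_aestronglyMeasurable hxm
  have hGy : AEStronglyMeasurable (fun t => G (y t)) (volume.restrict (Ioo 0 T)) :=
    hG.comp_aestronglyMeasurable hym
  have hix := intervalIntegrable_of_ae_bound hT hGx (hxR.mono fun t ht => hM _ ht)
  have hiy := intervalIntegrable_of_ae_bound hT hGy (hyR.mono fun t ht => hM _ ht)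
  have hmem : ∀ᵐ t ∂(volume.restrict (Ioo 0 T)), t ∈ Ioo 0 T :=
    ae_restrict_mem measurableSet_Ioo
  have hdiff : ∀ᵐ t ∂(volume.restrict (Ioo 0 T)),
      Θ (x t - y t) = ∫ s in (0 : ℝ)..t, (G (x s) - G (y s)) := by
    filter_upwards [hx, hy, hmem] with t h1 h2 ht
    have h0 : (0 : ℝ) ∈ Icc 0 T := ⟨le_rfl, hT⟩
    rw [map_sub, h1, h2, intervalIntegral.integral_sub
      (intervalIntegrable_sub hix h0 ⟨ht.1.le, ht.2.le⟩)
      (intervalIntegrable_sub hiy h0 ⟨ht.1.le, ht.2.le⟩)]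
    abel
  -- The primitive of `G x - G y` coincides almost everywhere with `Θ (x - y)`, so `mono` is
  -- precisely the hypothesis of `primitive_eq_zero`.
  have hz := fun t (ht : t ∈ Icc 0 T) => primitive_eq_zero (C := C) (M := M + M) hT
    (hGx.sub hGy)
    (by filter_upwards [hxR, hyR] with t h1 h2
        exact (norm_sub_le _ _).trans (add_le_add (hM _ h1) (hM _ h2)))
    (by filter_upwards [hxR, hyR, hdiff] with t h1 h2 h3
        have := hC _ _ h1 h2
        rw [h3] at this
        exact this) ht
  filter_upwards [hdiff, hmem] with t h1 ht
  have h2 := h1.trans (hz t ⟨ht.1.le, ht.2.le⟩)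
  rw [← map_zero Θ] at h2
  exact sub_eq_zero.mp (h.Θ_injective h2)

/-- After composition with the retraction the truncated field is bounded and globally Lipschitz, so
Picard–Lindelöf reaches any prescribed time. The solution stays in the range of `P n` because `P n ∘
W n = W n`, which makes `x - P n x` constant. -/
lemma exists_galerkin [CompleteSpace H] (n : ℕ) {R T : ℝ} (hR : 0 < R) (hT : 0 ≤ T) {x₀ : H}
    (hx₀ : P n x₀ = x₀) : ∃ x : ℝ → H, x 0 = x₀ ∧ ∀ t ∈ Icc 0 T,
      HasDerivAt x (W n (G (radial R (x t)))) t ∧ P n (x t) = x t := by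
  obtain ⟨M, hM0, hM⟩ := h.exists_bound R
  obtain ⟨K, hK⟩ := h.lip R
  set v : H → H := fun x => W n (G (radial R x)) with hv
  have hvb : ∀ x, ‖v x‖ ≤ ‖W n‖ * M := fun x =>
    ((W n).le_opNorm _).trans (by gcongr; exact hM _ (norm_radial_le hR x))
  have hvl : ∀ x y, ‖v x - v y‖ ≤ ‖W n‖ * (|K| * 2) * ‖x - y‖ := fun x y => by
    rw [hv]
    simp only
    rw [← map_sub, mul_assoc]
    refine ((W n).le_opNorm _).trans ?_
    gcongr
    refine (hK _ _ (norm_radial_le hR x) (norm_radial_le hR y)).trans ?_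
    rw [mul_assoc]
    exact mul_le_mul (le_abs_self K) (radial_lipschitz hR x y) (norm_nonneg _) (abs_nonneg _)
  set L : ℝ≥0 := ⟨‖W n‖ * M, by positivity⟩
  set L' : ℝ≥0 := ⟨‖W n‖ * (|K| * 2), by positivity⟩
  -- The larger interval `[-1, T + 1]` provides two-sided derivatives at the ends of `[0, T]`. The
  -- radius is the speed bound times the longer side `T + 1`.
  have hpl : IsPicardLindelof (fun _ => v) (tmin := -1) (tmax := T + 1)
      ⟨0, by constructor <;> linarith⟩ x₀ (L * ⟨T + 1, by linarith⟩) 0 L L' := by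
    refine IsPicardLindelof.of_time_independent (fun x _ => hvb x) ?_ ?_
    · refine LipschitzOnWith.of_dist_le_mul fun x _ y _ => ?_
      rw [dist_eq_norm, dist_eq_norm]
      exact hvl x y
    · simp only [sub_zero, zero_sub, neg_neg, NNReal.coe_zero]
      rw [max_eq_left (by linarith)]
      exact le_rfl
  obtain ⟨x, hx0, hx⟩ := hpl.exists_eq_forall_mem_Icc_hasDerivWithinAt₀
  have hd : ∀ t ∈ Icc 0 T, HasDerivAt x (v (x t)) t := fun t ht =>
    (hx t ⟨by linarith [ht.1], by linarith [ht.2]⟩).hasDerivAt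
      (Icc_mem_nhds (by linarith [ht.1]) (by linarith [ht.2]))
  refine ⟨x, hx0, fun t ht => ⟨hd t ht, ?_⟩⟩
  have hz : ∀ t ∈ Icc 0 T, HasDerivAt (fun t => x t - P n (x t)) 0 t := fun t ht => by
    have h1 := (hd t ht).sub ((P n).hasFDerivAt.comp_hasDerivAt t (hd t ht))
    have h2 : v (x t) - P n (v (x t)) = 0 := by rw [hv]; simp [h.P_W n n le_rfl]
    rwa [h2] at h1
  have h3 := constant_of_has_deriv_right_zero
    (fun t ht => (hz t ht).continuousAt.continuousWithinAt)
    (fun t ht => (hz t ⟨ht.1, ht.2.le⟩).hasDerivWithinAt) t ht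
  simp only [hx0] at h3
  rw [hx₀, sub_self] at h3
  exact (sub_eq_zero.mp h3).symm

/-- The truncated equations have solutions on a common time interval, with a common bound. -/
lemma exists_galerkin_bound [CompleteSpace H] (x₀ : H) : ∃ T > 0, ∃ R > 0, ∃ x : ℕ → ℝ → H,
    (∀ n, x n 0 = P n x₀) ∧ ∀ n, ∀ t ∈ Icc 0 T,
      HasDerivAt (x n) (W n (G (x n t))) t ∧ ‖x n t‖ ≤ R := by
  -- With `T = log 2 / K` the squared norm at most doubles, and `2 ‖x₀‖² ≤ R²`. The solution
  -- therefore never leaves the ball on which the retraction is the identity. The summand `1` in `K`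
  -- only ensures positivity.
  set R : ℝ := 2 * ‖x₀‖ + 1 with hRdef
  have hR : 0 < R := by positivity
  obtain ⟨C, hC⟩ := h.energy R
  set K : ℝ := 2 * |C| + 1 with hK
  have hKpos : 0 < K := by positivity
  set T : ℝ := Real.log 2 / K with hT
  have hTpos : 0 < T := div_pos (Real.log_pos one_lt_two) hKpos
  choose x hx0 hx using fun n => h.exists_galerkin n hR hTpos.le (h.P_P n x₀)
  refine ⟨T, hTpos, R, hR, x, hx0, fun n => ?_⟩
  have hb : ∀ t ∈ Icc 0 T, ‖x n t‖ ≤ R := fun t ht => by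
    have h1 := norm_sq_le_gronwallBound (K := K) (ε := 0) (δ := ‖x₀‖ ^ 2)
      (fun t ht => (hx n t ht).1)
      (by rw [hx0]; exact pow_le_pow_left₀ (norm_nonneg _) (h.norm_P_le n x₀) 2)
      (fun t ht => by
        set y := x n t
        set s : ℝ := R / max R ‖y‖ with hs
        have hmax : 0 < max R ‖y‖ := lt_max_of_lt_left hR
        have hspos : 0 < s := div_pos hR hmax
        have hs1 : s ≤ 1 := (div_le_one hmax).mpr (le_max_left _ _)
        have hr : radial R y = s • y := rfl
        have h2 := hC n (radial R y) (norm_radial_le hR y)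
          (by rw [hr, map_smul, (hx n t ht).2])
        -- The energy estimate is available at the retracted point `s • y` with `0 < s ≤ 1`.
        -- Dividing it by `s` gives a bound tested against `y` itself.
        have h3 : inner ℝ y (W n (G (radial R y))) ≤ |C| * ‖y‖ ^ 2 := by
          nth_rewrite 1 [hr] at h2
          rw [real_inner_smul_left, hr, norm_smul, Real.norm_of_nonneg hspos.le, mul_pow] at h2
          rw [hr]
          have h4 : inner ℝ y (W n (G (s • y))) ≤ C * s * ‖y‖ ^ 2 := by
            refine le_of_mul_le_mul_left ?_ hspos
            calc _ ≤ _ := h2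
              _ = _ := by ring
          refine h4.trans ?_
          gcongr
          calc C * s ≤ |C| * s := by gcongr; exact le_abs_self C
            _ ≤ |C| * 1 := by gcongr
            _ = |C| := mul_one _
        have : 0 ≤ ‖y‖ ^ 2 := by positivity
        nlinarith) ht
    rw [gronwallBound_ε0] at h1
    have h2 : Real.exp (K * t) ≤ 2 := by
      rw [← Real.le_log_iff_exp_le two_pos]
      have := ht.2
      rw [hT, le_div_iff₀ hKpos] at this
      linarith
    refine le_of_sq_le_sq (h1.trans ?_) hR.le
    rw [hRdef]
    nlinarith [norm_nonneg x₀, sq_nonneg ‖x₀‖]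
  exact fun t ht => ⟨by simpa [radial_of_le hR (hb t ht)] using (hx n t ht).1, hb t ht⟩

/-- `P n (G a) - P m (G b)` is `G a - G b`, controlled by `mono`, up to truncation errors. Moving
the projections onto `δ = Θ (a - b)` and using `tail` bounds these by `2 R M / (n + 1)` and `2 R M /
(m + 1)`; the derivative of the square doubles them. Thus the approximations are Cauchy in the rough
norm, without compactness. -/
lemma galerkin_close {T R M C : ℝ} {x₀ : H} {x : ℕ → ℝ → H}
    (hM : ∀ y, ‖y‖ ≤ R → ‖G y‖ ≤ M)
    (hC : ∀ x y, ‖x‖ ≤ R → ‖y‖ ≤ R → inner ℝ (Θ (x - y)) (G x - G y) ≤ C * ‖Θ (x - y)‖ ^ 2)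
    (hx0 : ∀ n, x n 0 = P n x₀)
    (hx : ∀ n, ∀ t ∈ Icc 0 T, HasDerivAt (x n) (W n (G (x n t))) t ∧ ‖x n t‖ ≤ R)
    (m n : ℕ) {t : ℝ} (ht : t ∈ Icc 0 T) :
    ‖Θ (x n t - x m t)‖ ^ 2 ≤ gronwallBound (‖Θ (P n x₀ - P m x₀)‖ ^ 2) (2 * C)
      (4 * R * M * (1 / (n + 1) + 1 / (m + 1))) t := by
  refine norm_sq_le_gronwallBound (x := fun t => Θ (x n t - x m t))
    (x' := fun t => P n (G (x n t)) - P m (G (x m t))) (T := T) (fun t ht => ?_)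
    (by simp [hx0]) (fun t ht => ?_) ht
  · have := Θ.hasFDerivAt.comp_hasDerivAt t ((hx n t ht).1.sub (hx m t ht).1)
    simpa [h.Θ_W, Function.comp_def] using this
  · set a := x n t
    set b := x m t
    have ha := (hx n t ht).2
    have hb := (hx m t ht).2
    set δ := Θ (a - b) with hδ
    have e : inner ℝ δ (P n (G a) - P m (G b)) = inner ℝ δ (G a - G b)
        - inner ℝ (δ - P n δ) (G a) + inner ℝ (δ - P m δ) (G b) := by
      simp only [inner_sub_right, inner_sub_left, h.P_symm]
      ring
    have hab : ‖a - b‖ ≤ 2 * R := (norm_sub_le _ _).trans (by linarith)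
    have hR0 : 0 ≤ R := (norm_nonneg _).trans ha
    have tl : ∀ (k : ℕ) (z : H), ‖G z‖ ≤ M →
        |inner ℝ (δ - P k δ) (G z)| ≤ 2 * R * M * (1 / (k + 1)) := fun k z hz => by
      refine (abs_real_inner_le_norm _ _).trans ?_
      calc ‖δ - P k δ‖ * ‖G z‖ ≤ (2 * R / (k + 1)) * M := by
            gcongr
            exact (h.tail k (a - b)).trans (by gcongr)
        _ = _ := by ring
    have t1 := (abs_le.mp (tl n a (hM a ha))).1
    have t2 := (abs_le.mp (tl m b (hM b hb))).2
    have t3 := hC a b ha hb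
    rw [e]
    linarith

/-- Local existence of a bounded solution of the integrated equation. -/
theorem exists_solution [CompleteSpace H] (x₀ : H) : ∃ T > 0, ∃ R, ∃ x : ℝ → H,
    (∀ t ∈ Icc 0 T, ‖x t‖ ≤ R) ∧ ContinuousOn (fun t => Θ (x t)) (Icc 0 T) ∧
    ContinuousOn (fun t => G (x t)) (Icc 0 T) ∧
    ∀ t ∈ Icc 0 T, Θ (x t) = Θ x₀ + ∫ s in (0 : ℝ)..t, G (x s) := by
  obtain ⟨T, hT, R, hR, x, hx0, hx⟩ := h.exists_galerkin_bound x₀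
  obtain ⟨M, hM0, hM⟩ := h.exists_bound R
  obtain ⟨C, hC⟩ := h.mono R
  have hclose := fun m n t ht => h.galerkin_close (t := t) hM hC hx0 hx m n ht
  have hcauchy : ∀ t ∈ Icc 0 T, CauchySeq fun n => Θ (x n t) := fun t ht => by
    have hlim : Tendsto (fun p : ℕ × ℕ => gronwallBound (‖Θ (P p.1 x₀ - P p.2 x₀)‖ ^ 2) (2 * C)
        (4 * R * M * (1 / ((p.1 : ℝ) + 1) + 1 / ((p.2 : ℝ) + 1))) t) (atTop ×ˢ atTop) (𝓝 0) := by
      have hc : Continuous fun q : ℝ × ℝ => gronwallBound q.1 (2 * C) q.2 t := by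
        by_cases hK : 2 * C = 0
        · simp only [gronwallBound, if_pos hK]; fun_prop
        · simp only [gronwallBound, if_neg hK]; fun_prop
      have h1 : Tendsto (fun p : ℕ × ℕ => ‖Θ (P p.1 x₀ - P p.2 x₀)‖ ^ 2) (atTop ×ˢ atTop)
          (𝓝 0) := by
        have := (((Θ.continuous.tendsto _).comp ((h.P_tendsto x₀).comp tendsto_fst |>.sub
          ((h.P_tendsto x₀).comp (tendsto_snd (f := (atTop : Filter ℕ))))))).norm.pow 2
        simpa [Function.comp_def] using this
      have h2 : Tendsto (fun p : ℕ × ℕ => 4 * R * M * (1 / ((p.1 : ℝ) + 1) + 1 / ((p.2 : ℝ) + 1)))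
          (atTop ×ˢ atTop) (𝓝 0) := by
        have h3 := tendsto_one_div_add_atTop_nhds_zero_nat (𝕜 := ℝ)
        have := ((h3.comp tendsto_fst).add
          (h3.comp (tendsto_snd (f := (atTop : Filter ℕ))))).const_mul (4 * R * M)
        simpa [Function.comp_def] using this
      have := (hc.tendsto (0, 0)).comp (h1.prodMk_nhds h2)
      simpa [Function.comp_def, gronwallBound_ε0] using this
    rw [cauchySeq_iff_tendsto_dist_atTop_0, ← prod_atTop_atTop_eq]
    have h4 := hlim.sqrt
    rw [Real.sqrt_zero] at h4
    refine squeeze_zero (fun _ => dist_nonneg) (fun p => ?_) h4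
    rw [dist_eq_norm, ← map_sub]
    exact Real.le_sqrt_of_sq_le (hclose p.2 p.1 t ht)
  have hlim : ∀ t ∈ Icc 0 T, ∃ y, Tendsto (fun n => Θ (x n t)) atTop (𝓝 (Θ y)) ∧ ‖y‖ ≤ R := by
    intro t ht
    obtain ⟨u, hu⟩ := cauchySeq_tendsto_of_complete (hcauchy t ht)
    -- Each `W n` is continuous for the rough limit, and `W n ∘ Θ = P n` transfers the uniform
    -- smooth bound to it.
    obtain ⟨y, rfl, hy⟩ := h.exists_Θ_eq (u := u) (R := R) fun n => by
      refine le_of_tendsto (((W n).continuous.tendsto u).comp hu).norm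
        (Eventually.of_forall fun k => ?_)
      simp only [Function.comp_apply, h.W_Θ]
      exact (h.norm_P_le _ _).trans (hx k t ht).2
    exact ⟨y, hu, hy⟩
  choose! y hy hyR using hlim
  have hGlim : ∀ t ∈ Icc 0 T, Tendsto (fun n => P n (G (x n t))) atTop (𝓝 (G (y t))) := by
    intro t ht
    -- The `x n t` converge only in the rough norm. `weak` compensates for this on bounded sets.
    have hG : Tendsto (fun n => G (x n t)) atTop (𝓝 (G (y t))) := by
      rw [tendsto_iff_norm_sub_tendsto_zero, Metric.tendsto_atTop]
      intro ε hε
      obtain ⟨C', hC'⟩ := h.weak R (ε / 2) (half_pos hε)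
      have h1 : Tendsto (fun n => C' * ‖Θ (x n t - y t)‖) atTop (𝓝 0) := by
        have := (tendsto_iff_norm_sub_tendsto_zero.mp (hy t ht)).const_mul C'
        simpa [map_sub] using this
      obtain ⟨N, hN⟩ := (h1.eventually (gt_mem_nhds (half_pos hε))).exists_forall_of_atTop
      refine ⟨N, fun n hn => ?_⟩
      rw [dist_zero_right, norm_norm]
      have := hC' _ _ (hx n t ht).2 (hyR t ht)
      linarith [hN n hn]
    have h2 : Tendsto (fun n => P n (G (x n t) - G (y t)) + P n (G (y t))) atTop
        (𝓝 (0 + G (y t))) := by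
      refine Tendsto.add ?_ (h.P_tendsto _)
      refine squeeze_zero_norm (fun n => h.norm_P_le n _) ?_
      exact tendsto_iff_norm_sub_tendsto_zero.mp hG
    simpa using h2
  have hcx : ∀ n, ContinuousOn (fun t => P n (G (x n t))) (Icc 0 T) := fun n =>
    (P n).continuous.comp_continuousOn (h.continuous.comp_continuousOn
      fun t ht => (hx n t ht).1.continuousAt.continuousWithinAt)
  have hint : ∀ n, ∀ t ∈ Icc 0 T, Θ (x n t) = Θ (P n x₀) + ∫ s in (0 : ℝ)..t, P n (G (x n s)) := by
    intro n t ht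
    have := intervalIntegral.integral_eq_sub_of_hasDerivAt (a := 0) (b := t)
      (f := fun t => Θ (x n t)) (f' := fun s => P n (G (x n s))) (fun s hs => by
        rw [uIcc_of_le ht.1] at hs
        have := Θ.hasFDerivAt.comp_hasDerivAt s (hx n s ⟨hs.1, hs.2.trans ht.2⟩).1
        simpa [h.Θ_W, Function.comp_def] using this)
      (((hcx n).mono (by rw [uIcc_of_le ht.1]; exact Icc_subset_Icc_right ht.2)).intervalIntegrable)
    rw [this, hx0]
    abel
  have hPM : ∀ n, ∀ t ∈ Icc 0 T, ‖P n (G (x n t))‖ ≤ M := fun n t ht =>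
    (h.norm_P_le _ _).trans (hM _ (hx n t ht).2)
  have hsol : ∀ t ∈ Icc 0 T, Θ (y t) = Θ x₀ + ∫ s in (0 : ℝ)..t, G (y s) := by
    intro t ht
    have hsub : uIoc 0 t ⊆ Icc 0 T := by
      rw [uIoc_of_le ht.1]
      exact fun s hs => ⟨hs.1.le, hs.2.trans ht.2⟩
    have h1 := intervalIntegral.tendsto_integral_filter_of_dominated_convergence
      (μ := volume) (a := 0) (b := t) (l := atTop) (F := fun n s => P n (G (x n s)))
      (f := fun s => G (y s)) (fun _ => M)
      (Eventually.of_forall fun n => ((hcx n).mono hsub).aestronglyMeasurable measurableSet_uIoc)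
      (Eventually.of_forall fun n => ae_of_all _ fun s hs => hPM n s (hsub hs))
      intervalIntegrable_const (ae_of_all _ fun s hs => hGlim s (hsub hs))
    have h2 := ((Θ.continuous.tendsto _).comp (h.P_tendsto x₀)).add h1
    refine tendsto_nhds_unique (hy t ht) ?_
    refine h2.congr fun n => ?_
    rw [hint n t ht]
    rfl
  have hmeas : AEStronglyMeasurable (fun t => G (y t)) (volume.restrict (Ioo 0 T)) := by
    refine aestronglyMeasurable_of_tendsto_ae atTop
      (fun n => ((hcx n).mono Ioo_subset_Icc_self).aestronglyMeasurable measurableSet_Ioo) ?_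
    filter_upwards [ae_restrict_mem measurableSet_Ioo] with t ht
    exact hGlim t ⟨ht.1.le, ht.2.le⟩
  have hcont : ContinuousOn (fun t => Θ (y t)) (Icc 0 T) := by
    have h1 := (absolutelyContinuous_primitive (M := M) hT.le hmeas (by
      filter_upwards [ae_restrict_mem measurableSet_Ioo] with t ht
      exact hM _ (hyR t ⟨ht.1.le, ht.2.le⟩))).continuousOn
    rw [uIcc_of_le hT.le] at h1
    exact (continuousOn_const.add h1).congr hsol
  -- Continuity of `y` itself in the smooth norm is not known. Continuity of `G ∘ y` follows from
  -- that of `Θ ∘ y` by `weak`.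
  refine ⟨T, hT, R, y, hyR, hcont, fun t ht => ?_, hsol⟩
  rw [ContinuousWithinAt, tendsto_iff_norm_sub_tendsto_zero, Metric.tendsto_nhds]
  intro ε hε
  obtain ⟨C', hC'⟩ := h.weak R (ε / 2) (half_pos hε)
  have h1 : Tendsto (fun s => C' * ‖Θ (y s - y t)‖) (𝓝[Icc 0 T] t) (𝓝 0) := by
    have := (tendsto_iff_norm_sub_tendsto_zero.mp (hcont t ht)).const_mul C'
    simpa [map_sub] using this
  filter_upwards [h1.eventually (gt_mem_nhds (half_pos hε)), self_mem_nhdsWithin] with s hs hsT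
  rw [dist_zero_right, norm_norm]
  have := hC' _ _ (hyR s hsT) (hyR t ht)
  linarith

end IsQuasilinear

end


/-! ### Young's inequality for convolutions -/

section Young

lemma eLpNorm_two_sq (f : ℝ → ℝ≥0∞) : eLpNorm f 2 volume ^ 2 = ∫⁻ x, f x ^ 2 := by
  rw [eLpNorm_eq_lintegral_rpow_enorm_toReal (by simp) (by simp)]
  rw [← ENNReal.rpow_natCast, ← ENNReal.rpow_mul]
  simp

/-- Cauchy–Schwarz. -/
lemma lintegral_mul_le_eLpNorm_two {f g : ℝ → ℝ≥0∞} (hf : Measurable f) (hg : Measurable g) :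
    ∫⁻ x, f x * g x ≤ eLpNorm f 2 volume * eLpNorm g 2 volume := by
  have := ENNReal.lintegral_mul_le_Lp_mul_Lq volume Real.HolderConjugate.two_two
    hf.aemeasurable hg.aemeasurable
  simpa [eLpNorm_eq_lintegral_rpow_enorm_toReal] using this

lemma measurable_lintegral_sub {f g : ℝ → ℝ≥0∞} (hf : Measurable f) (hg : Measurable g) :
    Measurable fun k => ∫⁻ l, f (k - l) * g l :=
  (show Measurable fun p : ℝ × ℝ => f (p.1 - p.2) * g p.2 by fun_prop).lintegral_prod_right'

/-- Young's inequality `‖f * g‖₂ ≤ ‖f‖₁ ‖g‖₂`. -/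
lemma eLpNorm_lintegral_sub_le {f g : ℝ → ℝ≥0∞} (hf : Measurable f) (hg : Measurable g) :
    eLpNorm (fun k => ∫⁻ l, f (k - l) * g l) 2 volume ≤ (∫⁻ x, f x) * eLpNorm g 2 volume := by
  have key : ∀ k, (∫⁻ l, f (k - l) * g l) ^ 2 ≤ (∫⁻ x, f x) * ∫⁻ l, f (k - l) * g l ^ 2 := by
    intro k
    -- Cauchy–Schwarz after splitting `f g = f^{1/2} · (f^{1/2} g)`.
    have h1 := lintegral_mul_le_eLpNorm_two (f := fun l => f (k - l) ^ (1 / 2 : ℝ))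
      (g := fun l => f (k - l) ^ (1 / 2 : ℝ) * g l) (by fun_prop) (by fun_prop)
    have hs : ∀ x : ℝ≥0∞, x ^ (1 / 2 : ℝ) * x ^ (1 / 2 : ℝ) = x := fun x => by
      rw [← ENNReal.rpow_add_of_nonneg _ _ (by norm_num) (by norm_num)]
      norm_num
    have h2 := pow_le_pow_left' h1 2
    rw [mul_pow, eLpNorm_two_sq, eLpNorm_two_sq] at h2
    simp only [← mul_assoc, hs, mul_pow, pow_two (_ ^ (1 / 2 : ℝ))] at h2
    rwa [lintegral_sub_left_eq_self f k] at h2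
  rw [← ENNReal.pow_le_pow_left_iff two_ne_zero, eLpNorm_two_sq, mul_pow, eLpNorm_two_sq]
  calc ∫⁻ k, (∫⁻ l, f (k - l) * g l) ^ 2
      ≤ ∫⁻ k, (∫⁻ x, f x) * ∫⁻ l, f (k - l) * g l ^ 2 := lintegral_mono key
    _ = (∫⁻ x, f x) * ∫⁻ k, ∫⁻ l, f (k - l) * g l ^ 2 :=
        lintegral_const_mul _ (measurable_lintegral_sub hf (by fun_prop))
    _ = (∫⁻ x, f x) * ∫⁻ l, ∫⁻ k, f (k - l) * g l ^ 2 := by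
        rw [lintegral_lintegral_swap]
        exact (show Measurable fun p : ℝ × ℝ => f (p.1 - p.2) * g p.2 ^ 2 by fun_prop).aemeasurable
    _ = (∫⁻ x, f x) * ∫⁻ l, (∫⁻ x, f x) * g l ^ 2 := by
        congr 1
        refine lintegral_congr fun l => ?_
        rw [lintegral_mul_const _ (by fun_prop), lintegral_sub_right_eq_self f l]
    _ = (∫⁻ x, f x) ^ 2 * ∫⁻ x, g x ^ 2 := by
        rw [lintegral_const_mul _ (by fun_prop)]
        ring

end Young

/-! ### The weight `θ` and bilinear operators on `L²` given by kernels -/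

/-- The weight `(1 + |ξ|)⁻¹`. -/
def θ (ξ : ℝ) : ℝ := (1 + |ξ|)⁻¹

lemma θ_pos (ξ : ℝ) : 0 < θ ξ := by unfold θ; positivity

lemma θ_le_one (ξ : ℝ) : θ ξ ≤ 1 := inv_le_one_of_one_le₀ (by linarith [abs_nonneg ξ])

@[simp] lemma θ_neg (ξ : ℝ) : θ (-ξ) = θ ξ := by simp [θ]

lemma θ_mul (ξ : ℝ) : θ ξ * (1 + |ξ|) = 1 := inv_mul_cancel₀ (by positivity)

@[fun_prop] lemma measurable_θ : Measurable θ := by unfold θ; fun_prop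

lemma memLp_θ : MemLp θ 2 volume := by
  rw [memLp_two_iff_integrable_sq measurable_θ.aestronglyMeasurable]
  have := integrable_one_add_norm (E := ℝ) (μ := volume) (r := 2) (by simp)
  refine this.congr (ae_of_all _ fun x => ?_)
  simp only [θ, Real.norm_eq_abs]
  rw [Real.rpow_neg (by positivity), inv_pow]
  norm_cast

/-- The norm of `θ` in `L²`. -/
def θNorm : ℝ := (eLpNorm θ 2 volume).toReal

lemma θNorm_nonneg : 0 ≤ θNorm := ENNReal.toReal_nonneg

lemma ofReal_θNorm : ENNReal.ofReal θNorm = eLpNorm θ 2 volume :=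
  ENNReal.ofReal_toReal memLp_θ.eLpNorm_ne_top

lemma L2.measurable (F : L2) : Measurable F := (Lp.stronglyMeasurable F).measurable

lemma L2.eLpNorm_eq (F : L2) : eLpNorm F 2 volume = ENNReal.ofReal ‖F‖ := by
  rw [Lp.norm_def, ENNReal.ofReal_toReal (Lp.eLpNorm_ne_top F)]

lemma L2.eLpNorm_enorm_coe (F : L2) : eLpNorm (fun x => ‖F x‖ₑ) 2 volume = ENNReal.ofReal ‖F‖ := by
  rw [eLpNorm_enorm, L2.eLpNorm_eq]

/-- Cauchy–Schwarz with `θ ∈ L²`. This is the Fourier side of the embedding of `H¹` into the bounded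
functions: a weighted transform is integrable. -/
lemma L2.lintegral_θ_le (F : L2) :
    ∫⁻ x, ENNReal.ofReal (θ x) * ‖F x‖ₑ ≤ ENNReal.ofReal (θNorm * ‖F‖) := by
  have hF := L2.measurable F
  refine (lintegral_mul_le_eLpNorm_two (by have := measurable_θ; fun_prop) (by fun_prop)).trans ?_
  rw [L2.eLpNorm_enorm_coe, ENNReal.ofReal_mul θNorm_nonneg, ofReal_θNorm, ← eLpNorm_enorm θ]
  simp [Real.enorm_eq_ofReal (θ_pos _).le]

/-- The convolution of `|F|` and `|G|` with a kernel. -/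
def majorant (σ : ℝ → ℝ → ℝ) (F G : ℝ → ℂ) (k : ℝ) : ℝ≥0∞ :=
  ∫⁻ l, ‖σ k l‖ₑ * (‖F (k - l)‖ₑ * ‖G l‖ₑ)

lemma measurable_majorant {σ : ℝ → ℝ → ℝ} (hσ : Measurable (Function.uncurry σ)) (F G : L2) :
    Measurable (majorant σ F G) := by
  have hF := L2.measurable F
  have hG := L2.measurable G
  exact (show Measurable fun p : ℝ × ℝ =>
    ‖Function.uncurry σ p‖ₑ * (‖F (p.1 - p.2)‖ₑ * ‖G p.2‖ₑ) by fun_prop).lintegral_prod_right'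

lemma majorant_swap (σ : ℝ → ℝ → ℝ) (F G : ℝ → ℂ) (k : ℝ) :
    majorant σ F G k = majorant (fun k l => σ k (k - l)) G F k := by
  unfold majorant
  rw [← lintegral_sub_left_eq_self _ k]
  simp [mul_comm]

/-- Young's inequality with `θ |F|` as the `L¹` factor. The weight `b` is moved to the second
argument, which allows that argument to be measured in a weaker norm. -/
lemma eLpNorm_majorant_le {σ : ℝ → ℝ → ℝ} {C : ℝ} (hC : 0 ≤ C) {b : ℝ → ℝ} {F G G' : L2}
    (hσ : ∀ k l, |σ k l| ≤ C * θ (k - l) * b l) (hG : ∀ᵐ l, b l * ‖G l‖ ≤ ‖G' l‖) :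
    eLpNorm (majorant σ F G) 2 volume ≤ ENNReal.ofReal (C * θNorm * ‖F‖ * ‖G'‖) := by
  have hF := L2.measurable F
  have hG' := L2.measurable G'
  have hθ := measurable_θ
  have h1 : ∀ k, majorant σ F G k ≤
      ∫⁻ l, (ENNReal.ofReal C * (ENNReal.ofReal (θ (k - l)) * ‖F (k - l)‖ₑ)) * ‖G' l‖ₑ := by
    intro k
    refine lintegral_mono_ae ?_
    filter_upwards [hG] with l hl
    simp only [← ofReal_norm]
    rw [← ENNReal.ofReal_mul (by positivity), ← ENNReal.ofReal_mul (by positivity),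
      ← ENNReal.ofReal_mul (θ_pos _).le, ← ENNReal.ofReal_mul hC,
      ← ENNReal.ofReal_mul (by have := θ_pos (k - l); positivity)]
    refine ENNReal.ofReal_le_ofReal ?_
    have hp := θ_pos (k - l)
    calc ‖σ k l‖ * (‖F (k - l)‖ * ‖G l‖)
        ≤ (C * θ (k - l) * b l) * (‖F (k - l)‖ * ‖G l‖) := by gcongr; exact hσ k l
      _ = C * θ (k - l) * ‖F (k - l)‖ * (b l * ‖G l‖) := by ring
      _ ≤ C * θ (k - l) * ‖F (k - l)‖ * ‖G' l‖ := by gcongr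
      _ = _ := by ring
  calc eLpNorm (majorant σ F G) 2 volume ≤ _ := eLpNorm_mono_enorm (fun k => by simpa using h1 k)
    _ ≤ _ := eLpNorm_lintegral_sub_le
        (f := fun x => ENNReal.ofReal C * (ENNReal.ofReal (θ x) * ‖F x‖ₑ)) (by fun_prop) (by fun_prop)
    _ ≤ (ENNReal.ofReal C * ENNReal.ofReal (θNorm * ‖F‖)) * ENNReal.ofReal ‖G'‖ := by
        rw [lintegral_const_mul _ (by fun_prop), L2.eLpNorm_enorm_coe]
        gcongr
        exact L2.lintegral_θ_le F
    _ = _ := by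
        have := θNorm_nonneg
        rw [← ENNReal.ofReal_mul hC, ← ENNReal.ofReal_mul (by positivity)]
        congr 1
        ring

/-- Admissible kernels of bilinear operators on `L²`. -/
structure IsKer (σ : ℝ → ℝ → ℝ) : Prop where
  measurable : Measurable (Function.uncurry σ)
  even : ∀ k l, σ (-k) (-l) = σ k l
  bound : ∃ C, 0 ≤ C ∧ ∀ k l, |σ k l| ≤ C * (θ (k - l) + θ l)

/-- The kernel splits into a part small in the first frequency and a part small in the second. The
swap `l ↦ k - l` reduces the second part to the first case. -/
lemma eLpNorm_majorant_le_add {σ : ℝ → ℝ → ℝ} {C : ℝ} (hC : 0 ≤ C)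
    (hb : ∀ k l, |σ k l| ≤ C * (θ (k - l) + θ l)) (F G : L2) :
    eLpNorm (majorant σ F G) 2 volume ≤ ENNReal.ofReal (2 * C * θNorm * ‖F‖ * ‖G‖) := by
  set σ₁ : ℝ → ℝ → ℝ := fun k l => C * θ (k - l) with hσ₁
  set σ₂ : ℝ → ℝ → ℝ := fun k l => C * θ l with hσ₂
  have hθ := measurable_θ
  have hm₁ : Measurable (Function.uncurry σ₁) := by
    simp only [hσ₁, Function.uncurry_def]; fun_prop
  have hm₂ : Measurable (Function.uncurry σ₂) := by
    simp only [hσ₂, Function.uncurry_def]; fun_prop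
  have hp := fun x => (θ_pos x).le
  have h1 : ∀ k, majorant σ F G k ≤ majorant σ₁ F G k + majorant σ₂ F G k := by
    intro k
    unfold majorant
    have hF := L2.measurable F
    have hG := L2.measurable G
    rw [← lintegral_add_left (by
      have : Measurable (σ₁ k) := hm₁.of_uncurry_left
      fun_prop)]
    refine lintegral_mono fun l => ?_
    rw [← add_mul]
    gcongr
    rw [Real.enorm_eq_ofReal (mul_nonneg hC (hp _)), Real.enorm_eq_ofReal (mul_nonneg hC (hp _)),
      ← ENNReal.ofReal_add (mul_nonneg hC (hp _)) (mul_nonneg hC (hp _)), ← mul_add,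
      ← ofReal_norm]
    exact ENNReal.ofReal_le_ofReal (hb k l)
  have h2 := eLpNorm_majorant_le (σ := σ₁) hC (b := fun _ => 1) (F := F) (G := G) (G' := G)
    (fun k l => by simp [hσ₁, abs_of_nonneg, hC, hp]) (by simp)
  have h3 : eLpNorm (majorant σ₂ F G) 2 volume ≤ ENNReal.ofReal (C * θNorm * ‖G‖ * ‖F‖) := by
    rw [show majorant σ₂ F G = majorant (fun k l => σ₂ k (k - l)) G F from
      funext fun k => majorant_swap σ₂ F G k]
    exact eLpNorm_majorant_le hC (b := fun _ => 1) (F := G) (G := F) (G' := F)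
      (fun k l => by simp [hσ₂, abs_of_nonneg, hC, hp]) (by simp)
  refine (eLpNorm_mono_enorm (g := majorant σ₁ F G + majorant σ₂ F G)
    fun k => by simpa using h1 k).trans ?_
  refine (eLpNorm_add_le (measurable_majorant hm₁ F G).aestronglyMeasurable
    (measurable_majorant hm₂ F G).aestronglyMeasurable (by simp)).trans ?_
  refine (add_le_add h2 h3).trans (le_of_eq ?_)
  have := θNorm_nonneg
  rw [← ENNReal.ofReal_add (by positivity) (by positivity)]
  congr 1
  ring

lemma IsKer.eLpNorm_majorant_lt_top {σ : ℝ → ℝ → ℝ} (hσ : IsKer σ) (F G : L2) :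
    eLpNorm (majorant σ F G) 2 volume < ⊤ :=
  let ⟨_, hC, hb⟩ := hσ.bound
  (eLpNorm_majorant_le_add hC hb F G).trans_lt ENNReal.ofReal_lt_top

/-- The convolution of `F` and `G` with a kernel. -/
def convKer (σ : ℝ → ℝ → ℝ) (F G : ℝ → ℂ) (k : ℝ) : ℂ := ∫ l, (σ k l : ℂ) * (F (k - l) * G l)

lemma enorm_convKer_le (σ : ℝ → ℝ → ℝ) (F G : ℝ → ℂ) (k : ℝ) :
    ‖convKer σ F G k‖ₑ ≤ majorant σ F G k := by
  refine (enorm_integral_le_lintegral_enorm _).trans (le_of_eq ?_)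
  refine lintegral_congr fun l => ?_
  rw [enorm_mul, enorm_mul, ← ofReal_norm, Complex.norm_real, ofReal_norm]

lemma convKer_swap (σ : ℝ → ℝ → ℝ) (F G : ℝ → ℂ) (k : ℝ) :
    convKer σ F G k = convKer (fun k l => σ k (k - l)) G F k := by
  unfold convKer
  rw [← integral_sub_left_eq_self _ volume k]
  simp [mul_comm]

lemma convKer_congr (σ : ℝ → ℝ → ℝ) {F F' G G' : ℝ → ℂ} (hF : F =ᵐ[volume] F')
    (hG : G =ᵐ[volume] G') : convKer σ F G = convKer σ F' G' := by
  funext k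
  refine integral_congr_ae ?_
  filter_upwards [(quasiMeasurePreserving_sub_left volume k).ae_eq_comp hF, hG] with l h1 h2
  simp only [Function.comp_apply] at h1
  rw [h1, h2]

lemma measurable_integrand {σ : ℝ → ℝ → ℝ} (hσ : Measurable (Function.uncurry σ)) (F G : L2) :
    Measurable fun p : ℝ × ℝ => (σ p.1 p.2 : ℂ) * (F (p.1 - p.2) * G p.2) := by
  have hF := L2.measurable F
  have hG := L2.measurable G
  have : Measurable fun p : ℝ × ℝ => σ p.1 p.2 := hσ
  fun_prop

lemma IsKer.memLp_convKer {σ : ℝ → ℝ → ℝ} (hσ : IsKer σ) (F G : L2) :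
    MemLp (convKer σ F G) 2 volume := by
  refine ⟨(StronglyMeasurable.integral_prod_right
    (measurable_integrand hσ.measurable F G).stronglyMeasurable).aestronglyMeasurable, ?_⟩
  refine (eLpNorm_mono_enorm (g := majorant σ F G) fun k => ?_).trans_lt
    (hσ.eLpNorm_majorant_lt_top F G)
  simpa using enorm_convKer_le σ F G k

/-- An `L²` function is finite almost everywhere; applied to the majorant, this makes the
convolution integral converge absolutely, as needed for its additivity. -/
lemma IsKer.ae_integrable {σ : ℝ → ℝ → ℝ} (hσ : IsKer σ) (F G : L2) :
    ∀ᵐ k, Integrable fun l => (σ k l : ℂ) * (F (k - l) * G l) := by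
  have h1 : ∀ᵐ k, majorant σ F G k < ⊤ := by
    have h2 : ∫⁻ k, majorant σ F G k ^ 2 ≠ ⊤ := by
      rw [← eLpNorm_two_sq]
      exact (ENNReal.pow_lt_top (hσ.eLpNorm_majorant_lt_top F G)).ne
    filter_upwards [ae_lt_top ((measurable_majorant hσ.measurable F G).pow_const 2) h2] with k hk
    exact lt_top_iff_ne_top.mpr fun h => by simp [h] at hk
  filter_upwards [h1] with k hk
  refine ⟨((measurable_integrand hσ.measurable F G).comp
    measurable_prodMk_left).aestronglyMeasurable, ?_⟩
  refine lt_of_le_of_lt (le_of_eq ?_) hk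
  refine lintegral_congr fun l => ?_
  simp only
  rw [enorm_mul, enorm_mul, ← ofReal_norm, Complex.norm_real, ofReal_norm]

/-- The bilinear operator on `L²` with a given kernel. -/
def bil {σ : ℝ → ℝ → ℝ} (hσ : IsKer σ) : L2 →ₗ[ℝ] L2 →ₗ[ℝ] L2 :=
  LinearMap.mk₂ ℝ (fun F G => (hσ.memLp_convKer F G).toLp _)
    (fun F F' G => by
      rw [← MemLp.toLp_add]
      refine MemLp.toLp_congr _ _ ?_
      filter_upwards [hσ.ae_integrable F G, hσ.ae_integrable F' G] with k h1 h2
      rw [convKer_congr σ (Lp.coeFn_add F F') (ae_eq_refl _), Pi.add_apply]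
      unfold convKer
      rw [← integral_add h1 h2]
      exact integral_congr_ae (ae_of_all _ fun l => by simp; ring))
    (fun c F G => by
      rw [← MemLp.toLp_const_smul]
      refine MemLp.toLp_congr _ _ (ae_of_all _ fun k => ?_)
      rw [convKer_congr σ (Lp.coeFn_smul c F) (ae_eq_refl _), Pi.smul_apply]
      unfold convKer
      rw [← integral_smul]
      exact integral_congr_ae (ae_of_all _ fun l => by simp; ring))
    (fun F G G' => by
      rw [← MemLp.toLp_add]
      refine MemLp.toLp_congr _ _ ?_
      filter_upwards [hσ.ae_integrable F G, hσ.ae_integrable F G'] with k h1 h2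
      rw [convKer_congr σ (ae_eq_refl _) (Lp.coeFn_add G G'), Pi.add_apply]
      unfold convKer
      rw [← integral_add h1 h2]
      exact integral_congr_ae (ae_of_all _ fun l => by simp; ring))
    (fun c F G => by
      rw [← MemLp.toLp_const_smul]
      refine MemLp.toLp_congr _ _ (ae_of_all _ fun k => ?_)
      rw [convKer_congr σ (ae_eq_refl _) (Lp.coeFn_smul c G), Pi.smul_apply]
      unfold convKer
      rw [← integral_smul]
      exact integral_congr_ae (ae_of_all _ fun l => by simp; ring))

lemma coeFn_bil {σ : ℝ → ℝ → ℝ} (hσ : IsKer σ) (F G : L2) :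
    bil hσ F G =ᵐ[volume] convKer σ F G := MemLp.coeFn_toLp (hσ.memLp_convKer F G)

lemma norm_bil_le_majorant {σ : ℝ → ℝ → ℝ} (hσ : IsKer σ) (F G : L2) {R : ℝ} (hR : 0 ≤ R)
    (h : eLpNorm (majorant σ F G) 2 volume ≤ ENNReal.ofReal R) : ‖bil hσ F G‖ ≤ R := by
  rw [← ENNReal.ofReal_le_ofReal_iff hR, ← L2.eLpNorm_eq, eLpNorm_congr_ae (coeFn_bil hσ F G)]
  refine le_trans (eLpNorm_mono_enorm fun k => ?_) h
  simpa using enorm_convKer_le σ F G k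

lemma norm_bil_le {σ : ℝ → ℝ → ℝ} (hσ : IsKer σ) {C : ℝ} (hC : 0 ≤ C)
    (hb : ∀ k l, |σ k l| ≤ C * (θ (k - l) + θ l)) (F G : L2) :
    ‖bil hσ F G‖ ≤ 2 * C * θNorm * ‖F‖ * ‖G‖ :=
  norm_bil_le_majorant hσ F G (by have := θNorm_nonneg; positivity)
    (eLpNorm_majorant_le_add hC hb F G)

/-- The kernel is small in the first frequency. -/
lemma norm_bil_le_left {σ : ℝ → ℝ → ℝ} (hσ : IsKer σ) {C : ℝ} (hC : 0 ≤ C) {b : ℝ → ℝ}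
    {F G G' : L2} (hb : ∀ k l, |σ k l| ≤ C * θ (k - l) * b l)
    (hG : ∀ᵐ l, b l * ‖G l‖ ≤ ‖G' l‖) : ‖bil hσ F G‖ ≤ C * θNorm * ‖F‖ * ‖G'‖ :=
  norm_bil_le_majorant hσ F G (by have := θNorm_nonneg; positivity) (eLpNorm_majorant_le hC hb hG)

/-- The kernel is small in the second frequency. -/
lemma norm_bil_le_right {σ : ℝ → ℝ → ℝ} (hσ : IsKer σ) {C : ℝ} (hC : 0 ≤ C) {b : ℝ → ℝ}
    {F F' G : L2} (hb : ∀ k l, |σ k l| ≤ C * θ l * b (k - l))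
    (hF : ∀ᵐ l, b l * ‖F l‖ ≤ ‖F' l‖) : ‖bil hσ F G‖ ≤ C * θNorm * ‖F'‖ * ‖G‖ := by
  refine (norm_bil_le_majorant hσ F G (R := C * θNorm * ‖G‖ * ‖F'‖)
    (by have := θNorm_nonneg; positivity) ?_).trans (le_of_eq (by ring))
  rw [show majorant σ F G = majorant (fun k l => σ k (k - l)) G F from
    funext fun k => majorant_swap σ F G k]
  exact eLpNorm_majorant_le hC (fun k l => by simpa using hb k (k - l)) hF

lemma bil_swap {σ τ : ℝ → ℝ → ℝ} (hσ : IsKer σ) (hτ : IsKer τ) (h : ∀ k l, τ k l = σ k (k - l))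
    (F G : L2) : bil hσ F G = bil hτ G F := by
  refine Lp.ext ?_
  filter_upwards [coeFn_bil hσ F G, coeFn_bil hτ G F] with k h1 h2
  rw [h1, h2, convKer_swap, show τ = fun k l => σ k (k - l) from funext₂ h]

lemma bil_add_kernel {σ τ ρ : ℝ → ℝ → ℝ} (hσ : IsKer σ) (hτ : IsKer τ) (hρ : IsKer ρ)
    (h : ∀ k l, ρ k l = σ k l + τ k l) (F G : L2) : bil hρ F G = bil hσ F G + bil hτ F G := by
  refine Lp.ext ?_
  filter_upwards [coeFn_bil hσ F G, coeFn_bil hτ F G, coeFn_bil hρ F G,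
    Lp.coeFn_add (bil hσ F G) (bil hτ F G), hσ.ae_integrable F G, hτ.ae_integrable F G]
    with k h1 h2 h3 h4 h5 h6
  rw [h3, h4, Pi.add_apply, h1, h2]
  unfold convKer
  rw [← integral_add h5 h6]
  exact integral_congr_ae (ae_of_all _ fun l => by simp [h]; ring)

/-- Multipliers on the two inputs and on the output only change the kernel. Every later comparison
of quadratic terms thereby becomes a pointwise identity of kernels. -/
lemma bil_eq_of_kernel {σ τ : ℝ → ℝ → ℝ} (hσ : IsKer σ) (hτ : IsKer τ) {F G F' G' : L2}
    {a b c : ℝ → ℝ} (hF : F =ᵐ[volume] fun ξ => a ξ * F' ξ) (hG : G =ᵐ[volume] fun ξ => b ξ * G' ξ)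
    (h : ∀ k l, c k * σ k l * (a (k - l) * b l) = τ k l) :
    ∀ᵐ k, (c k : ℂ) * bil hσ F G k = bil hτ F' G' k := by
  filter_upwards [coeFn_bil hσ F G, coeFn_bil hτ F' G'] with k h1 h2
  rw [h1, h2, convKer_congr σ hF hG]
  unfold convKer
  rw [← integral_const_mul]
  refine integral_congr_ae (ae_of_all _ fun l => ?_)
  simp only [← h]
  push_cast
  ring


/-! ### Multiplication operators and the real Hilbert space of hermitian functions -/

/-- Bounded measurable symbols. -/
structure IsMul (φ : ℝ → ℂ) : Prop where
  measurable : Measurable φ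
  bound : ∃ C, 0 ≤ C ∧ ∀ ξ, ‖φ ξ‖ ≤ C

lemma IsMul.memLp {φ : ℝ → ℂ} (h : IsMul φ) (F : L2) :
    MemLp (fun ξ => φ ξ * F ξ) 2 volume := by
  obtain ⟨C, -, hC⟩ := h.bound
  refine (Lp.memLp F).of_le_mul (c := C)
    (h.measurable.mul (L2.measurable F)).aestronglyMeasurable (ae_of_all _ fun ξ => ?_)
  rw [norm_mul]
  gcongr
  exact hC ξ

/-- Multiplication by a bounded measurable function. -/
def mulOp {φ : ℝ → ℂ} (h : IsMul φ) : L2 →L[ℝ] L2 :=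
  LinearMap.mkContinuousOfExistsBound
    { toFun := fun F => (h.memLp F).toLp _
      map_add' := fun F G => by
        rw [← MemLp.toLp_add]
        refine MemLp.toLp_congr _ _ ?_
        filter_upwards [Lp.coeFn_add F G] with ξ hξ
        simp only [hξ, Pi.add_apply, mul_add]
      map_smul' := fun c F => by
        rw [RingHom.id_apply, ← MemLp.toLp_const_smul]
        refine MemLp.toLp_congr _ _ ?_
        filter_upwards [Lp.coeFn_smul c F] with ξ hξ
        simp only [hξ, Pi.smul_apply, Complex.real_smul]
        ring }
    (by
      obtain ⟨C, -, hC⟩ := h.bound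
      refine ⟨C, fun F => Lp.norm_le_mul_norm_of_ae_le_mul ?_⟩
      simp only [LinearMap.coe_mk, AddHom.coe_mk]
      filter_upwards [MemLp.coeFn_toLp (h.memLp F)] with ξ hξ
      rw [hξ, norm_mul]
      gcongr
      exact hC ξ)

lemma coeFn_mulOp {φ : ℝ → ℂ} (h : IsMul φ) (F : L2) :
    mulOp h F =ᵐ[volume] fun ξ => φ ξ * F ξ := MemLp.coeFn_toLp (h.memLp F)

lemma norm_mulOp_le {φ : ℝ → ℂ} (h : IsMul φ) {C : ℝ} (hC : ∀ ξ, ‖φ ξ‖ ≤ C) (F : L2) :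
    ‖mulOp h F‖ ≤ C * ‖F‖ := by
  refine Lp.norm_le_mul_norm_of_ae_le_mul ?_
  filter_upwards [coeFn_mulOp h F] with ξ hξ
  rw [hξ, norm_mul]
  gcongr
  exact hC ξ

lemma norm_mulOp_le_mulOp {φ ψ : ℝ → ℂ} (h : IsMul φ) (h' : IsMul ψ) {C : ℝ}
    (hC : ∀ ξ, ‖φ ξ‖ ≤ C * ‖ψ ξ‖) (F : L2) : ‖mulOp h F‖ ≤ C * ‖mulOp h' F‖ := by
  refine Lp.norm_le_mul_norm_of_ae_le_mul ?_
  filter_upwards [coeFn_mulOp h F, coeFn_mulOp h' F] with ξ h1 h2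
  rw [h1, h2, norm_mul, norm_mul, ← mul_assoc]
  gcongr
  exact hC ξ

/-- `F ↦ conj F(-·)` on `L²`. -/
def reflConj : L2 →L[ℝ] L2 :=
  (ContinuousLinearMap.compLpL 2 volume (Complex.conjCLE : ℂ →L[ℝ] ℂ)).comp
    (Lp.compMeasurePreservingₗᵢ ℝ (fun x : ℝ => -x)
      (Measure.measurePreserving_neg volume)).toContinuousLinearMap

lemma coeFn_reflConj (F : L2) :
    reflConj F =ᵐ[volume] fun ξ => (starRingEnd ℂ) (F (-ξ)) := by
  have h1 := ContinuousLinearMap.coeFn_compLpL (p := 2) (μ := volume) (Complex.conjCLE : ℂ →L[ℝ] ℂ)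
    (Lp.compMeasurePreservingₗᵢ ℝ (fun x : ℝ => -x) (Measure.measurePreserving_neg volume) F)
  have h2 := Lp.coeFn_compMeasurePreserving F (Measure.measurePreserving_neg (volume : Measure ℝ))
  filter_upwards [h1, h2] with ξ h1 h2
  refine Eq.trans h1 ?_
  rw [show (Lp.compMeasurePreservingₗᵢ ℝ (fun x : ℝ => -x)
    (Measure.measurePreserving_neg volume) F) = Lp.compMeasurePreserving _ _ F from rfl, h2]
  rfl

/-- The real Hilbert space of Fourier transforms of real functions. -/
def Hm : Submodule ℝ L2 := (reflConj - ContinuousLinearMap.id ℝ L2).ker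

instance : CompleteSpace Hm :=
  ContinuousLinearMap.completeSpace_ker (reflConj - ContinuousLinearMap.id ℝ L2)

lemma mem_Hm_iff' {F : L2} : F ∈ Hm ↔ reflConj F = F := by
  rw [Hm, LinearMap.mem_ker]
  simp [sub_eq_zero]

lemma mem_Hm_iff {F : L2} : F ∈ Hm ↔ ∀ᵐ ξ, F (-ξ) = (starRingEnd ℂ) (F ξ) := by
  rw [mem_Hm_iff']
  constructor
  · intro h
    have := coeFn_reflConj F
    rw [h] at this
    filter_upwards [this] with ξ hξ
    rw [hξ, Complex.conj_conj]
  · intro h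
    refine Lp.ext ?_
    filter_upwards [coeFn_reflConj F, h] with ξ h1 h2
    rw [h1, h2, Complex.conj_conj]

lemma mulOp_mem_Hm {φ : ℝ → ℂ} (h : IsMul φ) (hφ : ∀ ξ, φ (-ξ) = (starRingEnd ℂ) (φ ξ)) {F : L2}
    (hF : F ∈ Hm) : mulOp h F ∈ Hm := by
  rw [mem_Hm_iff] at hF ⊢
  have h1 := coeFn_mulOp h F
  filter_upwards [hF, h1, (Measure.measurePreserving_neg volume).quasiMeasurePreserving.ae_eq_comp h1]
    with ξ h2 h3 h4
  simp only [Function.comp_apply] at h4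
  rw [h4, h3, h2, hφ, map_mul]

/-- A real kernel that is even under `(k, l) ↦ (-k, -l)` commutes with `F ↦ conj F(-·)`. This is why
evenness belongs to `IsKer`. -/
lemma bil_mem_Hm {σ : ℝ → ℝ → ℝ} (hσ : IsKer σ) {F G : L2} (hF : F ∈ Hm) (hG : G ∈ Hm) :
    bil hσ F G ∈ Hm := by
  rw [mem_Hm_iff] at hF hG ⊢
  have h1 := coeFn_bil hσ F G
  filter_upwards [h1, (Measure.measurePreserving_neg volume).quasiMeasurePreserving.ae_eq_comp h1]
    with k h2 h3
  simp only [Function.comp_apply] at h3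
  rw [h3, h2]
  unfold convKer
  rw [← integral_conj, ← integral_neg_eq_self]
  refine integral_congr_ae ?_
  filter_upwards [hG, (quasiMeasurePreserving_sub_left volume k).ae hF] with l h4 h5
  simp only [map_mul, Complex.conj_ofReal]
  rw [hσ.even, show -k - -l = -(k - l) by ring, h4, h5]

/-- The operator `mulOp` on `Hm`. -/
def mulH {φ : ℝ → ℂ} (h : IsMul φ) (hφ : ∀ ξ, φ (-ξ) = (starRingEnd ℂ) (φ ξ)) : Hm →L[ℝ] Hm :=
  ((mulOp h).comp Hm.subtypeL).codRestrict Hm fun F => mulOp_mem_Hm h hφ F.2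

@[simp] lemma coe_mulH {φ : ℝ → ℂ} (h : IsMul φ) (hφ : ∀ ξ, φ (-ξ) = (starRingEnd ℂ) (φ ξ))
    (F : Hm) : (mulH h hφ F : L2) = mulOp h F := rfl

/-- The operator `bil` on `Hm`. -/
def bilH {σ : ℝ → ℝ → ℝ} (hσ : IsKer σ) : Hm →ₗ[ℝ] Hm →ₗ[ℝ] Hm :=
  LinearMap.mk₂ ℝ (fun F G => ⟨bil hσ F G, bil_mem_Hm hσ F.2 G.2⟩)
    (fun _ _ _ => Subtype.ext (by simp)) (fun _ _ _ => Subtype.ext (by simp))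
    (fun _ _ _ => Subtype.ext (by simp)) (fun _ _ _ => Subtype.ext (by simp))

@[simp] lemma coe_bilH {σ : ℝ → ℝ → ℝ} (hσ : IsKer σ) (F G : Hm) :
    (bilH hσ F G : L2) = bil hσ F G := rfl

/-! ### Trilinear forms and the gain from symmetrization -/

section Form

lemma memLp_norm (F : L2) : MemLp (fun ξ => ((‖F ξ‖ : ℝ) : ℂ)) 2 volume :=
  (Lp.memLp F).norm.ofReal

/-- The absolute value of an `L²` function. -/
def absL (F : L2) : L2 := (memLp_norm F).toLp _

lemma coeFn_absL (F : L2) : absL F =ᵐ[volume] fun ξ => ((‖F ξ‖ : ℝ) : ℂ) :=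
  MemLp.coeFn_toLp (memLp_norm F)

lemma norm_absL (F : L2) : ‖absL F‖ = ‖F‖ := by
  rw [Lp.norm_def, Lp.norm_def, eLpNorm_congr_norm_ae (g := F)]
  filter_upwards [coeFn_absL F] with ξ h
  simp [h]

/-- The integrand of the trilinear form of a kernel. -/
def formIntegrand (σ : ℝ → ℝ → ℝ) (D F G : ℝ → ℂ) (p : ℝ × ℝ) : ℝ :=
  σ p.1 p.2 * ((starRingEnd ℂ) (D p.1) * (F (p.1 - p.2) * G p.2)).re

lemma integrable_form {σ : ℝ → ℝ → ℝ} (hσ : IsKer σ) (D F G : L2) :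
    Integrable (formIntegrand σ D F G) (volume.prod volume) := by
  have hD := L2.measurable D
  have hF := L2.measurable F
  have hG := L2.measurable G
  have hm : Measurable fun p : ℝ × ℝ => (starRingEnd ℂ) (D p.1) * ((σ p.1 p.2 : ℂ) *
      (F (p.1 - p.2) * G p.2)) :=
    (Complex.continuous_conj.measurable.comp (hD.comp measurable_fst)).mul
      (measurable_integrand hσ.measurable F G)
  have hi : Integrable (fun p : ℝ × ℝ => (starRingEnd ℂ) (D p.1) * ((σ p.1 p.2 : ℂ) *
      (F (p.1 - p.2) * G p.2))) (volume.prod volume) := by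
    refine ⟨hm.aestronglyMeasurable, ?_⟩
    rw [hasFiniteIntegral_iff_enorm, lintegral_prod _ hm.enorm.aemeasurable]
    have : ∀ k, ∫⁻ l, ‖(starRingEnd ℂ) (D k) * ((σ k l : ℂ) * (F (k - l) * G l))‖ₑ =
        ‖D k‖ₑ * majorant σ F G k := fun k => by
      have hσk : Measurable (σ k) := hσ.measurable.of_uncurry_left
      unfold majorant
      rw [← lintegral_const_mul _ (by fun_prop)]
      refine lintegral_congr fun l => ?_
      rw [enorm_mul, enorm_mul, enorm_mul, ← ofReal_norm (σ k l : ℂ), Complex.norm_real,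
        ofReal_norm, RCLike.enorm_conj]
    simp only [this]
    refine (lintegral_mul_le_eLpNorm_two hD.enorm (measurable_majorant hσ.measurable F G)).trans_lt
      (ENNReal.mul_lt_top ?_ (hσ.eLpNorm_majorant_lt_top F G))
    rw [L2.eLpNorm_enorm_coe]
    exact ENNReal.ofReal_lt_top
  refine hi.re.congr (ae_of_all _ fun p => ?_)
  simp only [formIntegrand, RCLike.re_to_complex]
  rw [← Complex.re_ofReal_mul]
  congr 1
  ring

lemma inner_bil {σ : ℝ → ℝ → ℝ} (hσ : IsKer σ) (D F G : L2) :
    inner ℝ D (bil hσ F G) = ∫ p, formIntegrand σ D F G p ∂(volume.prod volume) := by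
  rw [integral_prod _ (integrable_form hσ D F G), L2.inner_def]
  refine integral_congr_ae ?_
  filter_upwards [coeFn_bil hσ F G, hσ.ae_integrable F G] with k h1 h2
  rw [h1, Complex.inner, mul_comm]
  unfold convKer
  rw [← integral_const_mul, ← RCLike.re_to_complex, ← integral_re (h2.const_mul _)]
  refine integral_congr_ae (ae_of_all _ fun l => ?_)
  simp only [formIntegrand, RCLike.re_to_complex]
  rw [← Complex.re_ofReal_mul]
  congr 1
  ring

/-- The kernel of a pointwise product whose first factor has transform `θ F`; it also majorizes the
symmetrized forms. -/
lemma isKer_θ : IsKer fun k l => θ (k - l) where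
  measurable := by
    have := measurable_θ
    simp only [Function.uncurry_def]
    fun_prop
  even k l := by rw [show -k - -l = -(k - l) by ring, θ_neg]
  bound := ⟨1, zero_le_one, fun k l => by
    rw [abs_of_pos (θ_pos _), one_mul]
    exact le_add_of_nonneg_right (θ_pos l).le⟩

/-- A form with a nearly antisymmetric kernel and a real coefficient gains a derivative. -/
lemma abs_inner_bil_le {τ : ℝ → ℝ → ℝ} (hτ : IsKer τ) {C : ℝ} (hC : 0 ≤ C) {a : ℝ → ℝ}
    (ha : ∀ ξ, 0 ≤ a ξ) (hb : ∀ k l, |τ k l + τ l k| ≤ C * θ (k - l) * (a k * a l)) {S E E' : L2}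
    (hS : S ∈ Hm) (hE : E' =ᵐ[volume] fun ξ => (a ξ : ℂ) * E ξ) :
    |inner ℝ E (bil hτ S E)| ≤ C * θNorm * ‖S‖ * ‖E'‖ ^ 2 := by
  have hi := integrable_form hτ E S E
  set g : ℝ × ℝ → ℝ := fun p => (τ p.1 p.2 + τ p.2 p.1) *
    ((starRingEnd ℂ) (E p.1) * (S (p.1 - p.2) * E p.2)).re with hg
  -- Exchanging the two frequencies conjugates the product, because `S (l - k) = conj (S (k - l))`
  -- for hermitian `S`. The real part is unchanged, so twice the form is the form with kernel `τ k l
  -- + τ l k`.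
  have hswap : ∀ᵐ p ∂((volume : Measure ℝ).prod (volume : Measure ℝ)),
      formIntegrand τ E S E p + formIntegrand τ E S E p.swap = g p := by
    filter_upwards [(quasiMeasurePreserving_sub (volume : Measure ℝ) volume).ae
      (mem_Hm_iff.mp hS)] with p hp
    simp only [formIntegrand, hg, Prod.fst_swap, Prod.snd_swap]
    rw [add_mul, show p.2 - p.1 = -(p.1 - p.2) by ring, hp]
    congr 2
    rw [← Complex.conj_re]
    simp only [map_mul, Complex.conj_conj]
    congr 1
    ring
  have h2 : 2 * inner ℝ E (bil hτ S E) = ∫ p, g p ∂(volume.prod volume) := by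
    have := integral_prod_swap (μ := volume) (ν := volume) (formIntegrand τ E S E)
    rw [← integral_congr_ae hswap, show (∫ p, formIntegrand τ E S E p + formIntegrand τ E S E p.swap
      ∂((volume : Measure ℝ).prod volume)) = _ from integral_add hi hi.swap]
    rw [this, inner_bil]
    ring
  have hgi : Integrable g (volume.prod volume) := (hi.add hi.swap).congr hswap
  have haE : absL E' =ᵐ[volume] fun ξ => ((a ξ * ‖E ξ‖ : ℝ) : ℂ) := by
    filter_upwards [coeFn_absL E', hE] with ξ h1 h2
    rw [h1, h2, norm_mul, Complex.norm_real, Real.norm_of_nonneg (ha ξ)]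
  have hq1 := Measure.quasiMeasurePreserving_fst (μ := (volume : Measure ℝ)) (ν := (volume : Measure ℝ))
  have hq2 := Measure.quasiMeasurePreserving_snd (μ := (volume : Measure ℝ)) (ν := (volume : Measure ℝ))
  -- Only absolute values matter after symmetrization. The weights `a k`, `a l` are absorbed in
  -- `E'`, and the kernel `θ (k - l)` is left.
  have hpt : ∀ᵐ p ∂((volume : Measure ℝ).prod (volume : Measure ℝ)),
      |g p| ≤ C * formIntegrand (fun k l => θ (k - l)) (absL E') (absL S) (absL E') p := by
    filter_upwards [(quasiMeasurePreserving_sub (volume : Measure ℝ) volume).ae (coeFn_absL S),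
      hq1.ae haE, hq2.ae haE] with p h3 h4 h5
    simp only [formIntegrand]
    rw [h3, h4, h5, Complex.conj_ofReal, ← Complex.ofReal_mul, ← Complex.ofReal_mul,
      Complex.ofReal_re, hg]
    simp only
    rw [abs_mul]
    have h6 := Complex.abs_re_le_norm ((starRingEnd ℂ) (E p.1) * (S (p.1 - p.2) * E p.2))
    rw [norm_mul, norm_mul, RCLike.norm_conj] at h6
    refine (mul_le_mul (hb p.1 p.2) h6 (abs_nonneg _) ?_).trans (le_of_eq (by ring))
    have := θ_pos (p.1 - p.2)
    have := ha p.1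
    have := ha p.2
    positivity
  have h3 : |2 * inner ℝ E (bil hτ S E)| ≤ C * inner ℝ (absL E') (bil isKer_θ (absL S) (absL E')) := by
    rw [h2, inner_bil, ← integral_const_mul]
    refine (abs_integral_le_integral_abs).trans ?_
    exact integral_mono_ae hgi.abs ((integrable_form isKer_θ _ _ _).const_mul C) hpt
  have h4 := norm_bil_le_left isKer_θ zero_le_one (b := fun _ => 1) (F := absL S) (G := absL E')
    (G' := absL E') (fun k l => by simp [abs_of_pos (θ_pos _)]) (by simp)
  have h5 := (real_inner_le_norm (absL E') (bil isKer_θ (absL S) (absL E')))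
  rw [norm_absL] at h5
  rw [norm_absL, norm_absL] at h4
  have h6 : inner ℝ (absL E') (bil isKer_θ (absL S) (absL E')) ≤ θNorm * ‖S‖ * ‖E'‖ ^ 2 := by
    calc _ ≤ _ := h5
      _ ≤ ‖E'‖ * (1 * θNorm * ‖S‖ * ‖E'‖) := by gcongr
      _ = _ := by ring
  rw [abs_mul, abs_two] at h3
  have h7 : C * inner ℝ (absL E') (bil isKer_θ (absL S) (absL E')) ≤
      C * (θNorm * ‖S‖ * ‖E'‖ ^ 2) := by gcongr
  have := abs_nonneg (inner ℝ E (bil hτ S E))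
  linarith

end Form


section Symbols

lemma isMul_ofReal {f : ℝ → ℝ} (hf : Measurable f) {C : ℝ} (hC : ∀ ξ, |f ξ| ≤ C) :
    IsMul fun ξ => (f ξ : ℂ) :=
  ⟨Complex.measurable_ofReal.comp hf, C, (abs_nonneg _).trans (hC 0), fun ξ => by
    rw [Complex.norm_real]; exact hC ξ⟩

lemma conj_ofReal_even {f : ℝ → ℝ} (hf : ∀ ξ, f (-ξ) = f ξ) (ξ : ℝ) :
    ((f (-ξ) : ℝ) : ℂ) = (starRingEnd ℂ) (f ξ) := by rw [Complex.conj_ofReal, hf]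

lemma mulOp_comp {φ ψ ρ : ℝ → ℂ} (hφ : IsMul φ) (hψ : IsMul ψ) (hρ : IsMul ρ)
    (h : ∀ ξ, φ ξ * ψ ξ = ρ ξ) (F : L2) : mulOp hφ (mulOp hψ F) = mulOp hρ F := by
  refine Lp.ext ?_
  filter_upwards [coeFn_mulOp hφ (mulOp hψ F), coeFn_mulOp hψ F, coeFn_mulOp hρ F] with ξ h1 h2 h3
  rw [h1, h2, h3, ← h, mul_assoc]

lemma inner_mulOp_right {φ : ℝ → ℂ} (hφ : IsMul φ) (h : ∀ ξ, (starRingEnd ℂ) (φ ξ) = φ ξ)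
    (F G : L2) : inner ℝ F (mulOp hφ G) = inner ℝ (mulOp hφ F) G := by
  rw [L2.inner_def, L2.inner_def]
  refine integral_congr_ae ?_
  filter_upwards [coeFn_mulOp hφ F, coeFn_mulOp hφ G] with ξ h1 h2
  rw [h1, h2, Complex.inner, Complex.inner, map_mul, h]
  congr 1
  ring

/-- The two functions are orthogonal at each frequency. This removes the term `α Λ f_tx`, whose
symbol is purely imaginary, from every energy identity. -/
lemma inner_mulOp_eq_zero {φ ψ : ℝ → ℂ} (hφ : IsMul φ) (hψ : IsMul ψ)
    (h : ∀ ξ, (ψ ξ * (starRingEnd ℂ) (φ ξ)).re = 0) (F : L2) :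
    inner ℝ (mulOp hφ F) (mulOp hψ F) = 0 := by
  rw [L2.inner_def, ← integral_zero ℝ ℝ]
  refine integral_congr_ae ?_
  filter_upwards [coeFn_mulOp hφ F, coeFn_mulOp hψ F] with ξ h1 h2
  rw [h1, h2, Complex.inner, map_mul]
  rw [show ψ ξ * F ξ * ((starRingEnd ℂ) (φ ξ) * (starRingEnd ℂ) (F ξ)) =
    (ψ ξ * (starRingEnd ℂ) (φ ξ)) * ((Complex.normSq (F ξ) : ℝ) : ℂ) by
      rw [Complex.normSq_eq_conj_mul_self]; ring, Complex.re_mul_ofReal, h, zero_mul]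

lemma L2.norm_sq_eq (F : L2) : ‖F‖ ^ 2 = ∫ x, ‖F x‖ ^ 2 := by
  rw [← real_inner_self_eq_norm_sq, L2.inner_def]
  simp only [real_inner_self_eq_norm_sq]

/-! ### The symbols of the linear part -/

/-- The angular frequency `|2πξ|`. -/
def κ (ξ : ℝ) : ℝ := |2 * Real.pi * ξ|

lemma κ_eq (ξ : ℝ) : κ ξ = 2 * Real.pi * |ξ| := by
  rw [κ, abs_mul, abs_of_pos Real.two_pi_pos]

lemma κ_nonneg (ξ : ℝ) : 0 ≤ κ ξ := abs_nonneg _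

@[simp] lemma κ_neg (ξ : ℝ) : κ (-ξ) = κ ξ := by simp [κ]

@[fun_prop] lemma measurable_κ : Measurable κ := by unfold κ; fun_prop

/-- `√(1 + k + |β| k³)` with `k` the angular frequency: the symmetrizer of the linear part. -/
def μ (β ξ : ℝ) : ℝ := Real.sqrt (1 + κ ξ + |β| * κ ξ ^ 3)

lemma μ_sq (β ξ : ℝ) : μ β ξ ^ 2 = 1 + κ ξ + |β| * κ ξ ^ 3 := by
  have := κ_nonneg ξ
  exact Real.sq_sqrt (by positivity)

/-- The summand `1` in `μ²` keeps the symmetrizer invertible at frequency zero. It costs only a term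
of order zero in the equation. -/
lemma one_le_μ (β ξ : ℝ) : 1 ≤ μ β ξ := by
  have := κ_nonneg ξ
  refine Real.one_le_sqrt.mpr ?_
  have : 0 ≤ |β| * κ ξ ^ 3 := by positivity
  linarith

lemma μ_pos (β ξ : ℝ) : 0 < μ β ξ := one_pos.trans_le (one_le_μ β ξ)

@[simp] lemma μ_neg (β ξ : ℝ) : μ β (-ξ) = μ β ξ := by simp [μ]

@[fun_prop] lemma measurable_μ (β : ℝ) : Measurable (μ β) := by
  have := measurable_κ
  unfold μ
  fun_prop

lemma μ_inv_le_one (β ξ : ℝ) : (μ β ξ)⁻¹ ≤ 1 := inv_le_one_of_one_le₀ (one_le_μ β ξ)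

lemma abs_mul_θ_le (ξ : ℝ) : |ξ| * θ ξ ≤ 1 := by
  have := θ_mul ξ
  have := θ_pos ξ
  nlinarith

lemma κ_mul_θ_le (ξ : ℝ) : κ ξ * θ ξ ≤ 2 * Real.pi := by
  rw [κ_eq, mul_assoc]
  exact mul_le_of_le_one_right Real.two_pi_pos.le (abs_mul_θ_le ξ)

/-- `μ` has order 3/2, so two powers of `θ` suffice. In `μ θ³` one power of `θ` is then to spare,
which yields continuity in a norm weaker than the smooth one. -/
lemma exists_μ_le (β : ℝ) : ∃ C, 0 ≤ C ∧ ∀ ξ, μ β ξ * θ ξ ^ 2 ≤ C := by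
  set c : ℝ := 1 + 2 * Real.pi + |β| * (2 * Real.pi) ^ 3 with hc
  have hc0 : 0 ≤ c := by have := Real.pi_pos; positivity
  refine ⟨Real.sqrt c, Real.sqrt_nonneg _, fun ξ => Real.le_sqrt_of_sq_le ?_⟩
  have h1 := κ_mul_θ_le ξ
  have h0 := (θ_pos ξ).le
  have h2 := θ_le_one ξ
  have h3 : 0 ≤ κ ξ * θ ξ := mul_nonneg (κ_nonneg ξ) h0
  rw [mul_pow, μ_sq]
  calc (1 + κ ξ + |β| * κ ξ ^ 3) * (θ ξ ^ 2) ^ 2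
      = θ ξ ^ 4 + (κ ξ * θ ξ) * θ ξ ^ 3 + |β| * ((κ ξ * θ ξ) ^ 3 * θ ξ) := by ring
    _ ≤ 1 + (2 * Real.pi) * 1 + |β| * ((2 * Real.pi) ^ 3 * 1) := by
        gcongr
        · exact pow_le_one₀ h0 h2
        · exact pow_le_one₀ h0 h2
    _ = c := by rw [hc]; ring

/-- Here surface tension enters: for `β > 0` the order 3/2 of `μ` exceeds one, so a full derivative
of `f` is controlled by the energy. The factor `1 / β` in the constant turns `β κ³` into `κ³`, which
with `κ` dominates `κ²`. -/
lemma exists_κ_le {β : ℝ} (hβ : 0 < β) : ∃ C, 0 ≤ C ∧ ∀ ξ, κ ξ * (μ β ξ)⁻¹ ≤ C := by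
  refine ⟨Real.sqrt (1 + 1 / β), Real.sqrt_nonneg _, fun ξ => ?_⟩
  rw [← div_eq_mul_inv, div_le_iff₀ (μ_pos β ξ)]
  refine le_of_sq_le_sq ?_ (mul_nonneg (Real.sqrt_nonneg _) (μ_pos β ξ).le)
  have h0 := κ_nonneg ξ
  rw [mul_pow, Real.sq_sqrt (by positivity), μ_sq, abs_of_pos hβ]
  set x := κ ξ
  have e : (1 + 1 / β) * (1 + x + β * x ^ 3) = (1 + x + β * x ^ 3) + (1 / β) * (1 + x) + x ^ 3 := by
    field_simp
    ring
  have h1 : 0 ≤ 1 / β * (1 + x) := by positivity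
  have h2 : 0 ≤ β * x ^ 3 := by positivity
  rw [e]
  nlinarith [mul_nonneg h0 (sq_nonneg (x - 1))]

end Symbols

/-! ### Elementary inequalities between the interacting frequencies -/

section FrequencyBounds

/-- From `|k| ≤ |k - l| + |l| ≤ (1 + |k - l|) (1 + |l|)`: one outer derivative is paid for by one
weight on each input. -/
lemma abs_mul_θ_mul_θ_le (k l : ℝ) : |k| * (θ (k - l) * θ l) ≤ 1 := by
  have h1 : |k| ≤ |k - l| + |l| := by simpa using abs_add_le (k - l) l
  have h2 := θ_pos (k - l)
  have h3 := θ_pos l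
  have h4 := θ_mul (k - l)
  have h5 := θ_mul l
  calc |k| * (θ (k - l) * θ l) ≤ (1 + |k - l|) * (1 + |l|) * (θ (k - l) * θ l) := by
        gcongr
        nlinarith [abs_nonneg (k - l), abs_nonneg l]
    _ = (θ (k - l) * (1 + |k - l|)) * (θ l * (1 + |l|)) := by ring
    _ = 1 := by rw [h4, h5, one_mul]

lemma abs_sign_le_one (x : ℝ) : |Real.sign x| ≤ 1 := by
  rcases Real.sign_apply_eq x with h | h | h <;> simp [h]

/-- Opposite frequencies produce a large output of the commutator `[H, f]`. -/
lemma abs_mul_sign_sub_sign_le (k l : ℝ) :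
    |k * (Real.sign k - Real.sign l)| ≤ 2 * |k - l| := by
  have h1 := le_abs_self (k - l)
  have h2 := neg_le_abs (k - l)
  rcases lt_trichotomy k 0 with hk | hk | hk <;> rcases lt_trichotomy l 0 with hl | hl | hl <;>
    simp only [Real.sign_of_neg, Real.sign_of_pos, Real.sign_zero, hk, hl] at h1 h2 ⊢ <;>
    exact abs_le.mpr ⟨by linarith, by linarith⟩

/-- The commutator factor vanishes for equal signs, and for opposite signs `|k - l| = |k| + |l|`. -/
lemma abs_le_of_sign_ne {k l : ℝ} (hl : l ≠ 0) (h : k * (Real.sign k - Real.sign l) ≠ 0) :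
    |k| ≤ |k - l| := by
  rcases lt_trichotomy k 0 with hk | hk | hk
  · rcases lt_or_gt_of_ne hl with hl | hl
    · simp [Real.sign_of_neg, hk, hl] at h
    · rw [abs_of_neg hk, abs_of_neg (by linarith : k - l < 0)]; linarith
  · simp [hk] at h
  · rcases lt_or_gt_of_ne hl with hl | hl
    · rw [abs_of_pos hk, abs_of_pos (by linarith : 0 < k - l)]; linarith
    · simp [Real.sign_of_pos, hk, hl] at h

/-- For equal signs the expression is `k - l`; for opposite signs it is `±(|k| + |l|)`, of size `|k
- l|`. This is the cancellation in the quadratic term: the derivative passes to the coefficient. -/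
lemma abs_sign_mul_abs_sub_le (k l : ℝ) :
    |Real.sign l * (|k|) - Real.sign k * (|l|)| ≤ |k - l| := by
  have h1 := le_abs_self (k - l)
  have h2 := neg_le_abs (k - l)
  rcases lt_trichotomy k 0 with hk | hk | hk <;> rcases lt_trichotomy l 0 with hl | hl | hl <;>
    simp only [Real.sign_of_neg, Real.sign_of_pos, Real.sign_zero, hk, hl, abs_of_neg, abs_of_pos,
      abs_zero] at h1 h2 ⊢ <;>
    exact abs_le.mpr ⟨by linarith, by linarith⟩

/-- The weight `|x| (1 + |x|)³`. -/
def topWeight (x : ℝ) : ℝ := |x| * (1 + |x|) ^ 3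

/-- By monotonicity of the weight only the extreme values `z = x + y` and `z = y - x` matter. The
first is a polynomial expansion, the second a difference quotient bound. The constant `10` is not
sharp. -/
lemma topWeight_sub_le_aux {x y z : ℝ} (hx : 0 ≤ x) (hy : 0 ≤ y) (hxy : x ≤ y) (hz1 : y - x ≤ z)
    (hz2 : z ≤ x + y) :
    |z * (1 + z) ^ 3 - x * (1 + x) ^ 3 - y * (1 + y) ^ 3| ≤
      10 * (x * (1 + y) ^ 3 + y * (1 + x) ^ 3) := by
  have hz : 0 ≤ z := by linarith
  have hmono : ∀ {a b : ℝ}, 0 ≤ a → a ≤ b → a * (1 + a) ^ 3 ≤ b * (1 + b) ^ 3 := by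
    intro a b ha hab
    have hb := ha.trans hab
    gcongr
  have hup := hmono hz hz2
  have hlow := hmono (by linarith : 0 ≤ y - x) hz1
  have hxx := hmono hx hxy
  have p1 : 0 ≤ x * y := by positivity
  have p2 : 0 ≤ x ^ 2 * y := by positivity
  have p3 : 0 ≤ x * y ^ 2 := by positivity
  have p4 : 0 ≤ x ^ 3 * y := by positivity
  have p5 : 0 ≤ x * y ^ 3 := by positivity
  have p6 : 0 ≤ x ^ 2 * y ^ 2 := by positivity
  have p7 : 2 * (x ^ 2 * y ^ 2) ≤ x ^ 3 * y + x * y ^ 3 := by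
    nlinarith [mul_nonneg p1 (sq_nonneg (x - y))]
  have h3 : x * (1 + x) ^ 3 ≤ x * (1 + y) ^ 3 := by gcongr
  rw [abs_le]
  constructor
  · have e : y * (1 + y) ^ 3 - (y - x) * (1 + (y - x)) ^ 3 ≤ 9 * (x * (1 + y) ^ 3) := by
      have q1 : 0 ≤ y - x := by linarith
      have : y * (1 + y) ^ 3 - (y - x) * (1 + (y - x)) ^ 3 =
        y * ((1 + y) ^ 3 - (1 + (y - x)) ^ 3) + x * (1 + (y - x)) ^ 3 := by ring
      have h4 : (1 + (y - x)) ^ 3 ≤ (1 + y) ^ 3 := by gcongr; linarith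
      have h5 : (1 + y) ^ 3 - (1 + (y - x)) ^ 3 ≤ 3 * x * (1 + y) ^ 2 := by
        have : (1 + y) ^ 3 - (1 + (y - x)) ^ 3 =
          x * ((1 + y) ^ 2 + (1 + y) * (1 + (y - x)) + (1 + (y - x)) ^ 2) := by ring
        rw [this]
        have h6 : 1 + (y - x) ≤ 1 + y := by linarith
        have h7 : (1 + y) * (1 + (y - x)) ≤ (1 + y) * (1 + y) := by gcongr
        have h8 : (1 + (y - x)) ^ 2 ≤ (1 + y) ^ 2 := by gcongr
        nlinarith
      calc _ = _ := this
        _ ≤ y * (3 * x * (1 + y) ^ 2) + x * (1 + y) ^ 3 := by gcongr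
        _ ≤ (1 + y) * (3 * x * (1 + y) ^ 2) + x * (1 + y) ^ 3 := by gcongr; linarith
        _ = 4 * (x * (1 + y) ^ 3) := by ring
        _ ≤ 9 * (x * (1 + y) ^ 3) := by
            have : 0 ≤ x * (1 + y) ^ 3 := by positivity
            linarith
    have : 0 ≤ y * (1 + x) ^ 3 := by positivity
    linarith
  · have e : (x + y) * (1 + (x + y)) ^ 3 - x * (1 + x) ^ 3 - y * (1 + y) ^ 3 =
        6 * (x * y) + 9 * (x ^ 2 * y) + 9 * (x * y ^ 2) + 4 * (x ^ 3 * y) + 6 * (x ^ 2 * y ^ 2)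
          + 4 * (x * y ^ 3) := by ring
    have e2 : x * (1 + y) ^ 3 + y * (1 + x) ^ 3 = x + y + 6 * (x * y) + 3 * (x * y ^ 2)
        + 3 * (x ^ 2 * y) + x * y ^ 3 + x ^ 3 * y := by ring
    rw [e2]
    linarith

/-- The Leibniz rule for the top-order weight: once the two terms with the whole weight on one input
are removed, what remains has one derivative on one input and three on the other. -/
lemma abs_topWeight_sub_le (k l : ℝ) :
    |topWeight k - topWeight (k - l) - topWeight l| ≤
      10 * (|k - l| * (1 + |l|) ^ 3 + |l| * (1 + |k - l|) ^ 3) := by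
  have h1 : |k| ≤ |k - l| + |l| := by simpa using abs_add_le (k - l) l
  have h2 : |l| - |k - l| ≤ |k| := by
    have := abs_sub_abs_le_abs_sub l (l - k)
    rw [abs_sub_comm l k] at this
    simpa using this
  have h3 : |k - l| - |l| ≤ |k| := by
    have := abs_sub_abs_le_abs_sub (k - l) (-l)
    simpa using this
  unfold topWeight
  rcases le_total |k - l| |l| with h | h
  · exact topWeight_sub_le_aux (abs_nonneg _) (abs_nonneg _) h h2 h1
  · have := topWeight_sub_le_aux (abs_nonneg l) (abs_nonneg (k - l)) h h3 (by linarith)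
    rw [show |k| * (1 + |k|) ^ 3 - |k - l| * (1 + |k - l|) ^ 3 - |l| * (1 + |l|) ^ 3 =
      |k| * (1 + |k|) ^ 3 - |l| * (1 + |l|) ^ 3 - |k - l| * (1 + |k - l|) ^ 3 by ring,
      add_comm (|k - l| * _)]
    exact this

end FrequencyBounds


/-! ### Real multipliers, frequency truncation and the nonlinearity in weighted variables -/

/-- Bounded even real symbols. -/
structure IsSym (f : ℝ → ℝ) : Prop where
  measurable : Measurable f
  even : ∀ ξ, f (-ξ) = f ξ
  bound : ∃ C, ∀ ξ, |f ξ| ≤ C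

lemma IsSym.isMul {f : ℝ → ℝ} (h : IsSym f) : IsMul fun ξ => (f ξ : ℂ) :=
  let ⟨_, hC⟩ := h.bound
  isMul_ofReal h.measurable hC

/-- Multiplication of Fourier transforms of real functions by a real even symbol. -/
def symH {f : ℝ → ℝ} (h : IsSym f) : Hm →L[ℝ] Hm := mulH h.isMul (conj_ofReal_even h.even)

lemma coe_symH {f : ℝ → ℝ} (h : IsSym f) (F : Hm) : (symH h F : L2) = mulOp h.isMul F := rfl

lemma coeFn_symH {f : ℝ → ℝ} (h : IsSym f) (F : Hm) :
    (symH h F : L2) =ᵐ[volume] fun ξ => (f ξ : ℂ) * (F : L2) ξ := coeFn_mulOp h.isMul F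

lemma symH_comp {f g r : ℝ → ℝ} (hf : IsSym f) (hg : IsSym g) (hr : IsSym r)
    (h : ∀ ξ, f ξ * g ξ = r ξ) (F : Hm) : symH hf (symH hg F) = symH hr F :=
  Subtype.ext (mulOp_comp hf.isMul hg.isMul hr.isMul (fun ξ => by rw [← h]; push_cast; rfl) _)

lemma inner_symH {f : ℝ → ℝ} (hf : IsSym f) (F G : Hm) :
    inner ℝ (symH hf F) G = inner ℝ F (symH hf G) := by
  rw [Submodule.coe_inner, Submodule.coe_inner, coe_symH, coe_symH,
    inner_mulOp_right _ fun ξ => Complex.conj_ofReal _]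

lemma norm_symH_le {f : ℝ → ℝ} (hf : IsSym f) {C : ℝ} (hC : ∀ ξ, |f ξ| ≤ C) (F : Hm) :
    ‖symH hf F‖ ≤ C * ‖F‖ :=
  norm_mulOp_le hf.isMul (fun ξ => by rw [Complex.norm_real]; exact hC ξ) _

lemma norm_symH_le_symH {f g : ℝ → ℝ} (hf : IsSym f) (hg : IsSym g) {C : ℝ}
    (hC : ∀ ξ, |f ξ| ≤ C * |g ξ|) (F : Hm) : ‖symH hf F‖ ≤ C * ‖symH hg F‖ :=
  norm_mulOp_le_mulOp hf.isMul hg.isMul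
    (fun ξ => by rw [Complex.norm_real, Complex.norm_real]; exact hC ξ) _

/-- The sharp frequency cutoff. -/
def cut (n : ℕ) (ξ : ℝ) : ℝ := if |ξ| ≤ n then 1 else 0

@[fun_prop] lemma measurable_cut (n : ℕ) : Measurable (cut n) :=
  Measurable.ite (measurableSet_le (by fun_prop) (by fun_prop)) (by fun_prop) (by fun_prop)

@[simp] lemma cut_neg (n : ℕ) (ξ : ℝ) : cut n (-ξ) = cut n ξ := by simp [cut]

lemma cut_nonneg (n : ℕ) (ξ : ℝ) : 0 ≤ cut n ξ := by unfold cut; split_ifs <;> simp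

lemma cut_le_one (n : ℕ) (ξ : ℝ) : cut n ξ ≤ 1 := by unfold cut; split_ifs <;> simp

lemma cut_mul_abs_le (n : ℕ) (ξ : ℝ) : cut n ξ * |ξ| ≤ n := by
  unfold cut; split_ifs with h <;> simp [h]

lemma cut_mul_cut {m n : ℕ} (h : m ≤ n) (ξ : ℝ) : cut m ξ * cut n ξ = cut m ξ := by
  unfold cut
  split_ifs with h1 h2 <;> simp
  exact h2 (h1.trans (by exact_mod_cast h))

@[fun_prop] lemma measurable_sign : Measurable Real.sign := by
  unfold Real.sign
  exact Measurable.ite measurableSet_Iio (by fun_prop)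
    (Measurable.ite measurableSet_Ioi (by fun_prop) (by fun_prop))

lemma θ_pow_le_one (n : ℕ) (ξ : ℝ) : θ ξ ^ n ≤ 1 := pow_le_one₀ (θ_pos ξ).le (θ_le_one ξ)

lemma isSym_θ : IsSym θ :=
  ⟨by fun_prop, by simp, 1, fun ξ => by rw [abs_of_pos (θ_pos ξ)]; exact θ_le_one ξ⟩

/-- The symbol of the embedding `Θ`. -/
lemma isSym_θ3 : IsSym fun ξ => θ ξ ^ 3 :=
  ⟨by fun_prop, by simp, 1, fun ξ => by
    rw [abs_of_pos (pow_pos (θ_pos ξ) 3)]; exact θ_pow_le_one 3 ξ⟩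

lemma isSym_cut (n : ℕ) : IsSym (cut n) :=
  ⟨by fun_prop, by simp, 1, fun ξ => by rw [abs_of_nonneg (cut_nonneg n ξ)]; exact cut_le_one n ξ⟩

lemma cut_mul_le {n : ℕ} {f : ℝ → ℝ} {C : ℝ} (hC : 0 ≤ C) (ξ : ℝ)
    (h : |ξ| ≤ n → |f ξ| ≤ C) : |cut n ξ * f ξ| ≤ C := by
  unfold cut
  split_ifs with h1
  · simpa using h h1
  · simpa using hC

lemma isSym_cutW (n : ℕ) : IsSym fun ξ => cut n ξ * (1 + |ξ|) ^ 3 :=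
  ⟨by fun_prop, by simp, (1 + n) ^ 3, fun ξ =>
    cut_mul_le (f := fun ξ => (1 + |ξ|) ^ 3) (by positivity) ξ fun h => by
      rw [abs_of_nonneg (by positivity)]; gcongr⟩

lemma isSym_μθ3 (β : ℝ) : IsSym fun ξ => μ β ξ * θ ξ ^ 3 := by
  obtain ⟨C, hC, h⟩ := exists_μ_le β
  refine ⟨by fun_prop, by simp, C, fun ξ => ?_⟩
  have h1 := μ_pos β ξ
  have h2 := θ_pos ξ
  rw [abs_of_pos (by positivity)]
  calc μ β ξ * θ ξ ^ 3 = (μ β ξ * θ ξ ^ 2) * θ ξ := by ring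
    _ ≤ C * 1 := by
        gcongr
        · exact h ξ
        · exact θ_le_one ξ
    _ = C := mul_one C

lemma isSym_μinvθ3 (β : ℝ) : IsSym fun ξ => (μ β ξ)⁻¹ * θ ξ ^ 3 := by
  refine ⟨by fun_prop, by simp, 1, fun ξ => ?_⟩
  have h1 := μ_pos β ξ
  have h2 := θ_pos ξ
  rw [abs_of_pos (by positivity)]
  exact mul_le_one₀ (μ_inv_le_one β ξ) (by positivity) (θ_pow_le_one 3 ξ)

/-- The symbol of `α Λ ∂ₓ Θ`. -/
def skewSymbol (α ξ : ℝ) : ℂ :=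
  Complex.I * ((α * (κ ξ * (2 * Real.pi * ξ)) * θ ξ ^ 3 : ℝ) : ℂ)

lemma norm_skewSymbol_le (α ξ : ℝ) :
    ‖skewSymbol α ξ‖ ≤ |α| * (2 * Real.pi) ^ 2 * θ ξ := by
  have h1 := κ_mul_θ_le ξ
  have h0 := κ_nonneg ξ
  have h2 := (θ_pos ξ).le
  rw [skewSymbol, norm_mul, Complex.norm_I, one_mul, Complex.norm_real, Real.norm_eq_abs, abs_mul,
    abs_mul, abs_mul, abs_of_nonneg h0, show |2 * Real.pi * ξ| = κ ξ from rfl,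
    abs_of_nonneg (pow_nonneg h2 3)]
  calc |α| * (κ ξ * κ ξ) * θ ξ ^ 3 = |α| * ((κ ξ * θ ξ) * (κ ξ * θ ξ)) * θ ξ := by ring
    _ ≤ |α| * ((2 * Real.pi) * (2 * Real.pi)) * θ ξ := by gcongr
    _ = _ := by ring

lemma isMul_skewSymbol (α : ℝ) : IsMul (skewSymbol α) where
  measurable := by unfold skewSymbol; fun_prop
  bound := ⟨|α| * (2 * Real.pi) ^ 2, by positivity, fun ξ => (norm_skewSymbol_le α ξ).trans
    (mul_le_of_le_one_right (by positivity) (θ_le_one ξ))⟩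

lemma skewSymbol_neg (α ξ : ℝ) : skewSymbol α (-ξ) = (starRingEnd ℂ) (skewSymbol α ξ) := by
  simp only [skewSymbol, map_mul, Complex.conj_I, Complex.conj_ofReal, κ_neg, θ_neg]
  push_cast
  ring

/-- The operator with symbol `skewSymbol`. -/
def skewH (α : ℝ) : Hm →L[ℝ] Hm := mulH (isMul_skewSymbol α) (skewSymbol_neg α)

lemma norm_skewH_le (α : ℝ) (F : Hm) :
    ‖skewH α F‖ ≤ |α| * (2 * Real.pi) ^ 2 * ‖symH isSym_θ F‖ :=
  norm_mulOp_le_mulOp (isMul_skewSymbol α) isSym_θ.isMul (fun ξ => by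
    rw [Complex.norm_real, Real.norm_of_nonneg (θ_pos ξ).le]; exact norm_skewSymbol_le α ξ) _

lemma inner_skewH {f : ℝ → ℝ} (hf : IsSym f) (α : ℝ) (F : Hm) :
    inner ℝ (symH hf F) (skewH α F) = 0 := by
  rw [Submodule.coe_inner]
  refine inner_mulOp_eq_zero hf.isMul (isMul_skewSymbol α) (fun ξ => ?_) _
  rw [Complex.conj_ofReal, skewSymbol, mul_assoc, ← Complex.ofReal_mul, Complex.re_mul_ofReal]
  simp

/-- The kernel of `-ε H (H g)²_x` in terms of the weighted transform of `g`. -/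
def quadKer (ε k l : ℝ) : ℝ :=
  ε * κ k * (Real.sign (k - l) * Real.sign l) * (θ (k - l) ^ 3 * θ l ^ 3)

/-- The kernel of `ε ([H, f] Λ f)_x` in terms of the weighted transform of `f`. -/
def commKer (β ε k l : ℝ) : ℝ :=
  ε * (2 * Real.pi * (k * (Real.sign k - Real.sign l))) * κ l *
    (((μ β (k - l))⁻¹ * θ (k - l) ^ 3) * ((μ β l)⁻¹ * θ l ^ 3))

lemma neg_sub_neg_eq (k l : ℝ) : -k - -l = -(k - l) := by ring

lemma abs_sign_mul_sign_le (x y : ℝ) : |Real.sign x * Real.sign y| ≤ 1 := by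
  rw [abs_mul]
  exact mul_le_one₀ (abs_sign_le_one x) (abs_nonneg _) (abs_sign_le_one y)

/-- One pair of weights pays for the outer derivative by `abs_mul_θ_mul_θ_le`, one pair is
discarded, and one is left for the product estimates. -/
lemma abs_quadKer_le (ε k l : ℝ) : |quadKer ε k l| ≤ |ε| * (2 * Real.pi) * θ (k - l) * θ l := by
  have h1 := abs_mul_θ_mul_θ_le k l
  have h2 := (θ_pos (k - l)).le
  have h3 := (θ_pos l).le
  have hpi := Real.pi_pos
  rw [quadKer, abs_mul, abs_mul, abs_mul, abs_of_nonneg (κ_nonneg k),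
    abs_of_nonneg (by positivity : 0 ≤ θ (k - l) ^ 3 * θ l ^ 3), κ_eq]
  calc |ε| * (2 * Real.pi * |k|) * |Real.sign (k - l) * Real.sign l| * (θ (k - l) ^ 3 * θ l ^ 3)
      ≤ |ε| * (2 * Real.pi * |k|) * 1 * (θ (k - l) ^ 3 * θ l ^ 3) := by
        gcongr; exact abs_sign_mul_sign_le _ _
    _ = |ε| * (2 * Real.pi) * (|k| * (θ (k - l) * θ l)) * (θ (k - l) * θ l) * (θ (k - l) * θ l) := by
        ring
    _ ≤ |ε| * (2 * Real.pi) * 1 * (1 * 1) * (θ (k - l) * θ l) := by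
        gcongr
        · exact θ_le_one _
        · exact θ_le_one _
    _ = _ := by ring

lemma isKer_of_le_left {σ : ℝ → ℝ → ℝ} (hm : Measurable (Function.uncurry σ))
    (he : ∀ k l, σ (-k) (-l) = σ k l) {C : ℝ} (hC : 0 ≤ C) (h : ∀ k l, |σ k l| ≤ C * θ (k - l)) :
    IsKer σ :=
  ⟨hm, he, C, hC, fun k l => (h k l).trans (by have := θ_pos l; gcongr; linarith)⟩

lemma isKer_of_le_right {σ : ℝ → ℝ → ℝ} (hm : Measurable (Function.uncurry σ))
    (he : ∀ k l, σ (-k) (-l) = σ k l) {C : ℝ} (hC : 0 ≤ C) (h : ∀ k l, |σ k l| ≤ C * θ l) :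
    IsKer σ :=
  ⟨hm, he, C, hC, fun k l => (h k l).trans (by have := θ_pos (k - l); gcongr; linarith)⟩

lemma quadKer_even (ε k l : ℝ) : quadKer ε (-k) (-l) = quadKer ε k l := by
  simp only [quadKer, neg_sub_neg_eq, Real.sign_neg, θ_neg, κ_neg]
  ring

lemma commKer_even (β ε k l : ℝ) : commKer β ε (-k) (-l) = commKer β ε k l := by
  simp only [commKer, neg_sub_neg_eq, Real.sign_neg, θ_neg, μ_neg, κ_neg]
  ring

lemma measurable_quadKer (ε : ℝ) : Measurable (Function.uncurry (quadKer ε)) := by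
  simp only [Function.uncurry_def, quadKer]
  fun_prop

lemma measurable_commKer (β ε : ℝ) : Measurable (Function.uncurry (commKer β ε)) := by
  simp only [Function.uncurry_def, commKer]
  fun_prop

lemma isKer_quadKer (ε : ℝ) : IsKer (quadKer ε) :=
  isKer_of_le_left (measurable_quadKer ε) (quadKer_even ε)
    (by have := Real.pi_pos; positivity : 0 ≤ |ε| * (2 * Real.pi)) fun k l =>
    (abs_quadKer_le ε k l).trans (mul_le_of_le_one_right
      (by have := Real.pi_pos; have := θ_pos (k - l); positivity) (θ_le_one l))

lemma quadKer_swap (ε k l : ℝ) : quadKer ε k l = quadKer ε k (k - l) := by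
  simp only [quadKer, sub_sub_cancel]
  ring

lemma abs_commKer_le (β ε k l : ℝ) : |commKer β ε k l| ≤
    |ε| * (4 * Real.pi) * (|k - l| * (μ β (k - l))⁻¹ * θ (k - l) ^ 3) *
      (κ l * (μ β l)⁻¹ * θ l ^ 3) := by
  have h2 := (θ_pos (k - l)).le
  have h3 := (θ_pos l).le
  have h4 := (μ_pos β (k - l)).le
  have h5 := (μ_pos β l).le
  have hpi := Real.pi_pos
  have hk := κ_nonneg l
  rw [commKer, abs_mul, abs_mul, abs_mul, abs_mul (2 * Real.pi), abs_of_nonneg hk,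
    abs_of_nonneg (by positivity : 0 ≤ 2 * Real.pi),
    abs_of_nonneg (by positivity :
      0 ≤ ((μ β (k - l))⁻¹ * θ (k - l) ^ 3) * ((μ β l)⁻¹ * θ l ^ 3))]
  calc _ ≤ |ε| * (2 * Real.pi * (2 * |k - l|)) * κ l *
        (((μ β (k - l))⁻¹ * θ (k - l) ^ 3) * ((μ β l)⁻¹ * θ l ^ 3)) := by
        gcongr
        exact abs_mul_sign_sub_sign_le k l
    _ = _ := by ring

lemma abs_mul_μinv_mul_θ3_le (β x : ℝ) : |x| * (μ β x)⁻¹ * θ x ^ 3 ≤ θ x := by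
  have h2 := (θ_pos x).le
  have h4 := (μ_pos β x).le
  have h5 := μ_inv_le_one β x
  calc |x| * (μ β x)⁻¹ * θ x ^ 3 = (|x| * θ x) * ((μ β x)⁻¹ * (θ x * θ x)) := by ring
    _ ≤ 1 * (1 * (1 * θ x)) := by
        gcongr
        · exact abs_mul_θ_le x
        · exact θ_le_one x
    _ = θ x := by ring

lemma κ_mul_μinv_mul_θ3_le (β x : ℝ) : κ x * (μ β x)⁻¹ * θ x ^ 3 ≤ 2 * Real.pi * θ x := by
  rw [κ_eq, mul_assoc (2 * Real.pi), mul_assoc (2 * Real.pi)]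
  exact mul_le_mul_of_nonneg_left (abs_mul_μinv_mul_θ3_le β x) Real.two_pi_pos.le

/-- A bound for the quadratic terms. -/
def kerConst (ε : ℝ) : ℝ := |ε| * (4 * Real.pi) * (2 * Real.pi)

lemma kerConst_nonneg (ε : ℝ) : 0 ≤ kerConst ε := by
  have := Real.pi_pos
  unfold kerConst
  positivity

lemma abs_commKer_le' (β ε k l : ℝ) : |commKer β ε k l| ≤ kerConst ε * θ (k - l) * θ l := by
  have h2 := (θ_pos (k - l)).le
  have h3 := (θ_pos l).le
  have h4 := (μ_pos β l).le
  have hpi := Real.pi_pos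
  have hk := κ_nonneg l
  calc _ ≤ _ := abs_commKer_le β ε k l
    _ ≤ |ε| * (4 * Real.pi) * θ (k - l) * (2 * Real.pi * θ l) :=
        mul_le_mul (mul_le_mul_of_nonneg_left (abs_mul_μinv_mul_θ3_le β _) (by positivity))
          (κ_mul_μinv_mul_θ3_le β l) (by positivity) (by positivity)
    _ = _ := by rw [kerConst]; ring

lemma isKer_commKer (β ε : ℝ) : IsKer (commKer β ε) :=
  isKer_of_le_left (measurable_commKer β ε) (commKer_even β ε) (kerConst_nonneg ε) fun k l =>
    (abs_commKer_le' β ε k l).trans (mul_le_of_le_one_right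
      (by have := kerConst_nonneg ε; have := θ_pos (k - l); positivity) (θ_le_one l))

lemma abs_quadKer_le' (ε k l : ℝ) : |quadKer ε k l| ≤ kerConst ε * θ (k - l) * θ l := by
  have h2 := (θ_pos (k - l)).le
  have h3 := (θ_pos l).le
  have hpi := Real.pi_gt_three
  refine (abs_quadKer_le ε k l).trans ?_
  gcongr
  unfold kerConst
  have : 0 ≤ |ε| * (2 * Real.pi) := by positivity
  nlinarith

/-- The second component of the nonlinear operator. -/
def accel (α β ε : ℝ) (A B : Hm) : Hm :=
  -symH (isSym_μθ3 β) A + symH (isSym_μinvθ3 β) A + skewH α B + bilH (isKer_quadKer ε) B B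
    + bilH (isKer_commKer β ε) A A

/-- Decay in both inputs is more than Young's inequality needs. The second weight goes to `G`, so
that only `θ G` enters the bound. -/
lemma norm_bilH_le {σ : ℝ → ℝ → ℝ} (hσ : IsKer σ) {C : ℝ} (hC : 0 ≤ C)
    (h : ∀ k l, |σ k l| ≤ C * θ (k - l) * θ l) (F G : Hm) :
    ‖bilH hσ F G‖ ≤ C * θNorm * ‖F‖ * ‖symH isSym_θ G‖ :=
  norm_bil_le_left hσ hC h (F := F) (G := G) (G' := (symH isSym_θ G : L2)) <| by
    filter_upwards [coeFn_symH isSym_θ G] with ξ h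
    rw [h, norm_mul, Complex.norm_real, Real.norm_of_nonneg (θ_pos ξ).le]

lemma norm_bilH_le' {σ : ℝ → ℝ → ℝ} (hσ : IsKer σ) {C : ℝ} (hC : 0 ≤ C)
    (h : ∀ k l, |σ k l| ≤ C * θ (k - l) * θ l) (F G : Hm) :
    ‖bilH hσ F G‖ ≤ C * θNorm * ‖symH isSym_θ F‖ * ‖G‖ :=
  norm_bil_le_right hσ hC (b := θ) (F := F) (G := G) (F' := (symH isSym_θ F : L2))
    (fun k l => (h k l).trans (le_of_eq (by ring))) <| by
    filter_upwards [coeFn_symH isSym_θ F] with ξ h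
    rw [h, norm_mul, Complex.norm_real, Real.norm_of_nonneg (θ_pos ξ).le]

lemma norm_bilH_sub_le {σ : ℝ → ℝ → ℝ} (hσ : IsKer σ) {C : ℝ} (hC : 0 ≤ C)
    (h : ∀ k l, |σ k l| ≤ C * θ (k - l) * θ l) (F G : Hm) :
    ‖bilH hσ F F - bilH hσ G G‖ ≤ C * θNorm * (‖F‖ + ‖G‖) * ‖symH isSym_θ (F - G)‖ := by
  have e : bilH hσ F F - bilH hσ G G = bilH hσ F (F - G) + bilH hσ (F - G) G := by
    simp only [map_sub, LinearMap.sub_apply]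
    abel
  rw [e]
  refine (norm_add_le _ _).trans ?_
  have h1 := norm_bilH_le hσ hC h F (F - G)
  have h2 := norm_bilH_le' hσ hC h (F - G) G
  linarith

/-- Every term of `accel` has a spare weight `θ`, so differences are controlled by `θ (A - A')` and
`θ (B - B')`. The stronger form serves local Lipschitz continuity and, after interpolation, rough
continuity. -/
lemma exists_norm_accel_sub_le (α β ε : ℝ) : ∃ C, 0 ≤ C ∧ ∀ A B A' B' : Hm,
    ‖accel α β ε A B - accel α β ε A' B'‖ ≤ C * (1 + ‖A‖ + ‖A'‖ + ‖B‖ + ‖B'‖) *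
      (‖symH isSym_θ (A - A')‖ + ‖symH isSym_θ (B - B')‖) := by
  obtain ⟨C₁, hC₁, h₁⟩ := exists_μ_le β
  set C₂ := |α| * (2 * Real.pi) ^ 2 with hC₂
  set C₃ := kerConst ε * θNorm with hC₃
  have hC₂0 : 0 ≤ C₂ := by positivity
  have hC₃0 : 0 ≤ C₃ := mul_nonneg (kerConst_nonneg ε) θNorm_nonneg
  refine ⟨C₁ + 1 + C₂ + C₃, by positivity, fun A B A' B' => ?_⟩
  set a := ‖symH isSym_θ (A - A')‖
  set b := ‖symH isSym_θ (B - B')‖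
  have ha : 0 ≤ a := norm_nonneg _
  have hb : 0 ≤ b := norm_nonneg _
  have e : accel α β ε A B - accel α β ε A' B' =
      -symH (isSym_μθ3 β) (A - A') + symH (isSym_μinvθ3 β) (A - A') + skewH α (B - B')
      + (bilH (isKer_quadKer ε) B B - bilH (isKer_quadKer ε) B' B')
      + (bilH (isKer_commKer β ε) A A - bilH (isKer_commKer β ε) A' A') := by
    simp only [accel, map_sub]
    abel
  have t1 : ‖symH (isSym_μθ3 β) (A - A')‖ ≤ C₁ * a :=
    norm_symH_le_symH _ _ (fun ξ => by
      have h2 := μ_pos β ξ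
      have h3 := θ_pos ξ
      rw [abs_of_pos (by positivity), abs_of_pos h3]
      calc μ β ξ * θ ξ ^ 3 = (μ β ξ * θ ξ ^ 2) * θ ξ := by ring
        _ ≤ C₁ * θ ξ := by gcongr; exact h₁ ξ) _
  have t2 : ‖symH (isSym_μinvθ3 β) (A - A')‖ ≤ 1 * a :=
    norm_symH_le_symH _ _ (fun ξ => by
      have h2 := μ_pos β ξ
      have h3 := θ_pos ξ
      rw [abs_of_pos (by positivity), abs_of_pos h3]
      calc (μ β ξ)⁻¹ * θ ξ ^ 3 = ((μ β ξ)⁻¹ * θ ξ ^ 2) * θ ξ := by ring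
        _ ≤ (1 * 1) * θ ξ := by
            gcongr
            · exact μ_inv_le_one β ξ
            · exact θ_pow_le_one 2 ξ
        _ = 1 * θ ξ := by ring) _
  have t3 : ‖skewH α (B - B')‖ ≤ C₂ * b := norm_skewH_le α _
  have t4 := norm_bilH_sub_le (isKer_quadKer ε) (kerConst_nonneg ε) (abs_quadKer_le' ε) B B'
  have t5 := norm_bilH_sub_le (isKer_commKer β ε) (kerConst_nonneg ε) (abs_commKer_le' β ε) A A'
  rw [e]
  refine (norm_add_le _ _).trans ((add_le_add_left ((norm_add_le _ _).trans (add_le_add_left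
    ((norm_add_le _ _).trans (add_le_add_left ((norm_add_le _ _)) _)) _)) _).trans ?_)
  rw [norm_neg]
  refine (add_le_add (add_le_add (add_le_add (add_le_add t1 t2) t3) t4) t5).trans ?_
  have n1 := norm_nonneg A
  have n2 := norm_nonneg A'
  have n3 := norm_nonneg B
  have n4 := norm_nonneg B'
  set N := 1 + ‖A‖ + ‖A'‖ + ‖B‖ + ‖B'‖ with hN
  have hN1 : 1 ≤ N := by linarith
  have i1 : C₁ * a ≤ C₁ * N * (a + b) := by
    rw [mul_assoc]
    exact mul_le_mul_of_nonneg_left (by nlinarith) hC₁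
  have i2 : 1 * a ≤ 1 * N * (a + b) := by nlinarith
  have i3 : C₂ * b ≤ C₂ * N * (a + b) := by
    rw [mul_assoc C₂ N]
    exact mul_le_mul_of_nonneg_left (by nlinarith) hC₂0
  have i4 : C₃ * (‖B‖ + ‖B'‖) * b + C₃ * (‖A‖ + ‖A'‖) * a ≤ C₃ * N * (a + b) := by
    have : (‖B‖ + ‖B'‖) * b + (‖A‖ + ‖A'‖) * a ≤ N * (a + b) := by
      have p1 : (‖B‖ + ‖B'‖) * b ≤ N * b := by gcongr; linarith
      have p2 : (‖A‖ + ‖A'‖) * a ≤ N * a := by gcongr; linarith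
      linarith
    calc _ = C₃ * ((‖B‖ + ‖B'‖) * b + (‖A‖ + ‖A'‖) * a) := by ring
      _ ≤ C₃ * (N * (a + b)) := by gcongr
      _ = _ := by ring
  linarith


lemma IsSym.mul {f g : ℝ → ℝ} (hf : IsSym f) (hg : IsSym g) : IsSym fun ξ => f ξ * g ξ := by
  obtain ⟨C, hC⟩ := hf.bound
  obtain ⟨D, hD⟩ := hg.bound
  refine ⟨hf.measurable.mul hg.measurable, fun ξ => by rw [hf.even, hg.even], C * D, fun ξ => ?_⟩
  rw [abs_mul]
  exact mul_le_mul (hC ξ) (hD ξ) (abs_nonneg _) ((abs_nonneg _).trans (hC ξ))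

lemma symH_comm {f g : ℝ → ℝ} (hf : IsSym f) (hg : IsSym g) (F : Hm) :
    symH hf (symH hg F) = symH hg (symH hf F) := by
  rw [symH_comp hf hg (hf.mul hg) (fun _ => rfl), symH_comp hg hf (hf.mul hg) fun ξ => mul_comm _ _]

lemma symH_bilH {σ τ : ℝ → ℝ → ℝ} (hσ : IsKer σ) (hτ : IsKer τ) {f g : ℝ → ℝ} (hf : IsSym f)
    (hg : IsSym g) (h : ∀ k l, f k * σ k l * (g (k - l) * g l) = τ k l) (F G : Hm) :
    symH hf (bilH hσ (symH hg F) (symH hg G)) = bilH hτ F G := by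
  refine Subtype.ext (Lp.ext ?_)
  filter_upwards [coeFn_symH hf (bilH hσ (symH hg F) (symH hg G)),
    bil_eq_of_kernel hσ hτ (coeFn_symH hg F) (coeFn_symH hg G) h] with k h1 h2
  rw [h1, coe_bilH, h2, coe_bilH]

lemma isSym_one : IsSym fun _ => 1 := ⟨by fun_prop, fun _ => rfl, 1, fun _ => by simp⟩

lemma symH_one (F : Hm) : symH isSym_one F = F := by
  refine Subtype.ext (Lp.ext ?_)
  filter_upwards [coeFn_symH isSym_one F] with k h
  simp [h]

lemma symH_bilH' {σ τ : ℝ → ℝ → ℝ} (hσ : IsKer σ) (hτ : IsKer τ) {f : ℝ → ℝ} (hf : IsSym f)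
    (h : ∀ k l, f k * σ k l = τ k l) (F G : Hm) :
    symH hf (bilH hσ F G) = bilH hτ F G := by
  simpa [symH_one] using symH_bilH hσ hτ hf isSym_one (fun k l => by simp [h]) F G

lemma bilH_swap {σ τ : ℝ → ℝ → ℝ} (hσ : IsKer σ) (hτ : IsKer τ) (h : ∀ k l, τ k l = σ k (k - l))
    (F G : Hm) : bilH hσ F G = bilH hτ G F := Subtype.ext (bil_swap hσ hτ h _ _)

lemma bilH_add_kernel {σ τ ρ : ℝ → ℝ → ℝ} (hσ : IsKer σ) (hτ : IsKer τ) (hρ : IsKer ρ)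
    (h : ∀ k l, ρ k l = σ k l + τ k l) (F G : Hm) : bilH hρ F G = bilH hσ F G + bilH hτ F G :=
  Subtype.ext (bil_add_kernel hσ hτ hρ h _ _)

lemma abs_inner_bilH_le {τ : ℝ → ℝ → ℝ} (hτ : IsKer τ) {C : ℝ} (hC : 0 ≤ C) {a : ℝ → ℝ}
    (hs : IsSym a) (ha : ∀ ξ, 0 ≤ a ξ) (hb : ∀ k l, |τ k l + τ l k| ≤ C * θ (k - l) * (a k * a l))
    (S E : Hm) : |inner ℝ E (bilH hτ S E)| ≤ C * θNorm * ‖S‖ * ‖symH hs E‖ ^ 2 :=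
  abs_inner_bil_le hτ hC ha hb S.2 (coeFn_symH hs E)

lemma abs_inner_bilH_le' {τ : ℝ → ℝ → ℝ} (hτ : IsKer τ) {C : ℝ} (hC : 0 ≤ C)
    (hb : ∀ k l, |τ k l + τ l k| ≤ C * θ (k - l))
    (S E : Hm) : |inner ℝ E (bilH hτ S E)| ≤ C * θNorm * ‖S‖ * ‖E‖ ^ 2 := by
  simpa [symH_one] using abs_inner_bilH_le hτ hC isSym_one (fun _ => zero_le_one)
    (fun k l => by simpa using hb k l) S E

lemma θ_sub_comm (k l : ℝ) : θ (l - k) = θ (k - l) := by rw [← neg_sub, θ_neg]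

lemma cut_sub_comm (n : ℕ) (k l : ℝ) : cut n (l - k) = cut n (k - l) := by rw [← neg_sub, cut_neg]

lemma sign_sub_comm (k l : ℝ) : Real.sign (l - k) = -Real.sign (k - l) := by
  rw [← neg_sub, Real.sign_neg]

lemma abs_mul_θ3_le (x : ℝ) : |x| * θ x ^ 3 ≤ θ x := by
  have h := θ_pos x
  calc |x| * θ x ^ 3 = (|x| * θ x) * θ x * θ x := by ring
    _ ≤ 1 * 1 * θ x := by
        gcongr
        · exact abs_mul_θ_le x
        · exact θ_le_one x
    _ = θ x := by ring

/-! ### The estimate for differences in the rough norm -/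

section Monotone

/-- All three weights of the second input are kept for the rough norm. The derivative on that input
is absorbed by `μ⁻¹`, and that on the smooth first input by its weights. -/
lemma abs_commKer_le_left {β Cκ : ℝ} (hκ : ∀ ξ, κ ξ * (μ β ξ)⁻¹ ≤ Cκ) (ε k l : ℝ) :
    |commKer β ε k l| ≤ |ε| * (4 * Real.pi) * Cκ * θ (k - l) * θ l ^ 3 := by
  have h2 := (θ_pos (k - l)).le
  have h3 := (θ_pos l).le
  have h4 := (μ_pos β l).le
  have hpi := Real.pi_pos
  have hk := κ_nonneg l
  calc _ ≤ _ := abs_commKer_le β ε k l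
    _ ≤ |ε| * (4 * Real.pi) * θ (k - l) * (Cκ * θ l ^ 3) :=
        mul_le_mul (mul_le_mul_of_nonneg_left (abs_mul_μinv_mul_θ3_le β _) (by positivity))
          (mul_le_mul_of_nonneg_right (hκ l) (by positivity)) (by positivity) (by positivity)
    _ = _ := by ring

lemma abs_mul_μinv_le {β Cκ : ℝ} (hκ : ∀ ξ, κ ξ * (μ β ξ)⁻¹ ≤ Cκ) (x : ℝ) :
    |x| * (μ β x)⁻¹ ≤ Cκ := by
  have h4 := (μ_pos β x).le
  have hpi := Real.pi_gt_three
  refine le_trans ?_ (hκ x)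
  gcongr
  rw [κ_eq]
  nlinarith [abs_nonneg x]

lemma abs_commKer_le_right {β Cκ : ℝ} (hκ : ∀ ξ, κ ξ * (μ β ξ)⁻¹ ≤ Cκ) (ε k l : ℝ) :
    |commKer β ε k l| ≤ (|ε| * (4 * Real.pi) * Cκ * (2 * Real.pi)) * θ l * θ (k - l) ^ 3 := by
  have h2 := (θ_pos (k - l)).le
  have h3 := (θ_pos l).le
  have h4 := (μ_pos β l).le
  have h5 := (μ_pos β (k - l)).le
  have hpi := Real.pi_pos
  have hk := κ_nonneg l
  have hC : 0 ≤ Cκ := (mul_nonneg (κ_nonneg 0) (inv_nonneg.mpr (μ_pos β 0).le)).trans (hκ 0)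
  calc _ ≤ _ := abs_commKer_le β ε k l
    _ ≤ |ε| * (4 * Real.pi) * (Cκ * θ (k - l) ^ 3) * (2 * Real.pi * θ l) :=
        mul_le_mul (mul_le_mul_of_nonneg_left
          (mul_le_mul_of_nonneg_right (abs_mul_μinv_le hκ _) (by positivity)) (by positivity))
          (κ_mul_μinv_mul_θ3_le β l) (by positivity) (by positivity)
    _ = _ := by ring

/-- The commutator term is locally Lipschitz in the rough norm, so no symmetrization is needed:
whichever input carries the difference, its derivative is paid for by `μ⁻¹`. -/
lemma norm_bilH_commKer_sub_le {β Cκ : ℝ} (hκ : ∀ ξ, κ ξ * (μ β ξ)⁻¹ ≤ Cκ) (ε : ℝ) (F G : Hm) :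
    ‖bilH (isKer_commKer β ε) F F - bilH (isKer_commKer β ε) G G‖ ≤
      (|ε| * (4 * Real.pi) * Cκ * (2 * Real.pi)) * θNorm * (‖F‖ + ‖G‖) *
        ‖symH isSym_θ3 (F - G)‖ := by
  have hpi := Real.pi_gt_three
  have hC : 0 ≤ Cκ := (mul_nonneg (κ_nonneg 0) (inv_nonneg.mpr (μ_pos β 0).le)).trans (hκ 0)
  have hθ := θNorm_nonneg
  have hae : ∀ F : Hm, ∀ᵐ ξ, θ ξ ^ 3 * ‖(F : L2) ξ‖ ≤ ‖(symH isSym_θ3 F : L2) ξ‖ := fun F => by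
    filter_upwards [coeFn_symH isSym_θ3 F] with ξ h
    rw [h, norm_mul, Complex.norm_real, Real.norm_of_nonneg (pow_nonneg (θ_pos ξ).le 3)]
  have e : bilH (isKer_commKer β ε) F F - bilH (isKer_commKer β ε) G G =
      bilH (isKer_commKer β ε) F (F - G) + bilH (isKer_commKer β ε) (F - G) G := by
    simp only [map_sub, LinearMap.sub_apply]
    abel
  rw [e]
  refine (norm_add_le _ _).trans ?_
  have h1 := norm_bil_le_left (isKer_commKer β ε) (by positivity : 0 ≤ |ε| * (4 * Real.pi) * Cκ)
    (abs_commKer_le_left hκ ε) (F := F) (hae (F - G))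
  have h2 := norm_bil_le_right (isKer_commKer β ε)
    (by positivity : 0 ≤ |ε| * (4 * Real.pi) * Cκ * (2 * Real.pi))
    (b := fun ξ => θ ξ ^ 3) (abs_commKer_le_right hκ ε) (G := G) (hae (F - G))
  have h3 : |ε| * (4 * Real.pi) * Cκ * θNorm * ‖F‖ * ‖symH isSym_θ3 (F - G)‖ ≤
      |ε| * (4 * Real.pi) * Cκ * (2 * Real.pi) * θNorm * ‖F‖ * ‖symH isSym_θ3 (F - G)‖ := by
    have h : |ε| * (4 * Real.pi) * Cκ ≤ |ε| * (4 * Real.pi) * Cκ * (2 * Real.pi) :=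
      le_mul_of_one_le_right (by positivity) (by linarith)
    generalize |ε| * (4 * Real.pi) * Cκ * (2 * Real.pi) = D at h ⊢
    gcongr
  have h1' : ‖bilH (isKer_commKer β ε) F (F - G)‖ ≤
    |ε| * (4 * Real.pi) * Cκ * θNorm * ‖F‖ * ‖symH isSym_θ3 (F - G)‖ := h1
  have h2' : ‖bilH (isKer_commKer β ε) (F - G) G‖ ≤ |ε| * (4 * Real.pi) * Cκ * (2 * Real.pi) *
    θNorm * ‖symH isSym_θ3 (F - G)‖ * ‖G‖ := h2
  linarith

/-- The quadratic kernel seen from the rough norm. -/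
def lowKer (ε k l : ℝ) : ℝ := θ k ^ 3 * quadKer ε k l

lemma isKer_lowKer (ε : ℝ) : IsKer (lowKer ε) := by
  refine isKer_of_le_left ?_ (fun k l => by rw [lowKer, quadKer_even, θ_neg, lowKer])
    (kerConst_nonneg ε) fun k l => ?_
  · have := measurable_quadKer ε
    have h2 : Measurable fun p : ℝ × ℝ => quadKer ε p.1 p.2 := this
    simp only [Function.uncurry_def, lowKer]
    fun_prop
  · have h1 := (θ_pos (k - l)).le
    have h2 := (θ_pos k).le
    have h3 := (θ_pos l).le
    have h4 := kerConst_nonneg ε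
    rw [lowKer, abs_mul, abs_of_nonneg (by positivity)]
    calc θ k ^ 3 * |quadKer ε k l| ≤ 1 * (kerConst ε * θ (k - l) * 1) := by
          gcongr
          · exact θ_pow_le_one 3 k
          · refine (abs_quadKer_le' ε k l).trans ?_
            gcongr
            exact θ_le_one l
      _ = _ := by ring

/-- The weights `θ k ^ 3 θ l ^ 3` are symmetric and factor out, leaving `sgn l |k| - sgn k |l|`. The
resulting `|k - l|` falls on the smooth coefficient. -/
lemma abs_lowKer_add_le (ε k l : ℝ) : |lowKer ε k l + lowKer ε l k| ≤
    |ε| * (2 * Real.pi) * θ (k - l) * (θ k ^ 3 * θ l ^ 3) := by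
  have h1 := (θ_pos (k - l)).le
  have h2 := (θ_pos k).le
  have h3 := (θ_pos l).le
  have hpi := Real.pi_pos
  have e : lowKer ε k l + lowKer ε l k = ε * (2 * Real.pi) * Real.sign (k - l) *
      (Real.sign l * (|k|) - Real.sign k * (|l|)) * θ (k - l) ^ 3 * (θ k ^ 3 * θ l ^ 3) := by
    simp only [lowKer, quadKer, κ_eq, θ_sub_comm k l, sign_sub_comm k l]
    ring
  rw [e, abs_mul, abs_mul, abs_mul, abs_mul, abs_mul, abs_of_pos Real.two_pi_pos,
    abs_of_nonneg (by positivity : 0 ≤ θ k ^ 3 * θ l ^ 3), abs_of_nonneg (pow_nonneg h1 3)]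
  have h4 := abs_sign_mul_abs_sub_le k l
  have h5 := abs_sign_le_one (k - l)
  have h6 := abs_nonneg (Real.sign l * |k| - Real.sign k * |l|)
  generalize |Real.sign l * (|k|) - Real.sign k * (|l|)| = D at h4 h6 ⊢
  generalize |Real.sign (k - l)| = E at h5 ⊢
  calc _ ≤ |ε| * (2 * Real.pi) * 1 * |k - l| * θ (k - l) ^ 3 * (θ k ^ 3 * θ l ^ 3) := by
        gcongr
    _ = |ε| * (2 * Real.pi) * (|k - l| * θ (k - l) ^ 3) * (θ k ^ 3 * θ l ^ 3) := by ring
    _ ≤ _ := by gcongr; exact abs_mul_θ3_le _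

/-- By symmetry of the kernel the difference of squares factors. The sum is then a real coefficient
acting on the difference, as `abs_inner_bilH_le` requires. -/
lemma bilH_quadKer_sub (ε : ℝ) (F G : Hm) :
    bilH (isKer_quadKer ε) F F - bilH (isKer_quadKer ε) G G =
      bilH (isKer_quadKer ε) (F + G) (F - G) := by
  have := bilH_swap (isKer_quadKer ε) (isKer_quadKer ε) (fun k l => quadKer_swap ε k l) F G
  simp only [map_sub, map_add, LinearMap.add_apply, this]
  abel

/-- The two pairings with `μ` cancel, and the term with `α` is skew. The quadratic term is
controlled by symmetrization, and the remaining two terms by Cauchy–Schwarz. -/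
lemma inner_accel_sub_le (α ε : ℝ) {β : ℝ} (hβ : 0 < β) : ∃ C, 0 ≤ C ∧ ∀ A B A' B' : Hm,
    inner ℝ (symH isSym_θ3 (A - A')) (symH (isSym_μθ3 β) (B - B')) +
      inner ℝ (symH isSym_θ3 (B - B')) (accel α β ε A B - accel α β ε A' B') ≤
    C * (1 + ‖A‖ + ‖A'‖ + ‖B‖ + ‖B'‖) *
      (‖symH isSym_θ3 (A - A')‖ ^ 2 + ‖symH isSym_θ3 (B - B')‖ ^ 2) := by
  obtain ⟨Cκ, hCκ, hκ⟩ := exists_κ_le hβ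
  set C₁ := |ε| * (4 * Real.pi) * Cκ * (2 * Real.pi) * θNorm with hC₁
  set C₂ := |ε| * (2 * Real.pi) * θNorm with hC₂
  have hpi := Real.pi_pos
  have hθ := θNorm_nonneg
  have hC₁0 : 0 ≤ C₁ := by positivity
  have hC₂0 : 0 ≤ C₂ := by positivity
  refine ⟨1 + C₁ + C₂, by positivity, fun A B A' B' => ?_⟩
  set a := A - A' with ha
  set b := B - B' with hb
  set x := ‖symH isSym_θ3 a‖ with hx
  set y := ‖symH isSym_θ3 b‖ with hy
  have e : accel α β ε A B - accel α β ε A' B' =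
      -symH (isSym_μθ3 β) a + symH (isSym_μinvθ3 β) a + skewH α b
      + bilH (isKer_quadKer ε) (B + B') b
      + (bilH (isKer_commKer β ε) A A - bilH (isKer_commKer β ε) A' A') := by
    rw [hb, ← bilH_quadKer_sub, ha]
    simp only [accel, map_sub]
    abel
  have t1 : inner ℝ (symH isSym_θ3 a) (symH (isSym_μθ3 β) b) =
      inner ℝ (symH isSym_θ3 b) (symH (isSym_μθ3 β) a) := by
    rw [inner_symH, symH_comm, ← inner_symH, real_inner_comm]
  have t2 : inner ℝ (symH isSym_θ3 b) (symH (isSym_μinvθ3 β) a) ≤ y * x := by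
    refine (real_inner_le_norm _ _).trans ?_
    gcongr
    refine (norm_symH_le_symH (isSym_μinvθ3 β) isSym_θ3 (C := 1) (fun ξ => ?_) a).trans_eq
      (one_mul _)
    rw [abs_mul, one_mul, abs_of_pos (inv_pos.mpr (μ_pos β ξ))]
    exact mul_le_of_le_one_left (abs_nonneg _) (μ_inv_le_one β ξ)
  have t3 : inner ℝ (symH isSym_θ3 b) (skewH α b) = 0 := inner_skewH isSym_θ3 α b
  have t4 : inner ℝ (symH isSym_θ3 b) (bilH (isKer_quadKer ε) (B + B') b) ≤
      C₂ * (‖B‖ + ‖B'‖) * y ^ 2 := by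
    rw [inner_symH, symH_bilH' (isKer_quadKer ε) (isKer_lowKer ε) isSym_θ3 (fun k l => rfl)]
    refine (le_abs_self _).trans ((abs_inner_bilH_le (isKer_lowKer ε)
      (by positivity : 0 ≤ |ε| * (2 * Real.pi)) isSym_θ3 (fun ξ => pow_nonneg (θ_pos ξ).le 3)
      (abs_lowKer_add_le ε) (B + B') b).trans ?_)
    gcongr
    exact norm_add_le _ _
  have t5 : inner ℝ (symH isSym_θ3 b)
      (bilH (isKer_commKer β ε) A A - bilH (isKer_commKer β ε) A' A') ≤
      y * (C₁ * (‖A‖ + ‖A'‖) * x) := by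
    refine (real_inner_le_norm _ _).trans ?_
    gcongr
    exact norm_bilH_commKer_sub_le hκ ε A A'
  rw [e, inner_add_right, inner_add_right, inner_add_right, inner_add_right, inner_neg_right, t3, t1]
  have n1 := norm_nonneg A
  have n2 := norm_nonneg A'
  have n3 := norm_nonneg B
  have n4 := norm_nonneg B'
  have n5 : 0 ≤ x := norm_nonneg _
  have n6 : 0 ≤ y := norm_nonneg _
  have n7 : y * x ≤ x ^ 2 + y ^ 2 := by nlinarith [sq_nonneg (x - y)]
  set N := 1 + ‖A‖ + ‖A'‖ + ‖B‖ + ‖B'‖ with hN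
  have hq : 0 ≤ x ^ 2 + y ^ 2 := by positivity
  have i1 : y * x ≤ 1 * N * (x ^ 2 + y ^ 2) := by
    rw [one_mul]
    exact n7.trans (le_mul_of_one_le_left hq (by linarith))
  have i2 : C₂ * (‖B‖ + ‖B'‖) * y ^ 2 ≤ C₂ * N * (x ^ 2 + y ^ 2) := by
    gcongr
    · linarith
    · linarith [sq_nonneg x]
  have i3 : y * (C₁ * (‖A‖ + ‖A'‖) * x) ≤ C₁ * N * (x ^ 2 + y ^ 2) := by
    calc y * (C₁ * (‖A‖ + ‖A'‖) * x) = C₁ * (‖A‖ + ‖A'‖) * (y * x) := by ring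
      _ ≤ _ := by
        gcongr
        linarith
  linarith

end Monotone

/-! ### The uniform energy estimate for the truncated equation -/

section Energy

/-- The symmetric cutoff of all three frequencies. -/
def cut3 (n : ℕ) (k l : ℝ) : ℝ := cut n k * cut n (k - l) * cut n l

lemma cut3_nonneg (n : ℕ) (k l : ℝ) : 0 ≤ cut3 n k l :=
  mul_nonneg (mul_nonneg (cut_nonneg _ _) (cut_nonneg _ _)) (cut_nonneg _ _)

lemma cut3_le_one (n : ℕ) (k l : ℝ) : cut3 n k l ≤ 1 :=
  mul_le_one₀ (mul_le_one₀ (cut_le_one _ _) (cut_nonneg _ _) (cut_le_one _ _)) (cut_nonneg _ _)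
    (cut_le_one _ _)

lemma cut3_mul_abs_le (n : ℕ) (k l : ℝ) : cut3 n k l * |l| ≤ n := by
  have h1 : cut n k * cut n (k - l) ≤ 1 :=
    mul_le_one₀ (cut_le_one _ _) (cut_nonneg _ _) (cut_le_one _ _)
  calc cut3 n k l * |l| = (cut n k * cut n (k - l)) * (cut n l * |l|) := by rw [cut3]; ring
    _ ≤ 1 * (cut n l * |l|) := by
        have := cut_nonneg n l
        gcongr
    _ ≤ n := by rw [one_mul]; exact cut_mul_abs_le n l

lemma cut3_swap (n : ℕ) (k l : ℝ) : cut3 n k (k - l) = cut3 n k l := by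
  simp only [cut3, sub_sub_cancel]; ring

lemma cut3_symm (n : ℕ) (k l : ℝ) : cut3 n l k = cut3 n k l := by
  simp only [cut3, cut_sub_comm n k l]; ring

lemma cut3_neg (n : ℕ) (k l : ℝ) : cut3 n (-k) (-l) = cut3 n k l := by
  simp only [cut3, neg_sub_neg_eq, cut_neg]

/-- The truncated quadratic kernel in the smooth norm. -/
def topKer (n : ℕ) (ε k l : ℝ) : ℝ :=
  cut n k * (1 + |k|) ^ 3 * quadKer ε k l * (cut n (k - l) * cut n l)

/-- The part of `topKer` where all derivatives fall on the second factor. -/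
def mainKer (n : ℕ) (ε k l : ℝ) : ℝ :=
  cut3 n k l * (ε * (2 * Real.pi) * (Real.sign (k - l) * l) * θ (k - l) ^ 3)

/-- The commutator part of `topKer`. -/
def remKer (n : ℕ) (ε k l : ℝ) : ℝ :=
  cut3 n k l * (ε * (2 * Real.pi) * (Real.sign (k - l) * Real.sign l) *
    ((topWeight k - topWeight (k - l) - topWeight l) * (θ (k - l) ^ 3 * θ l ^ 3)))

/-- The weight `topWeight k` is replaced by its Leibniz expansion. In each main part `(1 + |l|)³`
cancels `θ l ^ 3`, and `sgn l · |l| = l` leaves one full derivative on that input. -/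
lemma topKer_eq (n : ℕ) (ε k l : ℝ) :
    topKer n ε k l = remKer n ε k l + (mainKer n ε k l + mainKer n ε k (k - l)) := by
  have h1 : θ l ^ 3 * (1 + |l|) ^ 3 = 1 := by rw [← mul_pow, θ_mul, one_pow]
  have h2 : θ (k - l) ^ 3 * (1 + |k - l|) ^ 3 = 1 := by rw [← mul_pow, θ_mul, one_pow]
  have h3 : ∀ x : ℝ, Real.sign x * |x| = x := fun x => by
    rcases lt_trichotomy x 0 with h | h | h
    · rw [Real.sign_of_neg h, abs_of_neg h]; ring
    · simp [h]
    · rw [Real.sign_of_pos h, abs_of_pos h, one_mul]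
  simp only [topKer, remKer, mainKer, cut3_swap, sub_sub_cancel, topWeight, quadKer, κ_eq]
  rw [cut3]
  set s := Real.sign (k - l)
  set s' := Real.sign l
  have e1 : s * l = s * (s' * |l|) := by rw [h3]
  have e2 : s' * (k - l) = s' * (s * |k - l|) := by rw [h3]
  rw [e1, e2]
  linear_combination
    (cut n k * cut n (k - l) * cut n l * (ε * (2 * Real.pi) * (s * s' * |l|) * θ (k - l) ^ 3)) * h1
    + (cut n k * cut n (k - l) * cut n l * (ε * (2 * Real.pi) * (s * s' * |k - l|) * θ l ^ 3)) * h2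

lemma measurable_topWeight : Measurable topWeight := by unfold topWeight; fun_prop

/-- The kernel has an uncompensated factor `l`, so without the cutoffs it would not be admissible.
The bound grows with `n` and only makes the operator well defined; the uniform bound comes from
`abs_mainKer_add_le`. -/
lemma isKer_mainKer (n : ℕ) (ε : ℝ) : IsKer (mainKer n ε) := by
  refine isKer_of_le_left ?_ (fun k l => ?_) (C := |ε| * (2 * Real.pi) * n)
    (by have := Real.pi_pos; positivity) fun k l => ?_
  · simp only [Function.uncurry_def, mainKer, cut3]; fun_prop
  · simp only [mainKer, cut3_neg, neg_sub_neg_eq, Real.sign_neg, θ_neg]; ring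
  · have h1 := (θ_pos (k - l)).le
    have h2 := cut3_nonneg n k l
    have hpi := Real.pi_pos
    rw [mainKer, abs_mul, abs_mul _ (θ _ ^ 3), abs_mul _ (Real.sign _ * l), abs_mul (Real.sign _),
      abs_mul ε, abs_of_nonneg h2, abs_of_pos Real.two_pi_pos, abs_of_nonneg (pow_nonneg h1 3)]
    calc _ = |ε| * (2 * Real.pi) * (cut3 n k l * |l|) * |Real.sign (k - l)| * θ (k - l) ^ 2 *
          θ (k - l) := by ring
      _ ≤ |ε| * (2 * Real.pi) * n * 1 * 1 * θ (k - l) := by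
          gcongr
          · exact cut3_mul_abs_le n k l
          · exact abs_sign_le_one _
          · exact θ_pow_le_one 2 _
      _ = _ := by ring

lemma isKer_mainKer_swap (n : ℕ) (ε : ℝ) : IsKer fun k l => mainKer n ε k (k - l) := by
  obtain ⟨hm, he, C, hC, hb⟩ := isKer_mainKer n ε
  refine ⟨?_, fun k l => by simp only [neg_sub_neg_eq]; exact he k (k - l), C, hC, fun k l => ?_⟩
  · exact hm.comp (f := fun p : ℝ × ℝ => (p.1, p.1 - p.2)) (by fun_prop)
  · have := hb k (k - l)
    rw [sub_sub_cancel, add_comm] at this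
    exact this

/-- In each Leibniz error term the input with three derivatives uses up its weights, while the other
spends `θ³` on one derivative and retains decay. The constant is `10 · 2π`. -/
lemma abs_remKer_le (n : ℕ) (ε k l : ℝ) :
    |remKer n ε k l| ≤ |ε| * (20 * Real.pi) * (θ (k - l) + θ l) := by
  have h1 := (θ_pos (k - l)).le
  have h2 := (θ_pos l).le
  have h3 := cut3_nonneg n k l
  have hpi := Real.pi_pos
  have e1 : θ l ^ 3 * (1 + |l|) ^ 3 = 1 := by rw [← mul_pow, θ_mul, one_pow]
  have e2 : θ (k - l) ^ 3 * (1 + |k - l|) ^ 3 = 1 := by rw [← mul_pow, θ_mul, one_pow]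
  rw [remKer, abs_mul, abs_mul (ε * (2 * Real.pi) * _), abs_mul (ε * (2 * Real.pi)), abs_mul ε,
    abs_mul _ (θ _ ^ 3 * _), abs_of_nonneg h3, abs_of_pos Real.two_pi_pos, abs_of_nonneg (by positivity : 0 ≤ θ (k - l) ^ 3 * θ l ^ 3)]
  calc _ ≤ 1 * (|ε| * (2 * Real.pi) * 1 *
        ((10 * (|k - l| * (1 + |l|) ^ 3 + |l| * (1 + |k - l|) ^ 3)) *
          (θ (k - l) ^ 3 * θ l ^ 3))) := by
        gcongr
        · exact cut3_le_one n k l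
        · exact abs_sign_mul_sign_le _ _
        · exact abs_topWeight_sub_le k l
    _ = |ε| * (20 * Real.pi) * (|k - l| * θ (k - l) ^ 3 * (θ l ^ 3 * (1 + |l|) ^ 3)
          + |l| * θ l ^ 3 * (θ (k - l) ^ 3 * (1 + |k - l|) ^ 3)) := by ring
    _ = |ε| * (20 * Real.pi) * (|k - l| * θ (k - l) ^ 3 + |l| * θ l ^ 3) := by
        rw [e1, e2, mul_one, mul_one]
    _ ≤ _ := by
        gcongr
        · exact abs_mul_θ3_le _
        · exact abs_mul_θ3_le _

lemma isKer_remKer (n : ℕ) (ε : ℝ) : IsKer (remKer n ε) := by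
  refine ⟨?_, fun k l => ?_, |ε| * (20 * Real.pi), by have := Real.pi_pos; positivity,
    abs_remKer_le n ε⟩
  · have := measurable_topWeight
    simp only [Function.uncurry_def, remKer, cut3]
    fun_prop
  · simp only [remKer, cut3_neg, neg_sub_neg_eq, Real.sign_neg, θ_neg, topWeight, abs_neg]
    ring

lemma IsKer.add {σ τ : ℝ → ℝ → ℝ} (hσ : IsKer σ) (hτ : IsKer τ) :
    IsKer fun k l => σ k l + τ k l := by
  obtain ⟨hm, he, C, hC, hb⟩ := hσ
  obtain ⟨hm', he', C', hC', hb'⟩ := hτ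
  refine ⟨hm.add hm', fun k l => by rw [he, he'], C + C', by positivity, fun k l => ?_⟩
  rw [add_mul]
  exact (abs_add_le _ _).trans (add_le_add (hb k l) (hb' k l))

lemma isKer_topKer (n : ℕ) (ε : ℝ) : IsKer (topKer n ε) := by
  have := (isKer_remKer n ε).add ((isKer_mainKer n ε).add (isKer_mainKer_swap n ε))
  rwa [show topKer n ε = _ from funext₂ (topKer_eq n ε)]

/-- The sum of `sgn (k - l) l` and `sgn (l - k) k` is `-|k - l|`. The cutoff `cut3` was chosen
invariant under this exchange, so it does not destroy the cancellation. -/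
lemma abs_mainKer_add_le (n : ℕ) (ε k l : ℝ) :
    |mainKer n ε k l + mainKer n ε l k| ≤ |ε| * (2 * Real.pi) * θ (k - l) := by
  have h1 := (θ_pos (k - l)).le
  have h3 := cut3_nonneg n k l
  have hpi := Real.pi_pos
  have e : mainKer n ε k l + mainKer n ε l k =
      cut3 n k l * (ε * (2 * Real.pi)) * Real.sign (k - l) * (-(k - l)) * θ (k - l) ^ 3 := by
    simp only [mainKer, cut3_symm n k l, θ_sub_comm k l, sign_sub_comm k l]
    ring
  rw [e, abs_mul, abs_mul, abs_mul, abs_mul, abs_mul, abs_neg, abs_of_nonneg h3,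
    abs_of_pos Real.two_pi_pos, abs_of_nonneg (pow_nonneg h1 3)]
  calc _ ≤ 1 * (|ε| * (2 * Real.pi)) * 1 * |k - l| * θ (k - l) ^ 3 := by
        gcongr
        · exact cut3_le_one n k l
        · exact abs_sign_le_one _
    _ = |ε| * (2 * Real.pi) * (|k - l| * θ (k - l) ^ 3) := by ring
    _ ≤ _ := by gcongr; exact abs_mul_θ3_le _

/-- Since `B` is truncated, cutoffs may be inserted on both inputs. The two main parts contribute
equally; with the remainder the constant is `2 · 2π + 2 · 20π = 44π`. -/
lemma inner_quad_le (n : ℕ) (ε : ℝ) {B : Hm} (hB : symH (isSym_cut n) B = B) :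
    inner ℝ B (symH (isSym_cutW n) (bilH (isKer_quadKer ε) B B)) ≤
      |ε| * (44 * Real.pi) * θNorm * ‖B‖ * ‖B‖ ^ 2 := by
  have hpi := Real.pi_pos
  have hs := isKer_mainKer_swap n ε
  have e1 : symH (isSym_cutW n) (bilH (isKer_quadKer ε) B B) = bilH (isKer_topKer n ε) B B := by
    have := symH_bilH (isKer_quadKer ε) (isKer_topKer n ε) (isSym_cutW n) (isSym_cut n)
      (fun k l => rfl) B B
    rwa [hB] at this
  have e2 := bilH_add_kernel (isKer_remKer n ε) ((isKer_mainKer n ε).add hs) (isKer_topKer n ε)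
    (topKer_eq n ε) B B
  have e3 := bilH_add_kernel (isKer_mainKer n ε) hs ((isKer_mainKer n ε).add hs)
    (fun _ _ => rfl) B B
  have e4 := bilH_swap (isKer_mainKer n ε) hs (fun _ _ => rfl) B B
  have h1 := abs_inner_bilH_le' (isKer_mainKer n ε) (by positivity : 0 ≤ |ε| * (2 * Real.pi))
    (abs_mainKer_add_le n ε) B B
  have h2 : ‖bilH (isKer_remKer n ε) B B‖ ≤ 2 * (|ε| * (20 * Real.pi)) * θNorm * ‖B‖ * ‖B‖ :=
    norm_bil_le (isKer_remKer n ε) (by positivity) (abs_remKer_le n ε) B B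
  have h3 : inner ℝ B (bilH (isKer_remKer n ε) B B) ≤
      ‖B‖ * (2 * (|ε| * (20 * Real.pi)) * θNorm * ‖B‖ * ‖B‖) :=
    (real_inner_le_norm _ _).trans (by gcongr)
  rw [e1, e2, e3, ← e4, inner_add_right, inner_add_right]
  have h4 := le_abs_self (inner ℝ B (bilH (isKer_mainKer n ε) B B))
  linarith

/-- The truncated commutator kernel in the smooth norm. -/
def topCommKer (n : ℕ) (β ε k l : ℝ) : ℝ := cut n k * (1 + |k|) ^ 3 * commKer β ε k l

/-- Where the kernel does not vanish, `|k| ≤ |k - l|`, so `θ (k - l) ^ 3` absorbs the energy weight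
`(1 + |k|)³`. The derivatives `|k - l|` and `κ l` that remain are absorbed by the two factors `μ⁻¹`.
-/
lemma abs_topCommKer_le {β Cκ : ℝ} (hκ : ∀ ξ, κ ξ * (μ β ξ)⁻¹ ≤ Cκ) (n : ℕ) (ε k l : ℝ) :
    |topCommKer n β ε k l| ≤ |ε| * (4 * Real.pi) * Cκ ^ 2 * θ l := by
  have h1 := (θ_pos (k - l)).le
  have h2 := (θ_pos l).le
  have h4 := (μ_pos β l).le
  have h5 := (μ_pos β (k - l)).le
  have hpi := Real.pi_pos
  have hk := κ_nonneg l
  have hC : 0 ≤ Cκ := (mul_nonneg (κ_nonneg 0) (inv_nonneg.mpr (μ_pos β 0).le)).trans (hκ 0)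
  have hpos : 0 ≤ |ε| * (4 * Real.pi) * Cκ ^ 2 * θ l := by positivity
  by_cases hl : l = 0
  · simpa [topCommKer, commKer, hl, κ] using hpos
  by_cases hs : k * (Real.sign k - Real.sign l) = 0
  · simpa [topCommKer, commKer, hs] using hpos
  have hkl := abs_le_of_sign_ne hl hs
  have hw : (1 + |k|) ^ 3 * θ (k - l) ^ 3 ≤ 1 := by
    rw [← mul_pow]
    refine pow_le_one₀ (by positivity) ?_
    calc (1 + |k|) * θ (k - l) ≤ (1 + |k - l|) * θ (k - l) := by gcongr
      _ = 1 := by rw [mul_comm, θ_mul]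
  rw [topCommKer, abs_mul, abs_mul, abs_of_nonneg (cut_nonneg n k),
    abs_of_nonneg (by positivity : 0 ≤ (1 + |k|) ^ 3)]
  calc cut n k * (1 + |k|) ^ 3 * |commKer β ε k l|
      ≤ 1 * (1 + |k|) ^ 3 * (|ε| * (4 * Real.pi) * (|k - l| * (μ β (k - l))⁻¹ * θ (k - l) ^ 3) *
        (κ l * (μ β l)⁻¹ * θ l ^ 3)) := by
        gcongr
        · exact cut_le_one n k
        · exact abs_commKer_le β ε k l
    _ = |ε| * (4 * Real.pi) * (|k - l| * (μ β (k - l))⁻¹) * (κ l * (μ β l)⁻¹) *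
        ((1 + |k|) ^ 3 * θ (k - l) ^ 3) * θ l ^ 2 * θ l := by ring
    _ ≤ |ε| * (4 * Real.pi) * Cκ * Cκ * 1 * 1 * θ l := by
        gcongr
        · exact abs_mul_μinv_le hκ _
        · exact hκ l
        · exact θ_pow_le_one 2 l
    _ = _ := by ring

lemma isKer_topCommKer {β : ℝ} (hβ : 0 < β) (n : ℕ) (ε : ℝ) : IsKer (topCommKer n β ε) := by
  obtain ⟨Cκ, hCκ, hκ⟩ := exists_κ_le hβ
  refine isKer_of_le_right ?_ (fun k l => ?_) (by have := Real.pi_pos; positivity)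
    (abs_topCommKer_le hκ n ε)
  · have h2 : Measurable fun p : ℝ × ℝ => commKer β ε p.1 p.2 := measurable_commKer β ε
    simp only [Function.uncurry_def, topCommKer]
    fun_prop
  · rw [topCommKer, commKer_even, cut_neg, abs_neg, topCommKer]

/-- The structure is that of `inner_accel_sub_le` with the weight `cut n (1 + |ξ|)³` in place of
`θ³`. All constants are independent of `n`. -/
lemma inner_accel_le (α ε : ℝ) {β : ℝ} (hβ : 0 < β) : ∃ C, 0 ≤ C ∧ ∀ (n : ℕ) (A B : Hm),
    symH (isSym_cut n) B = B →
    inner ℝ A (symH (isSym_cutW n) (symH (isSym_μθ3 β) B)) +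
      inner ℝ B (symH (isSym_cutW n) (accel α β ε A B)) ≤
    C * (1 + ‖A‖ + ‖B‖) * (‖A‖ ^ 2 + ‖B‖ ^ 2) := by
  obtain ⟨Cκ, hCκ, hκ⟩ := exists_κ_le hβ
  set C₁ := |ε| * (4 * Real.pi) * Cκ ^ 2 * θNorm with hC₁
  set C₂ := |ε| * (44 * Real.pi) * θNorm with hC₂
  have hpi := Real.pi_pos
  have hθ := θNorm_nonneg
  have hC₁0 : 0 ≤ C₁ := by positivity
  have hC₂0 : 0 ≤ C₂ := by positivity
  refine ⟨1 + C₁ + C₂, by positivity, fun n A B hB => ?_⟩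
  have t1 : inner ℝ A (symH (isSym_cutW n) (symH (isSym_μθ3 β) B)) =
      inner ℝ B (symH (isSym_cutW n) (symH (isSym_μθ3 β) A)) := by
    rw [← inner_symH, ← inner_symH, real_inner_comm, symH_comm]
  have t2 : inner ℝ B (symH (isSym_cutW n) (symH (isSym_μinvθ3 β) A)) ≤ ‖B‖ * ‖A‖ := by
    refine (real_inner_le_norm _ _).trans ?_
    gcongr
    rw [symH_comp (isSym_cutW n) (isSym_μinvθ3 β) ((isSym_cutW n).mul (isSym_μinvθ3 β))
      (fun _ => rfl)]
    refine (norm_symH_le _ (C := 1) (fun ξ => ?_) A).trans_eq (one_mul _)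
    have h2 := θ_pos ξ
    have h3 := μ_pos β ξ
    have h4 := cut_nonneg n ξ
    rw [abs_of_nonneg (by positivity)]
    calc cut n ξ * (1 + |ξ|) ^ 3 * ((μ β ξ)⁻¹ * θ ξ ^ 3)
        = cut n ξ * (μ β ξ)⁻¹ * (θ ξ * (1 + |ξ|)) ^ 3 := by ring
      _ ≤ 1 * 1 * (1 : ℝ) ^ 3 := by
          rw [θ_mul]
          gcongr
          · exact cut_le_one n ξ
          · exact μ_inv_le_one β ξ
      _ = 1 := by ring
  have t3 : inner ℝ B (symH (isSym_cutW n) (skewH α B)) = 0 := by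
    rw [← inner_symH]
    exact inner_skewH _ α B
  have t4 := inner_quad_le n ε hB
  have t5 : inner ℝ B (symH (isSym_cutW n) (bilH (isKer_commKer β ε) A A)) ≤
      ‖B‖ * (C₁ * ‖A‖ * ‖A‖) := by
    rw [symH_bilH' (isKer_commKer β ε) (isKer_topCommKer hβ n ε) (isSym_cutW n) (fun _ _ => rfl)]
    refine (real_inner_le_norm _ _).trans ?_
    gcongr
    exact norm_bil_le_right (isKer_topCommKer hβ n ε)
      (by positivity : 0 ≤ |ε| * (4 * Real.pi) * Cκ ^ 2) (b := fun _ => 1)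
      (F := A) (G := A) (F' := (A : L2))
      (fun k l => by simpa using abs_topCommKer_le hκ n ε k l) (by simp)
  simp only [accel, map_add, map_neg, inner_add_right, inner_neg_right]
  rw [t3, t1]
  have n1 := norm_nonneg A
  have n3 := norm_nonneg B
  set x := ‖A‖
  set y := ‖B‖
  have n7 : y * x ≤ x ^ 2 + y ^ 2 := by nlinarith [sq_nonneg (x - y)]
  have hq : 0 ≤ x ^ 2 + y ^ 2 := by positivity
  have i1 : y * x ≤ 1 * (1 + x + y) * (x ^ 2 + y ^ 2) := by
    rw [one_mul]
    exact n7.trans (le_mul_of_one_le_left hq (by linarith))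
  have i2 : C₂ * y * y ^ 2 ≤ C₂ * (1 + x + y) * (x ^ 2 + y ^ 2) := by
    gcongr
    · linarith
    · linarith [sq_nonneg x]
  have i3 : y * (C₁ * x * x) ≤ C₁ * (1 + x + y) * (x ^ 2 + y ^ 2) := by
    calc y * (C₁ * x * x) = C₁ * x * (y * x) := by ring
      _ ≤ _ := by
        gcongr
        linarith
  linarith

end Energy


/-! ### The phase space and the verification of the abstract hypotheses -/

lemma tendsto_symH_cut (F : Hm) : Tendsto (fun n => symH (isSym_cut n) F) atTop (𝓝 F) := by
  rw [tendsto_iff_norm_sub_tendsto_zero]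
  have hint : Integrable (fun ξ => ‖(F : L2) ξ‖ ^ 2) := by
    have := (Lp.memLp (F : L2)).integrable_norm_pow (p := 2) (by norm_num)
    simpa using this
  have h : ∀ n, ‖symH (isSym_cut n) F - F‖ ^ 2 =
      ∫ ξ, (1 - cut n ξ) ^ 2 * ‖(F : L2) ξ‖ ^ 2 := fun n => by
    rw [Submodule.coe_norm, L2.norm_sq_eq]
    refine integral_congr_ae ?_
    filter_upwards [Lp.coeFn_sub (symH (isSym_cut n) F : L2) (F : L2),
      coeFn_symH (isSym_cut n) F] with ξ h1 h2
    rw [Submodule.coe_sub, h1, Pi.sub_apply, h2,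
      show (cut n ξ : ℂ) * (F : L2) ξ - (F : L2) ξ = ((cut n ξ - 1 : ℝ) : ℂ) * (F : L2) ξ by
        push_cast; ring, norm_mul, mul_pow, Complex.norm_real, Real.norm_eq_abs, sq_abs]
    ring
  have key : Tendsto (fun n => ‖symH (isSym_cut n) F - F‖ ^ 2) atTop (𝓝 0) := by
    simp_rw [h]
    rw [← integral_zero ℝ ℝ (μ := volume)]
    refine tendsto_integral_of_dominated_convergence (fun ξ => ‖(F : L2) ξ‖ ^ 2) (fun n => ?_) hint
      (fun n => Eventually.of_forall fun ξ => ?_) (Eventually.of_forall fun ξ => ?_)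
    · exact (Measurable.aestronglyMeasurable (by fun_prop)).mul hint.aestronglyMeasurable
    · rw [Real.norm_of_nonneg (mul_nonneg (sq_nonneg _) (sq_nonneg _))]
      exact mul_le_of_le_one_left (sq_nonneg _)
        (pow_le_one₀ (by linarith [cut_le_one n ξ]) (by linarith [cut_nonneg n ξ]))
    · obtain ⟨N, hN⟩ := exists_nat_ge |ξ|
      refine tendsto_const_nhds.congr' ?_
      filter_upwards [eventually_ge_atTop N] with n hn
      have : |ξ| ≤ n := hN.trans (by exact_mod_cast hn)
      simp [cut, this]
  have := key.sqrt
  simpa [Real.sqrt_sq] using this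

lemma norm_symH_θ3_sub_le (n : ℕ) (F : Hm) :
    ‖symH isSym_θ3 F - symH (isSym_cut n) (symH isSym_θ3 F)‖ ≤ ‖F‖ / (n + 1) := by
  have hm : Measurable fun ξ => (1 - cut n ξ) * θ ξ ^ 3 := by fun_prop
  have hb : ∀ ξ, |(1 - cut n ξ) * θ ξ ^ 3| ≤ 1 / ((n : ℝ) + 1) := fun ξ => by
    have h0 := θ_pos ξ
    by_cases h : |ξ| ≤ n
    · simp only [cut, h, if_true, sub_self, zero_mul, abs_zero]
      positivity
    · simp only [cut, h, if_false, sub_zero, one_mul]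
      rw [abs_of_nonneg (by positivity)]
      calc θ ξ ^ 3 = θ ξ ^ 2 * θ ξ := by ring
        _ ≤ 1 * θ ξ := by gcongr; exact θ_pow_le_one 2 ξ
        _ ≤ _ := by
          rw [one_mul, θ, ← one_div]
          exact one_div_le_one_div_of_le (by positivity) (by linarith)
  have hs : IsSym fun ξ => (1 - cut n ξ) * θ ξ ^ 3 :=
    ⟨hm, fun ξ => by rw [cut_neg, θ_neg], _, hb⟩
  have e : symH isSym_θ3 F - symH (isSym_cut n) (symH isSym_θ3 F) = symH hs F := by
    refine Subtype.ext (Lp.ext ?_)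
    filter_upwards [Lp.coeFn_sub (symH isSym_θ3 F : L2) (symH (isSym_cut n) (symH isSym_θ3 F) : L2),
      coeFn_symH (isSym_cut n) (symH isSym_θ3 F), coeFn_symH isSym_θ3 F, coeFn_symH hs F]
      with ξ h1 h2 h3 h4
    rw [Submodule.coe_sub, h1, Pi.sub_apply, h2, h3, h4]
    push_cast
    ring
  rw [e]
  refine (norm_symH_le hs hb F).trans_eq ?_
  ring

/-- Interpolation between the smooth and the rough norm: where `θ ≤ δ` the smooth norm gains the
factor `δ`, and elsewhere `θ ≤ δ⁻² θ³`. -/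
lemma norm_symH_θ_le {δ : ℝ} (hδ : 0 < δ) (F : Hm) :
    ‖symH isSym_θ F‖ ≤ δ * ‖F‖ + (δ ^ 2)⁻¹ * ‖symH isSym_θ3 F‖ := by
  have hms : MeasurableSet {ξ | θ ξ ≤ δ} := measurableSet_le (by fun_prop) (by fun_prop)
  have hs : ∀ ξ : ℝ, |if θ ξ ≤ δ then θ ξ else 0| ≤ δ := fun ξ => by
    have := (θ_pos ξ).le
    split_ifs with h
    · rwa [abs_of_nonneg this]
    · simpa using hδ.le
  have ht : ∀ ξ : ℝ, |if θ ξ ≤ δ then 0 else θ ξ| ≤ (δ ^ 2)⁻¹ * |θ ξ ^ 3| := fun ξ => by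
    have h0 := (θ_pos ξ)
    rw [abs_of_nonneg (pow_nonneg h0.le 3)]
    split_ifs with h
    · simp only [abs_zero]; positivity
    · rw [abs_of_pos h0, inv_mul_eq_div, le_div_iff₀ (by positivity)]
      rw [not_le] at h
      calc θ ξ * δ ^ 2 ≤ θ ξ * θ ξ ^ 2 := by gcongr
        _ = _ := by ring
  have h₁ : IsSym fun ξ => if θ ξ ≤ δ then θ ξ else 0 :=
    ⟨Measurable.ite hms (by fun_prop) (by fun_prop), fun ξ => by simp only [θ_neg], δ, hs⟩
  have h₂ : IsSym fun ξ => if θ ξ ≤ δ then 0 else θ ξ := by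
    refine ⟨Measurable.ite hms (by fun_prop) (by fun_prop), fun ξ => by simp only [θ_neg], 1,
      fun ξ => ?_⟩
    have := (θ_pos ξ).le
    split_ifs
    · simp
    · rw [abs_of_nonneg this]
      exact θ_le_one ξ
  have e : symH isSym_θ F = symH h₁ F + symH h₂ F := by
    refine Subtype.ext (Lp.ext ?_)
    filter_upwards [Lp.coeFn_add (symH h₁ F : L2) (symH h₂ F : L2), coeFn_symH isSym_θ F,
      coeFn_symH h₁ F, coeFn_symH h₂ F] with ξ g1 g2 g3 g4
    rw [Submodule.coe_add, g1, Pi.add_apply, g2, g3, g4]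
    split_ifs <;> simp
  rw [e]
  exact (norm_add_le _ _).trans (add_le_add (norm_symH_le h₁ hs F) (norm_symH_le_symH h₂ _ ht F))

/-- The phase space, in terms of the Fourier transforms of position and velocity. -/
abbrev Phase : Type := WithLp 2 (Hm × Hm)

/-- The diagonal action of an operator on both components. -/
def diag (S : Hm →L[ℝ] Hm) : Phase →L[ℝ] Phase :=
  ((WithLp.prodContinuousLinearEquiv 2 ℝ Hm Hm).symm : (Hm × Hm) →L[ℝ] Phase) ∘L
    (S.prodMap S) ∘L ((WithLp.prodContinuousLinearEquiv 2 ℝ Hm Hm) : Phase →L[ℝ] (Hm × Hm))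

@[simp] lemma diag_fst (S : Hm →L[ℝ] Hm) (x : Phase) : (diag S x).fst = S x.fst := rfl

@[simp] lemma diag_snd (S : Hm →L[ℝ] Hm) (x : Phase) : (diag S x).snd = S x.snd := rfl

lemma Phase.ext {x y : Phase} (h₁ : x.fst = y.fst) (h₂ : x.snd = y.snd) : x = y :=
  WithLp.ofLp_injective 2 (Prod.ext h₁ h₂)

lemma Phase.norm_le {x y : Phase} {c : ℝ} (hc : 0 ≤ c) (h₁ : ‖x.fst‖ ≤ c * ‖y.fst‖)
    (h₂ : ‖x.snd‖ ≤ c * ‖y.snd‖) : ‖x‖ ≤ c * ‖y‖ := by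
  refine le_of_sq_le_sq ?_ (by positivity)
  rw [mul_pow, WithLp.prod_norm_sq_eq_of_L2, WithLp.prod_norm_sq_eq_of_L2, mul_add, ← mul_pow,
    ← mul_pow]
  gcongr

lemma Phase.norm_le_add (x : Phase) : ‖x‖ ≤ ‖x.fst‖ + ‖x.snd‖ := by
  refine le_of_sq_le_sq ?_ (by positivity)
  rw [WithLp.prod_norm_sq_eq_of_L2]
  nlinarith [norm_nonneg x.fst, norm_nonneg x.snd]

lemma Phase.norm_fst_le (x : Phase) : ‖x.fst‖ ≤ ‖x‖ := WithLp.norm_fst_le _ _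

lemma Phase.norm_snd_le (x : Phase) : ‖x.snd‖ ≤ ‖x‖ := WithLp.norm_snd_le _ _

lemma Phase.inner_eq (x y : Phase) :
    inner ℝ x y = inner ℝ x.fst y.fst + inner ℝ x.snd y.snd := WithLp.prod_inner_apply x y

/-- The right-hand side of the first-order system for `(f, f_t)` in the smooth variables. -/
def flow (α β ε : ℝ) (x : Phase) : Phase :=
  WithLp.toLp 2 (symH (isSym_μθ3 β) x.snd, accel α β ε x.fst x.snd)

@[simp] lemma flow_fst (α β ε : ℝ) (x : Phase) :
    (flow α β ε x).fst = symH (isSym_μθ3 β) x.snd := rfl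

@[simp] lemma flow_snd (α β ε : ℝ) (x : Phase) :
    (flow α β ε x).snd = accel α β ε x.fst x.snd := rfl

lemma exists_norm_flow_sub_le (α β ε : ℝ) : ∃ C, 0 ≤ C ∧ ∀ R, 0 ≤ R → ∀ x y : Phase, ‖x‖ ≤ R →
    ‖y‖ ≤ R → ‖flow α β ε x - flow α β ε y‖ ≤ C * (1 + R) * ‖diag (symH isSym_θ) (x - y)‖ := by
  obtain ⟨C₁, hC₁, h₁⟩ := exists_μ_le β
  obtain ⟨C₂, hC₂, h₂⟩ := exists_norm_accel_sub_le α β ε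
  refine ⟨C₁ + 8 * C₂, by positivity, fun R hR x y hx hy => ?_⟩
  set d := diag (symH isSym_θ) (x - y) with hd
  have i1 : ‖symH isSym_θ (x.fst - y.fst)‖ ≤ ‖d‖ := Phase.norm_fst_le d
  have i2 : ‖symH isSym_θ (x.snd - y.snd)‖ ≤ ‖d‖ := Phase.norm_snd_le d
  have i3 : ‖symH (isSym_μθ3 β) (x.snd - y.snd)‖ ≤ C₁ * ‖symH isSym_θ (x.snd - y.snd)‖ :=
    norm_symH_le_symH _ _ (fun ξ => by
      have h3 := (θ_pos ξ).le
      have h4 := (μ_pos β ξ).le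
      rw [abs_of_nonneg (by positivity), abs_of_nonneg h3]
      calc μ β ξ * θ ξ ^ 3 = (μ β ξ * θ ξ ^ 2) * θ ξ := by ring
        _ ≤ _ := by gcongr; exact h₁ ξ) _
  have e1 : (flow α β ε x - flow α β ε y).fst = symH (isSym_μθ3 β) (x.snd - y.snd) := by
    rw [WithLp.sub_fst, flow_fst, flow_fst, map_sub]
  have e2 : (flow α β ε x - flow α β ε y).snd =
    accel α β ε x.fst x.snd - accel α β ε y.fst y.snd := rfl
  refine (Phase.norm_le_add _).trans ?_
  rw [e1, e2]
  have i4 := h₂ x.fst x.snd y.fst y.snd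
  have hd0 : 0 ≤ ‖d‖ := norm_nonneg _
  have i5 : C₂ * (1 + ‖x.fst‖ + ‖y.fst‖ + ‖x.snd‖ + ‖y.snd‖) *
      (‖symH isSym_θ (x.fst - y.fst)‖ + ‖symH isSym_θ (x.snd - y.snd)‖) ≤
      C₂ * (4 * (1 + R)) * (‖d‖ + ‖d‖) := by
    gcongr
    linarith [(Phase.norm_fst_le x).trans hx, (Phase.norm_fst_le y).trans hy,
      (Phase.norm_snd_le x).trans hx, (Phase.norm_snd_le y).trans hy]
  have i6 : C₁ * ‖symH isSym_θ (x.snd - y.snd)‖ ≤ C₁ * (1 + R) * ‖d‖ := by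
    gcongr
    exact le_mul_of_one_le_right hC₁ (by linarith)
  calc _ ≤ C₁ * (1 + R) * ‖d‖ + C₂ * (4 * (1 + R)) * (‖d‖ + ‖d‖) :=
        add_le_add (i3.trans i6) (i4.trans i5)
    _ = _ := by ring

lemma norm_diag_θ_le {δ : ℝ} (hδ : 0 < δ) (x : Phase) :
    ‖diag (symH isSym_θ) x‖ ≤ 2 * δ * ‖x‖ + 2 * (δ ^ 2)⁻¹ * ‖diag (symH isSym_θ3) x‖ := by
  have h1 := norm_symH_θ_le hδ x.fst
  have h2 := norm_symH_θ_le hδ x.snd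
  have h3 := Phase.norm_le_add (diag (symH isSym_θ) x)
  have h4 : ‖symH isSym_θ3 x.fst‖ ≤ _ := Phase.norm_fst_le (diag (symH isSym_θ3) x)
  have h5 : ‖symH isSym_θ3 x.snd‖ ≤ _ := Phase.norm_snd_le (diag (symH isSym_θ3) x)
  have h6 := mul_le_mul_of_nonneg_left h4 (by positivity : 0 ≤ (δ ^ 2)⁻¹)
  have h7 := mul_le_mul_of_nonneg_left h5 (by positivity : 0 ≤ (δ ^ 2)⁻¹)
  have h8 := mul_le_mul_of_nonneg_left (Phase.norm_fst_le x) hδ.le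
  have h9 := mul_le_mul_of_nonneg_left (Phase.norm_snd_le x) hδ.le
  simp only [diag_fst, diag_snd] at h3
  linarith

theorem isQuasilinear_flow (α ε : ℝ) {β : ℝ} (hβ : 0 < β) :
    IsQuasilinear (diag (symH isSym_θ3)) (fun n => diag (symH (isSym_cut n)))
      (fun n => diag (symH (isSym_cutW n))) (flow α β ε) where
  norm_P_le n x := by
    have h : ∀ F : Hm, ‖symH (isSym_cut n) F‖ ≤ 1 * ‖F‖ := norm_symH_le _ fun ξ => by
      rw [abs_of_nonneg (cut_nonneg n ξ)]; exact cut_le_one n ξ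
    simpa using Phase.norm_le (x := diag (symH (isSym_cut n)) x) zero_le_one (h x.fst) (h x.snd)
  P_symm n x y := by
    rw [Phase.inner_eq, Phase.inner_eq, diag_fst, diag_snd, inner_symH, inner_symH, diag_fst,
      diag_snd]
  P_tendsto x := by
    rw [tendsto_iff_norm_sub_tendsto_zero]
    have h1 := tendsto_iff_norm_sub_tendsto_zero.mp (tendsto_symH_cut x.fst)
    have h2 := tendsto_iff_norm_sub_tendsto_zero.mp (tendsto_symH_cut x.snd)
    refine squeeze_zero (fun _ => norm_nonneg _)
      (fun n => Phase.norm_le_add (diag (symH (isSym_cut n)) x - x)) ?_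
    simpa using h1.add h2
  P_W m n hmn x := by
    have h : ∀ ξ, cut m ξ * (cut n ξ * (1 + |ξ|) ^ 3) = cut m ξ * (1 + |ξ|) ^ 3 := fun ξ => by
      rw [← mul_assoc, cut_mul_cut hmn]
    have key := symH_comp (isSym_cut m) (isSym_cutW n) (isSym_cutW m) h
    exact Phase.ext (key _) (key _)
  P_P n x := by
    have h : ∀ ξ, cut n ξ * cut n ξ = cut n ξ := cut_mul_cut le_rfl
    have key := symH_comp (isSym_cut n) (isSym_cut n) (isSym_cut n) h
    exact Phase.ext (key _) (key _)
  Θ_W n x := by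
    have h : ∀ ξ, θ ξ ^ 3 * (cut n ξ * (1 + |ξ|) ^ 3) = cut n ξ := fun ξ => by
      rw [mul_left_comm, ← mul_pow, θ_mul, one_pow, mul_one]
    have key := symH_comp isSym_θ3 (isSym_cutW n) (isSym_cut n) h
    exact Phase.ext (key _) (key _)
  W_Θ n x := by
    have h : ∀ ξ, cut n ξ * (1 + |ξ|) ^ 3 * θ ξ ^ 3 = cut n ξ := fun ξ => by
      rw [mul_assoc, mul_comm _ (θ ξ ^ 3), ← mul_pow, θ_mul, one_pow, mul_one]
    have key := symH_comp (isSym_cutW n) isSym_θ3 (isSym_cut n) h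
    exact Phase.ext (key _) (key _)
  tail n x := by
    have h : ∀ F : Hm, ‖symH isSym_θ3 F - symH (isSym_cut n) (symH isSym_θ3 F)‖ ≤
        (n + 1 : ℝ)⁻¹ * ‖F‖ := fun F => by
      rw [inv_mul_eq_div]; exact norm_symH_θ3_sub_le n F
    rw [← inv_mul_eq_div]
    exact Phase.norm_le (by positivity) (h x.fst) (h x.snd)
  lip R := by
    obtain ⟨C, hC, h⟩ := exists_norm_flow_sub_le α β ε
    refine ⟨C * (1 + |R|), fun x y hx hy => ?_⟩
    refine (h |R| (abs_nonneg R) x y (hx.trans (le_abs_self R)) (hy.trans (le_abs_self R))).trans ?_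
    have h1 : ∀ F : Hm, ‖symH isSym_θ F‖ ≤ 1 * ‖F‖ := norm_symH_le _ fun ξ => by
      rw [abs_of_pos (θ_pos ξ)]; exact θ_le_one ξ
    have h2 := Phase.norm_le (x := diag (symH isSym_θ) (x - y)) zero_le_one (h1 (x - y).fst)
      (h1 (x - y).snd)
    rw [one_mul] at h2
    gcongr
  weak R η hη := by
    obtain ⟨C, hC, h⟩ := exists_norm_flow_sub_le α β ε
    set K := C * (1 + |R|) with hK
    have hK0 : 0 ≤ K := by positivity
    -- The smooth part of the interpolation contributes at most `4 K |R| δ ≤ η`; the summand `1`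
    -- avoids a zero denominator.
    set δ := η / (4 * K * |R| + 1) with hδ
    have hδ0 : 0 < δ := by positivity
    refine ⟨K * (2 * (δ ^ 2)⁻¹), fun x y hx hy => ?_⟩
    have hx' := hx.trans (le_abs_self R)
    have hy' := hy.trans (le_abs_self R)
    refine (h |R| (abs_nonneg R) x y hx' hy').trans ?_
    have h1 := mul_le_mul_of_nonneg_left (norm_diag_θ_le hδ0 (x - y)) hK0
    have h2 : ‖x - y‖ ≤ 2 * |R| := (norm_sub_le _ _).trans (by linarith)
    have h3 : K * (2 * δ * ‖x - y‖) ≤ η := by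
      calc K * (2 * δ * ‖x - y‖) ≤ K * (2 * δ * (2 * |R|)) := by gcongr
        _ = δ * (4 * K * |R|) := by ring
        _ ≤ δ * (4 * K * |R| + 1) := by gcongr; linarith
        _ = η := by rw [hδ]; field_simp
    rw [mul_add] at h1
    rw [mul_assoc K]
    exact h1.trans (by gcongr)
  mono R := by
    obtain ⟨C, hC, h⟩ := inner_accel_sub_le α ε hβ
    refine ⟨C * (1 + 4 * |R|), fun x y hx hy => ?_⟩
    have hx' := hx.trans (le_abs_self R)
    have hy' := hy.trans (le_abs_self R)
    have e : (flow α β ε x - flow α β ε y).fst = symH (isSym_μθ3 β) (x.snd - y.snd) := by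
      rw [WithLp.sub_fst, flow_fst, flow_fst, map_sub]
    rw [Phase.inner_eq, WithLp.prod_norm_sq_eq_of_L2, e]
    refine (h x.fst x.snd y.fst y.snd).trans ?_
    refine mul_le_mul_of_nonneg_right (mul_le_mul_of_nonneg_left ?_ hC) (by positivity)
    linarith [(Phase.norm_fst_le x).trans hx', (Phase.norm_fst_le y).trans hy',
      (Phase.norm_snd_le x).trans hx', (Phase.norm_snd_le y).trans hy']
  energy R := by
    obtain ⟨C, hC, h⟩ := inner_accel_le α ε hβ
    refine ⟨C * (1 + 2 * |R|), fun n x hx hPx => ?_⟩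
    have hx' := hx.trans (le_abs_self R)
    rw [Phase.inner_eq, WithLp.prod_norm_sq_eq_of_L2]
    refine (h n x.fst x.snd (congrArg (fun y : Phase => y.snd) hPx)).trans ?_
    refine mul_le_mul_of_nonneg_right (mul_le_mul_of_nonneg_left ?_ hC) (by positivity)
    linarith [(Phase.norm_fst_le x).trans hx', (Phase.norm_snd_le x).trans hx']


/-! ### Fourier transforms of products and of real functions -/

/-- The Fourier transform of `L²` as a real-linear equivalence. -/
def FT : L2 ≃L[ℝ] L2 :=
  (Lp.fourierTransformₗᵢ ℝ ℂ).toContinuousLinearEquiv.restrictScalars ℝ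

lemma FT_apply (u : L2) : FT u = 𝓕 u := rfl

lemma FT_symm_apply (u : L2) : FT.symm u = 𝓕⁻ u := rfl

lemma norm_FT (u : L2) : ‖FT u‖ = ‖u‖ := Lp.norm_fourier_eq u

lemma continuous_fourierInv_of_integrable {f : ℝ → ℂ} (hf : Integrable f) :
    Continuous (𝓕⁻ f : ℝ → ℂ) :=
  VectorFourier.fourierIntegral_continuous Real.continuous_fourierChar
    (L := -innerₗ ℝ) (by simpa using by fun_prop) hf

lemma norm_fourierInv_le (f : ℝ → ℂ) (x : ℝ) : ‖(𝓕⁻ f : ℝ → ℂ) x‖ ≤ ∫ ξ, ‖f ξ‖ :=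
  VectorFourier.norm_fourierIntegral_le_integral_norm _ _ _ _ _

lemma L2.locallyIntegrable (F : L2) : LocallyIntegrable F volume :=
  (Lp.memLp F).locallyIntegrable (by norm_num)

/-- On `L¹ ∩ L²` the inverse Fourier transform is given by the integral. -/
lemma coeFn_fourierInv_of_integrable {F : L2} (hF : Integrable F) :
    (𝓕⁻ F : L2) =ᵐ[volume] (𝓕⁻ (F : ℝ → ℂ) : ℝ → ℂ) := by
  refine ae_eq_of_integral_contDiff_smul_eq (L2.locallyIntegrable _)
    (continuous_fourierInv_of_integrable hF).locallyIntegrable fun g hg hgc => ?_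
  have hgc' : HasCompactSupport fun x => (g x : ℂ) := hgc.comp_left (g := ((↑) : ℝ → ℂ)) rfl
  have hg' : ContDiff ℝ ∞ fun x => (g x : ℂ) := Complex.ofRealCLM.contDiff.comp hg
  set φ : SchwartzMap ℝ ℂ := hgc'.toSchwartzMap hg' with hφ
  -- The `L²` transform agrees with the distributional one, so it can be moved onto the test
  -- function; Fubini moves it back onto `F` as an integral.
  have h1 : (𝓕⁻ (F : TemperedDistribution ℝ ℂ)) φ =
      (((𝓕⁻ F : L2)) : TemperedDistribution ℝ ℂ) φ := by
    rw [Lp.fourierInv_toTemperedDistribution_eq]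
  rw [TemperedDistribution.fourierInv_apply, Lp.toTemperedDistribution_apply,
    Lp.toTemperedDistribution_apply] at h1
  have h2 : ∀ u : ℝ → ℂ, ∫ x, g x • u x = ∫ x, φ x • u x := fun u => by
    refine integral_congr_ae (ae_of_all _ fun x => ?_)
    simp [hφ]
  rw [h2, h2, ← h1]
  have h3 := VectorFourier.integral_fourierIntegral_smul_eq_flip (f := φ) (g := (F : ℝ → ℂ))
    (μ := volume) (ν := volume) (L := -innerₗ ℝ) Real.continuous_fourierChar
    (by simpa using by fun_prop) φ.integrable hF
  have h4 : (-innerₗ ℝ : ℝ →ₗ[ℝ] ℝ →ₗ[ℝ] ℝ).flip = -innerₗ ℝ := by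
    ext; simp
  rw [h4] at h3
  have h5 : (𝓕⁻ φ : SchwartzMap ℝ ℂ) = (𝓕⁻ (φ : ℝ → ℂ) : ℝ → ℂ) := SchwartzMap.fourierInv_coe φ
  rw [h5]
  exact h3

lemma fourierInv_convolution {f g : ℝ → ℂ} (hf : Integrable f) (hg : Integrable g) (x : ℝ) :
    (𝓕⁻ (convolution f g (ContinuousLinearMap.mul ℂ ℂ) volume) : ℝ → ℂ) x =
      (𝓕⁻ f : ℝ → ℂ) x * (𝓕⁻ g : ℝ → ℂ) x := by
  simp only [Real.fourierInv_eq_fourier_neg]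
  exact Real.fourier_mul_convolution_eq hf hg _

lemma isMul_θ : IsMul fun ξ => (θ ξ : ℂ) := isSym_θ.isMul

lemma integrable_mulOp_θ (F : L2) : Integrable (mulOp isMul_θ F) := by
  refine Integrable.congr ?_ (coeFn_mulOp isMul_θ F).symm
  exact MemLp.integrable_mul (p := 2) (q := 2) (memLp_θ.ofReal) (Lp.memLp F)

lemma isMul_fourierInv {f : ℝ → ℂ} (hf : Integrable f) : IsMul (𝓕⁻ f : ℝ → ℂ) where
  measurable := (continuous_fourierInv_of_integrable hf).measurable
  bound := ⟨_, integral_nonneg fun _ => norm_nonneg _, norm_fourierInv_le f⟩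

lemma dense_schwartz : DenseRange fun φ : SchwartzMap ℝ ℂ => (φ.toLp 2 volume : L2) :=
  SchwartzMap.denseRange_toLpCLM (p := 2) (by norm_num)

lemma integrable_toLp (φ : SchwartzMap ℝ ℂ) : Integrable (φ.toLp 2 volume : L2) :=
  φ.integrable.congr (φ.coeFn_toLp 2 volume).symm

lemma continuous_bil_right {σ : ℝ → ℝ → ℝ} (hσ : IsKer σ) (F : L2) : Continuous (bil hσ F) := by
  obtain ⟨C, hC, hb⟩ := hσ.bound
  exact (LinearMap.mkContinuous (bil hσ F) (2 * C * θNorm * ‖F‖)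
    fun G => norm_bil_le hσ hC hb F G).continuous

/-- Both sides are continuous in `G`, so `G` may be taken Schwartz. Then both factors of the
convolution are integrable and the classical convolution theorem applies. -/
lemma fourierInv_bil_θ (F G : L2) :
    (𝓕⁻ (bil isKer_θ F G) : L2) =
      mulOp (isMul_fourierInv (integrable_mulOp_θ F)) (𝓕⁻ G : L2) := by
  have h := DenseRange.equalizer dense_schwartz (g := fun G : L2 => FT.symm (bil isKer_θ F G))
    (h := fun G : L2 => mulOp (isMul_fourierInv (integrable_mulOp_θ F)) (FT.symm G))
    (FT.symm.continuous.comp (continuous_bil_right isKer_θ F))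
    ((mulOp _).continuous.comp FT.symm.continuous) ?_
  · exact congrFun h G
  funext φ
  simp only [Function.comp_apply, FT_symm_apply]
  set G : L2 := φ.toLp 2 volume with hG
  have hGi : Integrable G := integrable_toLp φ
  have hFi := integrable_mulOp_θ F
  have e : bil isKer_θ F G =ᵐ[volume]
      convolution G (mulOp isMul_θ F) (ContinuousLinearMap.mul ℂ ℂ) volume := by
    filter_upwards [coeFn_bil isKer_θ F G] with k hk
    rw [hk, convolution_def]
    refine integral_congr_ae ?_
    filter_upwards [(quasiMeasurePreserving_sub_left volume k).ae (coeFn_mulOp isMul_θ F)] with l hl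
    rw [ContinuousLinearMap.mul_apply', hl]
    ring
  have hi : Integrable (bil isKer_θ F G) :=
    (hGi.integrable_convolution (ContinuousLinearMap.mul ℂ ℂ) hFi).congr e.symm
  refine Lp.ext ?_
  filter_upwards [coeFn_fourierInv_of_integrable hi, coeFn_mulOp (isMul_fourierInv hFi) (𝓕⁻ G : L2),
    coeFn_fourierInv_of_integrable hGi] with x h1 h2 h3
  rw [h1, h2, h3, Real.fourierInv_congr_ae e, fourierInv_convolution hGi hFi, mul_comm]

/-- The product of two functions in `L²`, one of which has a weighted transform, and its Fourier
transform. -/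
lemma fourier_mul {u v : L2} {F : L2} (hF : (𝓕 u : L2) = mulOp isMul_θ F) :
    (𝓕 (mul u v) : L2) = bil isKer_θ F (𝓕 v : L2) := by
  have h1 := fourierInv_bil_θ F (𝓕 v : L2)
  rw [FourierTransform.fourierInv_fourier_eq] at h1
  have hi := integrable_mulOp_θ F
  have hu : u =ᵐ[volume] (𝓕⁻ (mulOp isMul_θ F : ℝ → ℂ) : ℝ → ℂ) := by
    have := coeFn_fourierInv_of_integrable hi
    rwa [← hF, FourierTransform.fourierInv_fourier_eq, hF] at this
  have e : (bil isKer_θ F (𝓕 v : L2) |> FT.symm : L2) =ᵐ[volume] fun x => u x * v x := by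
    rw [FT_symm_apply, h1]
    filter_upwards [coeFn_mulOp (isMul_fourierInv hi) v, hu] with x h2 h3
    rw [h2, h3]
  -- The product lies in `L²`, so `mul` does not take its default value.
  have hm : MemLp (fun x => u x * v x) 2 volume := (memLp_congr_ae e).mp (Lp.memLp _)
  have e2 : mul u v = FT.symm (bil isKer_θ F (𝓕 v : L2)) := by
    rw [mul, dif_pos hm]
    refine Lp.ext (hm.coeFn_toLp.trans e.symm)
  rw [e2, ← FT_apply, ContinuousLinearEquiv.apply_symm_apply]

/-- Pointwise complex conjugation on `L²`. -/
def conjL : L2 →L[ℝ] L2 := ContinuousLinearMap.compLpL 2 volume (Complex.conjCLE : ℂ →L[ℝ] ℂ)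

lemma coeFn_conjL (F : L2) : conjL F =ᵐ[volume] fun ξ => (starRingEnd ℂ) (F ξ) :=
  ContinuousLinearMap.coeFn_compLpL (p := 2) (μ := volume) (Complex.conjCLE : ℂ →L[ℝ] ℂ) F

/-- By density and continuity it suffices to treat transforms given by integrals, where conjugation
is a change of variables. Consequently real functions correspond to `Hm`. -/
lemma fourierInv_reflConj (F : L2) : (𝓕⁻ (reflConj F) : L2) = conjL (𝓕⁻ F : L2) := by
  have h := DenseRange.equalizer dense_schwartz (g := fun F : L2 => FT.symm (reflConj F))
    (h := fun F : L2 => conjL (FT.symm F)) (FT.symm.continuous.comp reflConj.continuous)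
    (conjL.continuous.comp FT.symm.continuous) ?_
  · exact congrFun h F
  funext φ
  simp only [Function.comp_apply, FT_symm_apply]
  set F : L2 := φ.toLp 2 volume with hF
  have hFi : Integrable F := integrable_toLp φ
  have e := coeFn_reflConj F
  have hi : Integrable (reflConj F) := by
    refine Integrable.congr ?_ e.symm
    exact (Complex.conjCLE : ℂ →L[ℝ] ℂ).integrable_comp hFi.comp_neg
  refine Lp.ext ?_
  filter_upwards [coeFn_fourierInv_of_integrable hi, coeFn_fourierInv_of_integrable hFi,
    coeFn_conjL (𝓕⁻ F : L2)] with x h1 h2 h3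
  rw [h1, h3, h2, Real.fourierInv_congr_ae e, Real.fourierInv_eq', Real.fourierInv_eq',
    ← integral_conj, ← integral_neg_eq_self]
  refine integral_congr_ae (ae_of_all _ fun ξ => ?_)
  simp only [smul_eq_mul, map_mul, neg_neg, ← Complex.exp_conj, Complex.conj_ofReal, Complex.conj_I]
  congr 2
  simp

lemma isRealValued_iff_conjL {u : L2} : IsRealValued u ↔ conjL u = u := by
  constructor
  · intro h
    refine Lp.ext ?_
    filter_upwards [coeFn_conjL u, h] with x h1 h2
    rw [h1, Complex.conj_eq_iff_im, h2]
  · intro h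
    have h1 := coeFn_conjL u
    rw [h] at h1
    filter_upwards [h1] with x hx
    exact Complex.conj_eq_iff_im.mp hx.symm

lemma isRealValued_iff {u : L2} : IsRealValued u ↔ (𝓕 u : L2) ∈ Hm := by
  rw [isRealValued_iff_conjL, mem_Hm_iff']
  have h := fourierInv_reflConj (𝓕 u : L2)
  rw [FourierTransform.fourierInv_fourier_eq] at h
  rw [← h, ← FT_symm_apply, ← FT_apply]
  exact FT.symm_apply_eq

/-- Exhibiting an `L²` representative of the product shows at once that `u` is in the domain, so the
default value is avoided. -/
lemma fourier_multiplier {m : ℝ → ℂ} {u F : L2} (h : F =ᵐ[volume] fun ξ => m ξ * (𝓕 u : L2) ξ) :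
    (𝓕 (multiplier m u) : L2) = F := by
  have hm : MemLp (fun ξ : ℝ => m ξ * (𝓕 u : L2) ξ) 2 volume := (memLp_congr_ae h).mp (Lp.memLp _)
  rw [multiplier, dif_pos hm, FourierTransform.fourier_fourierInv_eq]
  exact Lp.ext (hm.coeFn_toLp.trans h.symm)

/-! ### The right-hand side of the equation in weighted variables -/

section


lemma bil_smul_kernel {σ τ : ℝ → ℝ → ℝ} (hσ : IsKer σ) (hτ : IsKer τ) {c : ℝ}
    (h : ∀ k l, τ k l = c * σ k l) (F G : L2) : bil hτ F G = c • bil hσ F G := by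
  refine Lp.ext ?_
  filter_upwards [coeFn_bil hσ F G, coeFn_bil hτ F G, Lp.coeFn_smul c (bil hσ F G)] with k h1 h2 h3
  rw [h2, h3, Pi.smul_apply, h1]
  unfold convKer
  rw [← integral_smul]
  refine integral_congr_ae (ae_of_all _ fun l => ?_)
  simp only [h, Complex.real_smul]
  push_cast
  ring

lemma abs_sign_mul_le (x y : ℝ) : |Real.sign x * y| ≤ |y| := by
  rw [abs_mul]
  exact mul_le_of_le_one_left (abs_nonneg _) (abs_sign_le_one x)

lemma mul_sign_eq_abs (x : ℝ) : x * Real.sign x = |x| := by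
  rcases lt_trichotomy x 0 with h | h | h
  · rw [Real.sign_of_neg h, abs_of_neg h]; ring
  · simp [h]
  · rw [Real.sign_of_pos h, abs_of_pos h, mul_one]

lemma isMul_sign_mul {p : ℝ → ℝ} (hp : Measurable p) {C : ℝ} (hC : ∀ ξ, |p ξ| ≤ C) :
    IsMul fun ξ => -Complex.I * ((Real.sign ξ * p ξ : ℝ) : ℂ) where
  measurable := by fun_prop
  bound := ⟨C, (abs_nonneg _).trans (hC 0), fun ξ => by
    rw [norm_mul, norm_neg, Complex.norm_I, one_mul, Complex.norm_real]
    exact (abs_sign_mul_le _ _).trans (hC ξ)⟩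

lemma abs_θ_pow_le (n : ℕ) (ξ : ℝ) : |θ ξ ^ n| ≤ 1 := by
  rw [abs_of_nonneg (pow_nonneg (θ_pos ξ).le n)]
  exact θ_pow_le_one n ξ

lemma isSym_μinvθ2 (β : ℝ) : IsSym fun ξ => (μ β ξ)⁻¹ * θ ξ ^ 2 := by
  refine ⟨by have := measurable_μ β; fun_prop, fun ξ => by rw [μ_neg, θ_neg], 1, fun ξ => ?_⟩
  have h1 := μ_pos β ξ
  have h2 := θ_pos ξ
  rw [abs_of_nonneg (by positivity)]
  exact mul_le_one₀ (μ_inv_le_one β ξ) (by positivity) (θ_pow_le_one 2 ξ)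

lemma abs_κμinvθ3_le (β ξ : ℝ) : |κ ξ * (μ β ξ)⁻¹ * θ ξ ^ 3| ≤ 2 * Real.pi := by
  have h1 := μ_pos β ξ
  have h2 := θ_pos ξ
  have h3 := κ_nonneg ξ
  rw [abs_of_nonneg (by positivity)]
  exact (κ_mul_μinv_mul_θ3_le β ξ).trans
    (mul_le_of_le_one_right Real.two_pi_pos.le (θ_le_one ξ))

lemma isMul_κμinvθ3 (β : ℝ) : IsMul fun ξ => ((κ ξ * (μ β ξ)⁻¹ * θ ξ ^ 3 : ℝ) : ℂ) :=
  isMul_ofReal (by have := measurable_μ β; have := measurable_κ; fun_prop) (abs_κμinvθ3_le β)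

lemma isMul_κ3μinvθ3 {β : ℝ} (hβ : 0 < β) :
    IsMul fun ξ => ((κ ξ ^ 3 * (μ β ξ)⁻¹ * θ ξ ^ 3 : ℝ) : ℂ) := by
  obtain ⟨C, hC, h⟩ := exists_κ_le hβ
  refine isMul_ofReal (by have := measurable_μ β; have := measurable_κ; fun_prop)
    (C := C * (2 * Real.pi) * (2 * Real.pi)) fun ξ => ?_
  have h1 := μ_pos β ξ
  have h2 := θ_pos ξ
  have h3 := κ_nonneg ξ
  have hpi := Real.pi_pos
  rw [abs_of_nonneg (by positivity)]
  calc κ ξ ^ 3 * (μ β ξ)⁻¹ * θ ξ ^ 3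
      = (κ ξ * (μ β ξ)⁻¹) * (κ ξ * θ ξ) * (κ ξ * θ ξ) * θ ξ := by ring
    _ ≤ C * (2 * Real.pi) * (2 * Real.pi) * 1 := by
        have h4 := κ_mul_θ_le ξ
        gcongr
        · exact h ξ
        · exact θ_le_one ξ
    _ = _ := by ring

lemma isMul_dxθ3 : IsMul fun ξ => Complex.I * ((2 * Real.pi * ξ * θ ξ ^ 3 : ℝ) : ℂ) where
  measurable := by fun_prop
  bound := ⟨2 * Real.pi, Real.two_pi_pos.le, fun ξ => by
    have h2 := θ_pos ξ
    have hpi := Real.pi_pos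
    rw [norm_mul, Complex.norm_I, one_mul, Complex.norm_real, Real.norm_eq_abs, abs_mul, abs_mul,
      abs_of_pos Real.two_pi_pos, abs_of_pos (pow_pos h2 3), mul_assoc]
    exact mul_le_of_le_one_right (by positivity) ((abs_mul_θ3_le ξ).trans (θ_le_one ξ))⟩

section Rhs

variable {α β ε : ℝ} {f g : L2} {A B : Hm}

lemma FT_lam_one (hf : FT f = symH (isSym_μinvθ3 β) A) :
    FT (lam 1 f) = mulOp (isMul_κμinvθ3 β) A := by
  refine fourier_multiplier ?_
  rw [← FT_apply, hf]
  filter_upwards [coeFn_mulOp (isMul_κμinvθ3 β) A, coeFn_symH (isSym_μinvθ3 β) A] with ξ h1 h2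
  rw [h1, h2]
  simp only [κ]
  push_cast
  ring

lemma FT_lam_three (hβ : 0 < β) (hf : FT f = symH (isSym_μinvθ3 β) A) :
    FT (lam 3 f) = mulOp (isMul_κ3μinvθ3 hβ) A := by
  refine fourier_multiplier ?_
  rw [← FT_apply, hf]
  filter_upwards [coeFn_mulOp (isMul_κ3μinvθ3 hβ) A, coeFn_symH (isSym_μinvθ3 β) A] with ξ h1 h2
  rw [h1, h2]
  simp only [κ]
  push_cast
  ring

lemma FT_lam_one_dx (hg : FT g = symH isSym_θ3 B) : FT (lam 1 (dx g)) = skewH 1 B := by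
  have h : FT (dx g) = mulOp isMul_dxθ3 B := by
    refine fourier_multiplier ?_
    rw [← FT_apply, hg]
    filter_upwards [coeFn_mulOp isMul_dxθ3 B, coeFn_symH isSym_θ3 B] with ξ h1 h2
    rw [h1, h2]
    push_cast
    ring
  refine fourier_multiplier ?_
  rw [← FT_apply, h]
  filter_upwards [coeFn_mulOp isMul_dxθ3 B, coeFn_mulOp (isMul_skewSymbol 1) B] with ξ h1 h2
  rw [h1, skewH, coe_mulH, h2]
  simp only [κ, skewSymbol]
  push_cast
  ring

lemma FT_hilbert {u F : L2} {p : ℝ → ℝ} (hp : Measurable p) {C : ℝ} (hC : ∀ ξ, |p ξ| ≤ C)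
    (h : FT u =ᵐ[volume] fun ξ => (p ξ : ℂ) * F ξ) :
    FT (hilbert u) = mulOp (isMul_sign_mul hp hC) F := by
  refine fourier_multiplier ?_
  filter_upwards [coeFn_mulOp (isMul_sign_mul hp hC) F, h] with ξ h1 h2
  rw [h1, ← FT_apply, h2]
  push_cast
  ring

lemma isMul_sign : IsMul fun ξ => -Complex.I * ((Real.sign ξ * 1 : ℝ) : ℂ) :=
  isMul_sign_mul measurable_const (C := 1) fun _ => by simp

lemma FT_hilbert' (u : L2) : FT (hilbert u) = mulOp isMul_sign (FT u) :=
  FT_hilbert measurable_const (C := 1) (fun _ => by simp) (ae_of_all _ fun ξ => by simp)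

/-- One factor `θ` is split off the transform of the first `H g`, which puts the product in the form
required by `fourier_mul`. -/
lemma quad_formula (hg : FT g = symH isSym_θ3 B) : ∀ᵐ k, bil (isKer_quadKer 1) (B : L2) B k =
    Complex.I * ((2 * Real.pi * k : ℝ) : ℂ) *
      -(FT (hilbert (mul (hilbert g) (hilbert g)))) k := by
  have hs3 := isMul_sign_mul (p := fun ξ => θ ξ ^ 3) (by fun_prop) (abs_θ_pow_le 3)
  have hs2 := isMul_sign_mul (p := fun ξ => θ ξ ^ 2) (by fun_prop) (abs_θ_pow_le 2)
  have h1 : FT (hilbert g) = mulOp hs3 B := FT_hilbert (by fun_prop) (abs_θ_pow_le 3) (by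
    rw [hg]; exact coeFn_symH isSym_θ3 B)
  have h2 : FT (hilbert g) = mulOp isMul_θ (mulOp hs2 B) := by
    rw [h1, mulOp_comp isMul_θ hs2 hs3 fun ξ => by push_cast; ring]
  have h3 : FT (mul (hilbert g) (hilbert g)) = bil isKer_θ (mulOp hs2 B) (mulOp hs3 B) := by
    rw [← h1]; exact fourier_mul h2
  rw [FT_hilbert', h3]
  filter_upwards [coeFn_mulOp isMul_sign (bil isKer_θ (mulOp hs2 B) (mulOp hs3 B)),
    coeFn_bil isKer_θ (mulOp hs2 B) (mulOp hs3 B), coeFn_bil (isKer_quadKer 1) (B : L2) B]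
    with k e1 e2 e3
  rw [e1, e2, e3]
  unfold convKer
  rw [← integral_const_mul, ← integral_neg, ← integral_const_mul]
  refine integral_congr_ae ?_
  filter_upwards [coeFn_mulOp hs3 B,
    (quasiMeasurePreserving_sub_left volume k).ae (coeFn_mulOp hs2 B)] with l e4 e5
  rw [e4, e5]
  have hk : κ k = 2 * Real.pi * (k * Real.sign k) := by rw [mul_sign_eq_abs, κ_eq]
  rw [quadKer, hk]
  push_cast
  -- The factor `i` of the derivative, the outer minus sign and three factors `-i` from Hilbert
  -- transforms multiply to `1`.
  linear_combination (2 * Real.pi * k * Real.sign k * (Real.sign (k - l) * Real.sign l) *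
    (θ (k - l) ^ 3 * θ l ^ 3) * ((B : L2) (k - l) * (B : L2) l)) *
    (1 - Complex.I ^ 2) * Complex.I_sq

lemma comm_formula (hf : FT f = symH (isSym_μinvθ3 β) A) :
    ∀ᵐ k, bil (isKer_commKer β 1) (A : L2) A k =
      Complex.I * ((2 * Real.pi * k : ℝ) : ℂ) * (FT (comm hilbert f (lam 1 f))) k := by
  have hm := (isSym_μinvθ2 β).isMul
  have h0 := FT_lam_one hf
  have hp : Measurable fun ξ => κ ξ * (μ β ξ)⁻¹ * θ ξ ^ 3 := by
    have := measurable_μ β; have := measurable_κ; fun_prop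
  have hs := isMul_sign_mul hp (abs_κμinvθ3_le β)
  have h1 : FT (hilbert (lam 1 f)) = mulOp hs A := FT_hilbert hp (abs_κμinvθ3_le β) (by
    rw [h0]; exact coeFn_mulOp _ _)
  have h2 : FT f = mulOp isMul_θ (mulOp hm A) := by
    rw [hf, coe_symH, mulOp_comp isMul_θ hm (isSym_μinvθ3 β).isMul fun ξ => by push_cast; ring]
  have h3 : FT (mul f (lam 1 f)) = bil isKer_θ (mulOp hm A) (mulOp (isMul_κμinvθ3 β) A) := by
    rw [← h0]; exact fourier_mul h2
  have h4 : FT (mul f (hilbert (lam 1 f))) = bil isKer_θ (mulOp hm A) (mulOp hs A) := by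
    rw [← h1]; exact fourier_mul h2
  rw [comm, map_sub, FT_hilbert', h3, h4]
  filter_upwards [Lp.coeFn_sub (mulOp isMul_sign (bil isKer_θ (mulOp hm A)
      (mulOp (isMul_κμinvθ3 β) A))) (bil isKer_θ (mulOp hm A) (mulOp hs A)),
    coeFn_mulOp isMul_sign (bil isKer_θ (mulOp hm A) (mulOp (isMul_κμinvθ3 β) A)),
    coeFn_bil isKer_θ (mulOp hm A) (mulOp (isMul_κμinvθ3 β) A),
    coeFn_bil isKer_θ (mulOp hm A) (mulOp hs A),
    isKer_θ.ae_integrable (mulOp hm A) (mulOp (isMul_κμinvθ3 β) A),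
    isKer_θ.ae_integrable (mulOp hm A) (mulOp hs A),
    coeFn_bil (isKer_commKer β 1) (A : L2) A] with k e1 e2 e3 e4 i1 i2 e5
  rw [e1, Pi.sub_apply, e2, e3, e4, e5]
  unfold convKer
  rw [← integral_const_mul, ← integral_sub (i1.const_mul _) i2, ← integral_const_mul]
  refine integral_congr_ae ?_
  filter_upwards [coeFn_mulOp hs A, coeFn_mulOp (isMul_κμinvθ3 β) A,
    (quasiMeasurePreserving_sub_left volume k).ae (coeFn_mulOp hm A)] with l e6 e7 e8
  rw [e6, e7, e8, commKer]
  push_cast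
  linear_combination (2 * Real.pi * (k * (Real.sign k - Real.sign l)) * κ l *
    ((μ β (k - l))⁻¹ * θ (k - l) ^ 3 * ((μ β l)⁻¹ * θ l ^ 3)) *
      ((A : L2) (k - l) * (A : L2) l)) * Complex.I_sq

lemma FT_rhs (hβ : 0 < β) (hf : FT f = symH (isSym_μinvθ3 β) A) (hg : FT g = symH isSym_θ3 B) :
    FT (rhs α β ε f g) = accel α β ε A B := by
  have h1 : FT (dx (-hilbert (mul (hilbert g) (hilbert g)) + comm hilbert f (lam 1 f))) =
      bil (isKer_quadKer 1) (B : L2) B + bil (isKer_commKer β 1) (A : L2) A := by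
    refine fourier_multiplier ?_
    rw [← FT_apply, map_add, map_neg]
    filter_upwards [Lp.coeFn_add (bil (isKer_quadKer 1) (B : L2) B)
        (bil (isKer_commKer β 1) (A : L2) A), quad_formula hg, comm_formula hf,
      Lp.coeFn_add (-FT (hilbert (mul (hilbert g) (hilbert g)))) (FT (comm hilbert f (lam 1 f))),
      Lp.coeFn_neg (FT (hilbert (mul (hilbert g) (hilbert g))))] with k e1 e2 e3 e4 e5
    rw [e1, Pi.add_apply, e2, e3, e4, Pi.add_apply, e5, Pi.neg_apply]
    ring
  have h2 : -mulOp (isMul_κμinvθ3 β) (A : L2) - β • mulOp (isMul_κ3μinvθ3 hβ) (A : L2) =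
      -(symH (isSym_μθ3 β) A : L2) + (symH (isSym_μinvθ3 β) A : L2) := by
    rw [sub_eq_iff_eq_add, neg_eq_iff_add_eq_zero]
    refine Lp.ext ?_
    set a := mulOp (isMul_κμinvθ3 β) (A : L2)
    set b := mulOp (isMul_κ3μinvθ3 hβ) (A : L2)
    set c := (symH (isSym_μθ3 β) A : L2)
    set d := (symH (isSym_μinvθ3 β) A : L2)
    filter_upwards [Lp.coeFn_add a (-c + d + β • b), Lp.coeFn_add (-c + d) (β • b),
      Lp.coeFn_add (-c) d, Lp.coeFn_neg c, Lp.coeFn_smul β b, coeFn_mulOp (isMul_κμinvθ3 β) (A : L2),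
      coeFn_mulOp (isMul_κ3μinvθ3 hβ) (A : L2), coeFn_symH (isSym_μθ3 β) A,
      coeFn_symH (isSym_μinvθ3 β) A, Lp.coeFn_zero ℂ 2 (volume : Measure ℝ)]
      with ξ e1 e2 e3 e4 e5 e6 e7 e8 e9 e10
    rw [e1, Pi.add_apply, e2, Pi.add_apply, e3, Pi.add_apply, e4, Pi.neg_apply, e5, Pi.smul_apply,
      e6, e7, e8, e9, e10, Complex.real_smul]
    have h3 : μ β ξ * (μ β ξ)⁻¹ = 1 := mul_inv_cancel₀ (μ_pos β ξ).ne'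
    -- This is `κ + β κ³ = μ² - 1` divided by `μ`.
    have h4 : μ β ξ = (μ β ξ)⁻¹ + κ ξ * (μ β ξ)⁻¹ + β * κ ξ ^ 3 * (μ β ξ)⁻¹ := by
      have := μ_sq β ξ
      rw [abs_of_pos hβ] at this
      linear_combination (μ β ξ)⁻¹ * this - μ β ξ * h3
    have h5 : ((μ β ξ : ℝ) : ℂ) = (((μ β ξ)⁻¹ + κ ξ * (μ β ξ)⁻¹ + β * κ ξ ^ 3 * (μ β ξ)⁻¹ : ℝ) : ℂ) :=
      congrArg _ h4
    push_cast at h5 ⊢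
    rw [Pi.zero_apply]
    linear_combination (-(θ ξ : ℂ) ^ 3 * (A : L2) ξ) * h5
  have h3 : α • (skewH 1 B : L2) = skewH α B := by
    refine Lp.ext ?_
    rw [skewH, skewH, coe_mulH, coe_mulH]
    filter_upwards [Lp.coeFn_smul α (mulOp (isMul_skewSymbol 1) (B : L2)),
      coeFn_mulOp (isMul_skewSymbol 1) (B : L2), coeFn_mulOp (isMul_skewSymbol α) (B : L2)]
      with ξ e1 e2 e3
    rw [e1, Pi.smul_apply, e2, e3, Complex.real_smul]
    simp only [skewSymbol]
    push_cast
    ring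
  have h4 := bil_smul_kernel (isKer_quadKer 1) (isKer_quadKer ε) (c := ε)
    (fun k l => by simp only [quadKer]; ring) B B
  have h5 := bil_smul_kernel (isKer_commKer β 1) (isKer_commKer β ε) (c := ε)
    (fun k l => by simp only [commKer]; ring) A A
  rw [rhs, map_add, map_add, map_sub, map_neg, map_smul, map_smul, map_smul, h1, FT_lam_one hf,
    FT_lam_three hβ hf, FT_lam_one_dx hg, h2, h3, smul_add, ← h4, ← h5, accel]
  push_cast
  rw [coe_bilH, coe_bilH]
  abel

end Rhs

end

section


/-! ### Equivalence of the Sobolev norms with the weighted `L²` norms -/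

section Weights

variable {s K : ℝ} {p : ℝ → ℝ} {u : L2}

lemma hsNorm_le_of_eq_symH (hp : IsSym p) (hpos : ∀ ξ, 0 < p ξ)
    (h : ∀ ξ, Real.sqrt (1 + |2 * Real.pi * ξ| ^ (2 * s)) * p ξ ≤ K) {A : Hm}
    (hu : FT u = symH hp A) : hsNorm s u ≤ ENNReal.ofReal (K * ‖A‖) := by
  have hK : 0 ≤ K := (mul_nonneg (Real.sqrt_nonneg _) (hpos 0).le).trans (h 0)
  rw [hsNorm, ← FT_apply, hu, ENNReal.ofReal_mul hK, Submodule.coe_norm, ← L2.eLpNorm_eq]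
  refine eLpNorm_le_mul_eLpNorm_of_ae_le_mul ?_ 2
  filter_upwards [coeFn_symH hp A] with ξ hξ
  rw [hξ, norm_mul, norm_mul, Complex.norm_real, Complex.norm_real,
    Real.norm_of_nonneg (Real.sqrt_nonneg _), Real.norm_of_nonneg (hpos ξ).le, ← mul_assoc]
  gcongr
  exact h ξ

lemma exists_symH_eq_of_hsNorm_le (hp : IsSym p) (hpos : ∀ ξ, 0 < p ξ) (hK : 0 ≤ K)
    (h : ∀ ξ, 1 ≤ K * (Real.sqrt (1 + |2 * Real.pi * ξ| ^ (2 * s)) * p ξ)) (hu : FT u ∈ Hm)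
    {R : ℝ≥0} (hR : hsNorm s u ≤ R) : ∃ A : Hm, FT u = symH hp A ∧ ‖A‖ ≤ K * R := by
  have hle : eLpNorm (fun ξ => ((p ξ)⁻¹ : ℂ) * FT u ξ) 2 volume ≤ ENNReal.ofReal (K * R) := by
    rw [ENNReal.ofReal_mul hK, ENNReal.ofReal_coe_nnreal]
    refine le_trans ?_ (mul_le_mul_right hR _)
    refine eLpNorm_le_mul_eLpNorm_of_ae_le_mul (ae_of_all _ fun ξ => ?_) 2
    have h1 := hpos ξ
    rw [norm_mul, norm_mul, norm_inv, Complex.norm_real, Complex.norm_real,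
      Real.norm_of_nonneg (Real.sqrt_nonneg _), Real.norm_of_nonneg h1.le, FT_apply, ← mul_assoc]
    gcongr
    rw [inv_le_iff_one_le_mul₀ h1, mul_assoc]
    exact h ξ
  have hmeas : Measurable fun ξ => ((p ξ)⁻¹ : ℂ) * FT u ξ := by
    have := hp.measurable
    have := L2.measurable (FT u)
    fun_prop
  have hm : MemLp (fun ξ => ((p ξ)⁻¹ : ℂ) * FT u ξ) 2 volume :=
    ⟨hmeas.aestronglyMeasurable, hle.trans_lt ENNReal.ofReal_lt_top⟩
  have hc := hm.coeFn_toLp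
  have hmem : hm.toLp _ ∈ Hm := by
    rw [mem_Hm_iff] at hu ⊢
    filter_upwards [hc, (Measure.measurePreserving_neg volume).quasiMeasurePreserving.ae hc, hu]
      with ξ h1 h2 h3
    rw [h2, h1, h3, hp.even, map_mul, map_inv₀, Complex.conj_ofReal]
  refine ⟨⟨hm.toLp _, hmem⟩, Lp.ext ?_, ?_⟩
  · filter_upwards [hc, coeFn_symH hp ⟨hm.toLp _, hmem⟩] with ξ h1 h2
    rw [h2]
    simp only [h1]
    rw [mul_inv_cancel_left₀]
    exact_mod_cast (hpos ξ).ne'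
  · rw [Submodule.coe_norm, Lp.norm_toLp]
    exact ENNReal.toReal_le_of_le_ofReal (by positivity) hle

end Weights

lemma θ_mul_pow (n : ℕ) (ξ : ℝ) : θ ξ ^ n * (1 + |ξ|) ^ n = 1 := by
  rw [← mul_pow, θ_mul, one_pow]

lemma abs_le_κ (ξ : ℝ) : |ξ| ≤ κ ξ := by
  rw [κ_eq]
  nlinarith [abs_nonneg ξ, Real.pi_gt_three]

lemma κ_pow_mul_θ_pow_le (n : ℕ) (ξ : ℝ) : κ ξ ^ n * θ ξ ^ n ≤ (2 * Real.pi) ^ n := by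
  rw [← mul_pow]
  exact pow_le_pow_left₀ (mul_nonneg (κ_nonneg ξ) (θ_pos ξ).le) (κ_mul_θ_le ξ) n

lemma sobolev_three (ξ : ℝ) :
    1 + |2 * Real.pi * ξ| ^ (2 * (3 : ℝ)) = 1 + κ ξ ^ 6 := by
  rw [κ, ← Real.rpow_natCast]; norm_num

lemma sobolev_nine_halves (ξ : ℝ) :
    1 + |2 * Real.pi * ξ| ^ (2 * (9 / 2 : ℝ)) = 1 + κ ξ ^ 9 := by
  rw [κ, ← Real.rpow_natCast]; norm_num

lemma exists_velocity_weight_le : ∃ K : ℝ, ∀ ξ,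
    Real.sqrt (1 + |2 * Real.pi * ξ| ^ (2 * (3 : ℝ))) * θ ξ ^ 3 ≤ K := by
  refine ⟨Real.sqrt (1 + (2 * Real.pi) ^ 6), fun ξ => ?_⟩
  rw [sobolev_three]
  refine Real.le_sqrt_of_sq_le ?_
  have h1 := κ_nonneg ξ
  rw [mul_pow, Real.sq_sqrt (by positivity)]
  have h2 := κ_pow_mul_θ_pow_le 6 ξ
  have h3 := θ_pow_le_one 6 ξ
  calc (1 + κ ξ ^ 6) * (θ ξ ^ 3) ^ 2 = θ ξ ^ 6 + κ ξ ^ 6 * θ ξ ^ 6 := by ring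
    _ ≤ _ := by linarith

/-- In `κ⁹ = κ³ · κ⁶` the first factor is absorbed by `μ⁻²`, with constant `β⁻¹`, and the second by
`θ⁶`. -/
lemma exists_position_weight_le {β : ℝ} (hβ : 0 < β) : ∃ K : ℝ, ∀ ξ,
    Real.sqrt (1 + |2 * Real.pi * ξ| ^ (2 * (9 / 2 : ℝ))) * ((μ β ξ)⁻¹ * θ ξ ^ 3) ≤ K := by
  refine ⟨Real.sqrt (1 + β⁻¹ * (2 * Real.pi) ^ 6), fun ξ => ?_⟩
  rw [sobolev_nine_halves]
  refine Real.le_sqrt_of_sq_le ?_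
  have h1 := κ_nonneg ξ
  have h4 := μ_pos β ξ
  have h7 := θ_pos ξ
  rw [mul_pow, Real.sq_sqrt (by positivity)]
  have h2 := κ_pow_mul_θ_pow_le 6 ξ
  have h3 := θ_pow_le_one 6 ξ
  have h5 : κ ξ ^ 3 * ((μ β ξ)⁻¹) ^ 2 ≤ β⁻¹ := by
    rw [inv_pow, ← div_eq_mul_inv, div_le_iff₀ (by positivity), inv_mul_eq_div, le_div_iff₀ hβ, μ_sq,
      abs_of_pos hβ]
    nlinarith
  have h6 : ((μ β ξ)⁻¹) ^ 2 ≤ 1 := pow_le_one₀ (by positivity) (μ_inv_le_one β ξ)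
  have hβ' : 0 ≤ β⁻¹ := by positivity
  calc (1 + κ ξ ^ 9) * ((μ β ξ)⁻¹ * θ ξ ^ 3) ^ 2
      = ((μ β ξ)⁻¹) ^ 2 * θ ξ ^ 6 + (κ ξ ^ 3 * ((μ β ξ)⁻¹) ^ 2) * (κ ξ ^ 6 * θ ξ ^ 6) := by ring
    _ ≤ 1 * 1 + β⁻¹ * (2 * Real.pi) ^ 6 := by gcongr
    _ = _ := by ring

lemma exists_le_velocity_weight : ∃ K : ℝ, 0 ≤ K ∧ ∀ ξ,
    1 ≤ K * (Real.sqrt (1 + |2 * Real.pi * ξ| ^ (2 * (3 : ℝ))) * θ ξ ^ 3) := by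
  refine ⟨Real.sqrt (2 ^ 5), Real.sqrt_nonneg _, fun ξ => ?_⟩
  have h1 := κ_nonneg ξ
  rw [sobolev_three, ← mul_assoc, ← Real.sqrt_mul (by positivity)]
  nth_rw 1 [← θ_mul_pow 3 ξ]
  rw [mul_comm (θ ξ ^ 3)]
  refine mul_le_mul_of_nonneg_right (Real.le_sqrt_of_sq_le ?_) (pow_nonneg (θ_pos ξ).le 3)
  calc ((1 + |ξ|) ^ 3) ^ 2 = (1 + |ξ|) ^ 6 := by ring
    _ ≤ (1 + κ ξ) ^ 6 := by gcongr; exact abs_le_κ ξ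
    _ ≤ 2 ^ 5 * (1 ^ 6 + κ ξ ^ 6) := add_pow_le zero_le_one h1 6
    _ = _ := by ring

lemma exists_le_position_weight (β : ℝ) : ∃ K : ℝ, 0 ≤ K ∧ ∀ ξ,
    1 ≤ K * (Real.sqrt (1 + |2 * Real.pi * ξ| ^ (2 * (9 / 2 : ℝ))) *
      ((μ β ξ)⁻¹ * θ ξ ^ 3)) := by
  refine ⟨Real.sqrt ((1 + |β|) * 2 ^ 8), Real.sqrt_nonneg _, fun ξ => ?_⟩
  have h1 := κ_nonneg ξ
  have h2 := μ_pos β ξ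
  have h3 := θ_pos ξ
  have e : 1 = (1 + |ξ|) ^ 3 * μ β ξ * ((μ β ξ)⁻¹ * θ ξ ^ 3) := by
    rw [mul_assoc, mul_inv_cancel_left₀ h2.ne', mul_comm, θ_mul_pow]
  rw [sobolev_nine_halves, ← mul_assoc, ← Real.sqrt_mul (by positivity)]
  nth_rw 1 [e]
  refine mul_le_mul_of_nonneg_right (Real.le_sqrt_of_sq_le ?_) (by positivity)
  have h4 : μ β ξ ^ 2 ≤ (1 + |β|) * (1 + κ ξ) ^ 3 := by
    rw [μ_sq]
    have h5 : 0 ≤ |β| := abs_nonneg β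
    have h6 : κ ξ ^ 3 ≤ (1 + κ ξ) ^ 3 := by gcongr; linarith
    have h7 : 1 + κ ξ ≤ (1 + κ ξ) ^ 3 := le_self_pow₀ (by linarith) (by norm_num)
    nlinarith
  calc ((1 + |ξ|) ^ 3 * μ β ξ) ^ 2 = (1 + |ξ|) ^ 6 * μ β ξ ^ 2 := by ring
    _ ≤ (1 + κ ξ) ^ 6 * ((1 + |β|) * (1 + κ ξ) ^ 3) := by
        gcongr
        exact abs_le_κ ξ
    _ = (1 + |β|) * (1 + κ ξ) ^ 9 := by ring
    _ ≤ (1 + |β|) * (2 ^ 8 * (1 ^ 9 + κ ξ ^ 9)) := by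
        gcongr
        exact add_pow_le zero_le_one h1 9
    _ = _ := by ring

end


/-! ### Weak time derivatives and the integrated equation -/

/-- Integration by parts against a test function. -/
lemma integral_deriv_smul_primitive {E : Type*} [NormedAddCommGroup E] [NormedSpace ℝ E]
    [CompleteSpace E] {T M : ℝ} (hT : 0 < T) {u₀ : E} {v : ℝ → E}
    (hm : AEStronglyMeasurable v (volume.restrict (Ioo 0 T)))
    (hv : ∀ᵐ t ∂(volume.restrict (Ioo 0 T)), ‖v t‖ ≤ M)
    {φ : ℝ → ℝ} (hφ : ContDiff ℝ ∞ φ) (hφT : tsupport φ ⊆ Iio T) :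
    ∫ t in Ioo 0 T, deriv φ t • (u₀ + ∫ s in (0 : ℝ)..t, v s) =
      -(φ 0 • u₀) - ∫ t in Ioo 0 T, φ t • v t := by
  set U : ℝ → E := fun t => u₀ + ∫ s in (0 : ℝ)..t, v s with hU
  have hvi := intervalIntegrable_of_ae_bound hT.le hm hv
  have hφ1 : ContDiff ℝ 1 φ := hφ.of_le (by exact_mod_cast le_top)
  have hφ' : Continuous (deriv φ) := hφ1.continuous_deriv le_rfl
  have hPac := absolutelyContinuous_primitive hT.le hm hv
  have hUac : AbsolutelyContinuousOnInterval U 0 T :=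
    (AbsolutelyContinuousOnInterval.add (LipschitzOnWith.absolutelyContinuousOnInterval
      (K := 0) (f := fun _ => u₀) (LipschitzWith.const u₀).lipschitzOnWith) hPac)
  have hUc : ContinuousOn U (Icc 0 T) := by
    have := hUac.continuousOn
    rwa [uIcc_of_le hT.le] at this
  have hUi : IntervalIntegrable (fun t => deriv φ t • U t) volume 0 T := by
    refine ContinuousOn.intervalIntegrable ?_
    rw [uIcc_of_le hT.le]
    exact hφ'.continuousOn.smul hUc
  have hvi' : IntervalIntegrable (fun t => φ t • v t) volume 0 T :=
    hvi.continuousOn_smul hφ.continuous.continuousOn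
  set w : ℝ → E := fun t => deriv φ t • U t + φ t • v t with hw
  have hwi : IntervalIntegrable w volume 0 T := hUi.add hvi'
  obtain ⟨C₁, hC₁⟩ := (isCompact_Icc (a := (0 : ℝ)) (b := T)).exists_bound_of_continuousOn
    (hφ'.continuousOn.smul hUc)
  obtain ⟨C₂, hC₂⟩ := (isCompact_Icc (a := (0 : ℝ)) (b := T)).exists_bound_of_continuousOn
    hφ.continuous.continuousOn
  have hwm : AEStronglyMeasurable w (volume.restrict (Ioo 0 T)) := by
    rw [intervalIntegrable_iff_integrableOn_Ioo_of_le hT.le] at hwi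
    exact hwi.aestronglyMeasurable
  have hwb : ∀ᵐ t ∂(volume.restrict (Ioo 0 T)), ‖w t‖ ≤ C₁ + C₂ * M := by
    filter_upwards [hv, ae_restrict_mem measurableSet_Ioo] with t h1 h2
    have h3 := Ioo_subset_Icc_self h2
    refine (norm_add_le _ _).trans (add_le_add (hC₁ t h3) ?_)
    rw [norm_smul]
    exact mul_le_mul (hC₂ t h3) h1 (norm_nonneg _) ((norm_nonneg _).trans (hC₂ t h3))
  -- The product rule holds almost everywhere, so `φ U - ∫ w` is absolutely continuous with zero
  -- derivative, hence constant. Comparing its values at `0` and `T`, where `φ T = 0`, gives the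
  -- formula.
  have hVac : AbsolutelyContinuousOnInterval
      (fun t => φ t • U t - ∫ s in (0 : ℝ)..t, w s) 0 T :=
    AbsolutelyContinuousOnInterval.sub
      (AbsolutelyContinuousOnInterval.smul (absolutelyContinuous_of_contDiff hφ1 0 T) hUac)
      (absolutelyContinuous_primitive hT.le hwm hwb)
  have hd : ∀ᵐ x, x ∈ uIcc 0 T →
      HasDerivAt (fun t => φ t • U t - ∫ s in (0 : ℝ)..t, w s) 0 x := by
    filter_upwards [ae_hasDerivAt_primitive hT.le hvi, ae_hasDerivAt_primitive hT.le hwi]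
      with x h1 h2 hx
    rw [uIcc_of_le hT.le] at hx
    have h3 := ((hφ1.differentiable one_ne_zero) x).hasDerivAt.smul ((h1 hx).const_add u₀)
    have h4 := h3.sub (h2 hx)
    have e : φ x • v x + deriv φ x • (u₀ + ∫ s in (0 : ℝ)..x, v s) - w x = 0 := by
      simp only [hw, hU]
      abel
    rwa [e] at h4
  have hconst := hVac.const_of_ae_hasDerivAt_zero hd
  obtain ⟨c, hc⟩ := hconst
  have h0 := hc 0 (by simp)
  have hTT := hc T (by simp)
  have hφTz : φ T = 0 := image_eq_zero_of_notMem_tsupport fun h => lt_irrefl T (hφT h)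
  have h5 : ∫ s in (0 : ℝ)..T, w s = -(φ 0 • u₀) := by
    simp only [hU, intervalIntegral.integral_same, add_zero, sub_zero, hφTz, zero_smul,
      zero_sub] at h0 hTT
    rw [h0, ← hTT, neg_neg]
  rw [intervalIntegral.integral_add hUi hvi'] at h5
  rw [← integral_Ioc_eq_integral_Ioo, ← integral_Ioc_eq_integral_Ioo,
    ← intervalIntegral.integral_of_le hT.le, ← intervalIntegral.integral_of_le hT.le]
  exact eq_sub_of_add_eq h5

/-- A function with an integral representation has a weak time derivative. -/
lemma hasWeakTimeDeriv_of_integral {T M : ℝ} (hT : 0 < T) {u₀ : L2} {u v : ℝ → L2}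
    (hm : AEStronglyMeasurable v (volume.restrict (Ioo 0 T)))
    (hv : ∀ᵐ t ∂(volume.restrict (Ioo 0 T)), ‖v t‖ ≤ M)
    (hu : ∀ᵐ t ∂(volume.restrict (Ioo 0 T)), u t = u₀ + ∫ s in (0 : ℝ)..t, v s) :
    HasWeakTimeDeriv T u₀ u v := by
  intro φ hφ _ hφT
  rw [← integral_deriv_smul_primitive hT hm hv hφ hφT]
  refine integral_congr_ae ?_
  filter_upwards [hu] with t ht
  rw [ht]

/-- Every test function on `(0, T)` is the derivative there of a test function on `(-∞, T)`. -/
lemma exists_testFunction {T : ℝ} (hT : 0 < T) {ψ : ℝ → ℝ} (hψ : ContDiff ℝ ∞ ψ)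
    (hψc : HasCompactSupport ψ) (hψT : tsupport ψ ⊆ Ioo 0 T) :
    ∃ φ : ℝ → ℝ, ContDiff ℝ ∞ φ ∧ HasCompactSupport φ ∧ tsupport φ ⊆ Iio T ∧
      ∀ t ∈ Ioo 0 T, deriv φ t = ψ t := by
  obtain ⟨b, hb0, hbT, hb⟩ : ∃ b, 0 < b ∧ b < T ∧ tsupport ψ ⊆ Iio b := by
    rcases (tsupport ψ).eq_empty_or_nonempty with h | h
    · exact ⟨T / 2, by positivity, by linarith, by simp [h]⟩
    · obtain ⟨m, hm, hmax⟩ := hψc.isCompact.exists_isMaxOn h continuous_id.continuousOn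
      have := hψT hm
      exact ⟨(m + T) / 2, by linarith [this.1], by linarith [this.2], fun x hx => by
        have h1 : x ≤ m := hmax hx
        have := this.2
        simp only [mem_Iio]
        linarith⟩
  set Φ : ℝ → ℝ := fun t => ∫ s in b..t, ψ s with hΦ
  have hΦd : ∀ t, HasDerivAt Φ (ψ t) t := fun t =>
    intervalIntegral.integral_hasDerivAt_right (hψ.continuous.intervalIntegrable _ _)
      (hψ.continuous.stronglyMeasurableAtFilter _ _) hψ.continuous.continuousAt
  have hΦs : ContDiff ℝ ∞ Φ := by
    rw [contDiff_infty_iff_deriv]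
    refine ⟨fun t => (hΦd t).differentiableAt, ?_⟩
    rwa [show deriv Φ = ψ from funext fun t => (hΦd t).deriv]
  have hΦz : ∀ t, b ≤ t → Φ t = 0 := fun t ht => by
    refine intervalIntegral.integral_zero_ae (ae_of_all _ fun s hs => ?_)
    rw [uIoc_of_le ht] at hs
    exact image_eq_zero_of_notMem_tsupport fun h => absurd (hb h) (not_lt.mpr hs.1.le)
  -- The primitive based at `b` vanishes to the right of `b < T` but is constant far to the left.
  -- The bump function, equal to `1` on `[-T, T]`, makes the support compact without changing `(0,
  -- T)`.
  let χ : ContDiffBump (0 : ℝ) := ⟨T, T + 1, hT, by linarith⟩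
  refine ⟨fun t => χ t * Φ t, χ.contDiff.mul hΦs, χ.hasCompactSupport.mul_right, ?_, fun t ht => ?_⟩
  · refine (closure_minimal (fun t ht => ?_) isClosed_Iic : _ ⊆ Iic b).trans
      (Iic_subset_Iio.mpr hbT)
    by_contra h
    exact ht (by simp only [hΦz t (not_le.mp h).le, mul_zero])
  · have : (fun t => χ t * Φ t) =ᶠ[𝓝 t] Φ := by
      filter_upwards [isOpen_Ioo.mem_nhds ht] with s hs
      have h1 : χ s = 1 := χ.one_of_mem_closedBall (by
        rw [Metric.mem_closedBall, dist_zero_right, Real.norm_of_nonneg hs.1.le]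
        exact hs.2.le)
      rw [h1, one_mul]
    rw [this.deriv_eq, (hΦd t).deriv]

/-- The candidate `U` has the same weak derivative and initial value, so `u - U` is annihilated by
all `deriv φ`. By `exists_testFunction` these include all test functions on `(0, T)`. That `φ 0` is
unrestricted fixes the constant of integration as `u₀`. -/
lemma ae_eq_integral_of_hasWeakTimeDeriv {T M N : ℝ} (hT : 0 < T) {u₀ : L2} {u v : ℝ → L2}
    (hum : AEStronglyMeasurable u (volume.restrict (Ioo 0 T)))
    (hub : ∀ᵐ t ∂(volume.restrict (Ioo 0 T)), ‖u t‖ ≤ N)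
    (hm : AEStronglyMeasurable v (volume.restrict (Ioo 0 T)))
    (hv : ∀ᵐ t ∂(volume.restrict (Ioo 0 T)), ‖v t‖ ≤ M) (h : HasWeakTimeDeriv T u₀ u v) :
    ∀ᵐ t ∂(volume.restrict (Ioo 0 T)), u t = u₀ + ∫ s in (0 : ℝ)..t, v s := by
  set U : ℝ → L2 := fun t => u₀ + ∫ s in (0 : ℝ)..t, v s with hU
  have hUc : ContinuousOn U (Icc 0 T) := by
    have := (absolutelyContinuous_primitive hT.le hm hv).continuousOn
    rw [uIcc_of_le hT.le] at this
    exact continuousOn_const.add this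
  have hUi : IntegrableOn U (Ioo 0 T) := (hUc.integrableOn_Icc).mono_set Ioo_subset_Icc_self
  have hui : IntegrableOn u (Ioo 0 T) := Integrable.of_bound hum N hub
  have hW := hasWeakTimeDeriv_of_integral (u := U) hT hm hv (ae_of_all _ fun _ => rfl)
  have key : ∀ᵐ t, t ∈ Ioo 0 T → u t - U t = 0 := by
    refine IsOpen.ae_eq_zero_of_integral_contDiff_smul_eq_zero isOpen_Ioo
      (hui.sub hUi).locallyIntegrableOn fun ψ hψ hψc hψT => ?_
    obtain ⟨φ, hφ, hφc, hφT, hφd⟩ := exists_testFunction hT hψ hψc hψT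
    have h1 := h φ hφ hφc hφT
    rw [← hW φ hφ hφc hφT] at h1
    have e : ∀ w : ℝ → L2, ∫ t in Ioo 0 T, deriv φ t • w t = ∫ t in Ioo 0 T, ψ t • w t :=
      fun w => setIntegral_congr_fun measurableSet_Ioo fun t ht => by simp only [hφd t ht]
    rw [e, e] at h1
    obtain ⟨C, hC⟩ := hψc.exists_bound_of_continuous hψ.continuous
    have hi : ∀ w : ℝ → L2, IntegrableOn w (Ioo 0 T) →
        IntegrableOn (fun t => ψ t • w t) (Ioo 0 T) := fun w hw =>
      hw.bdd_smul C hψ.continuous.aestronglyMeasurable (ae_of_all _ hC)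
    have hz : ∀ t, t ∉ Ioo 0 T → ψ t • (u t - U t) = 0 := fun t ht => by
      rw [image_eq_zero_of_notMem_tsupport fun h => ht (hψT h), zero_smul]
    rw [← setIntegral_eq_integral_of_forall_compl_eq_zero hz]
    simp_rw [smul_sub]
    rw [integral_sub (hi u hui) (hi U hUi), h1, sub_self]
  rw [ae_restrict_iff' measurableSet_Ioo]
  filter_upwards [key] with t ht h1
  exact sub_eq_zero.mp (ht h1)

/-- The weak derivative stays in the kernel of a bounded operator. -/
lemma ae_eq_zero_of_hasWeakTimeDeriv {T : ℝ} {u₀ : L2} {u v : ℝ → L2} (J : L2 →L[ℝ] L2)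
    (hui : IntegrableOn u (Ioo 0 T)) (hvi : IntegrableOn v (Ioo 0 T))
    (h : HasWeakTimeDeriv T u₀ u v)
    (hu : ∀ᵐ t ∂(volume.restrict (Ioo 0 T)), J (u t) = 0) :
    ∀ᵐ t ∂(volume.restrict (Ioo 0 T)), J (v t) = 0 := by
  have hJ : IntegrableOn (fun t => J (v t)) (Ioo 0 T) := J.integrable_comp hvi
  have key : ∀ᵐ t, t ∈ Ioo 0 T → J (v t) = 0 := by
    refine IsOpen.ae_eq_zero_of_integral_contDiff_smul_eq_zero isOpen_Ioo
      hJ.locallyIntegrableOn fun ψ hψ hψc hψT => ?_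
    have h1 := h ψ hψ hψc (hψT.trans Ioo_subset_Iio_self)
    have h0 : ψ 0 = 0 := image_eq_zero_of_notMem_tsupport fun h => lt_irrefl 0 (hψT h).1
    have hψ1 : ContDiff ℝ 1 ψ := hψ.of_le (by exact_mod_cast le_top)
    have hψ' : Continuous (deriv ψ) := hψ1.continuous_deriv le_rfl
    have hi : ∀ η : ℝ → ℝ, Continuous η → HasCompactSupport η → ∀ w : ℝ → L2,
        IntegrableOn w (Ioo 0 T) → IntegrableOn (fun t => η t • w t) (Ioo 0 T) := by
      intro η hη hηc w hw
      obtain ⟨C, hC⟩ := hηc.exists_bound_of_continuous hη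
      exact hw.bdd_smul C hη.aestronglyMeasurable (ae_of_all _ hC)
    have h2 := congrArg J h1
    rw [h0, zero_smul, neg_zero, zero_sub, map_neg,
      ← J.integral_comp_comm (hi _ hψ' hψc.deriv u hui),
      ← J.integral_comp_comm (hi _ hψ.continuous hψc v hvi)] at h2
    have h3 : ∫ t in Ioo 0 T, J (deriv ψ t • u t) = 0 := by
      rw [← integral_zero ℝ L2 (μ := volume.restrict (Ioo 0 T))]
      refine integral_congr_ae ?_
      filter_upwards [hu] with t ht
      rw [map_smul, ht, smul_zero]
    rw [h3, eq_comm, neg_eq_zero] at h2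
    have hz : ∀ t, t ∉ Ioo 0 T → ψ t • J (v t) = 0 := fun t ht => by
      rw [image_eq_zero_of_notMem_tsupport fun h => ht (hψT h), zero_smul]
    rw [← setIntegral_eq_integral_of_forall_compl_eq_zero hz, ← h2]
    simp_rw [map_smul]
  rw [ae_restrict_iff' measurableSet_Ioo]
  exact key

/-! ### Weak solutions and phase-space trajectories -/

section


lemma isSym_μinv (β : ℝ) : IsSym fun ξ => (μ β ξ)⁻¹ := by
  refine ⟨by have := measurable_μ β; fun_prop, fun ξ => by rw [μ_neg], 1, fun ξ => ?_⟩
  rw [abs_of_pos (inv_pos.mpr (μ_pos β ξ))]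
  exact μ_inv_le_one β ξ

lemma symH_injective {p : ℝ → ℝ} (hp : IsSym p) (hpos : ∀ ξ, 0 < p ξ) :
    Function.Injective (symH hp) := by
  intro F G h
  refine Subtype.ext (Lp.ext ?_)
  have h1 := coeFn_symH hp F
  rw [h] at h1
  filter_upwards [h1, coeFn_symH hp G] with ξ h2 h3
  have h4 : (p ξ : ℂ) ≠ 0 := by exact_mod_cast (hpos ξ).ne'
  exact mul_left_cancel₀ h4 (h2.symm.trans h3)

/-- The loss of derivatives in the phase space. -/
abbrev rough : Phase →L[ℝ] Phase := diag (symH isSym_θ3)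

/-- The inverse Fourier transform of hermitian functions. -/
def synth : Hm →L[ℝ] L2 := (FT.symm : L2 →L[ℝ] L2) ∘L Hm.subtypeL

lemma FT_synth (F : Hm) : FT (synth F) = F := FT.apply_symm_apply _

lemma synth_injective : Function.Injective synth := fun _ _ h =>
  Subtype.ext (FT.symm.injective h)

lemma synth_eq_iff {F : Hm} {u : L2} : synth F = u ↔ FT u = F := by
  constructor
  · rintro rfl; exact FT_synth F
  · intro h; exact FT.injective ((FT_synth F).trans h.symm)

/-- The position component of a rough state. -/
def posL (β : ℝ) : Phase →L[ℝ] L2 :=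
  synth ∘L symH (isSym_μinv β) ∘L WithLp.fstL 2 ℝ Hm Hm

/-- The velocity component of a rough state. -/
def velL : Phase →L[ℝ] L2 := synth ∘L WithLp.sndL 2 ℝ Hm Hm

lemma posL_apply (β : ℝ) (z : Phase) : posL β z = synth (symH (isSym_μinv β) z.fst) := rfl

lemma velL_apply (z : Phase) : velL z = synth z.snd := rfl

lemma Phase.ext_posL_velL {β : ℝ} {y z : Phase} (h₁ : posL β y = posL β z)
    (h₂ : velL y = velL z) : y = z :=
  Phase.ext (symH_injective (isSym_μinv β) (fun ξ => inv_pos.mpr (μ_pos β ξ)) (synth_injective h₁))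
    (synth_injective h₂)

lemma posL_rough (β : ℝ) (x : Phase) :
    posL β (rough x) = synth (symH (isSym_μinvθ3 β) x.fst) := by
  rw [posL_apply, diag_fst, symH_comp (isSym_μinv β) isSym_θ3 (isSym_μinvθ3 β) fun _ => rfl]

lemma velL_rough (x : Phase) : velL (rough x) = synth (symH isSym_θ3 x.snd) := rfl

/-- The factor `μ⁻¹` in `posL` undoes the symmetrizer, so the first component of the flow expresses
`f_t = g`. -/
lemma posL_flow (α β ε : ℝ) (x : Phase) : posL β (flow α β ε x) = velL (rough x) := by
  rw [posL_apply, flow_fst, symH_comp (isSym_μinv β) (isSym_μθ3 β) isSym_θ3 fun ξ =>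
    inv_mul_cancel_left₀ (μ_pos β ξ).ne' _, velL_rough]

lemma velL_flow (α ε : ℝ) {β : ℝ} (hβ : 0 < β) (x : Phase) :
    velL (flow α β ε x) = rhs α β ε (posL β (rough x)) (velL (rough x)) := by
  rw [velL_apply, flow_snd, synth_eq_iff]
  refine FT_rhs hβ ?_ ?_
  · rw [posL_rough, FT_synth]
  · rw [velL_rough, FT_synth]

lemma isRealValued_synth (F : Hm) : IsRealValued (synth F) := by
  rw [isRealValued_iff, ← FT_apply, FT_synth]
  exact F.2

lemma ofReal_norm_le_hsNorm (s : ℝ) (u : L2) : ENNReal.ofReal ‖u‖ ≤ hsNorm s u := by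
  rw [← norm_FT, ← L2.eLpNorm_eq, hsNorm, FT_apply]
  refine eLpNorm_mono fun ξ => ?_
  rw [norm_mul, Complex.norm_real, Real.norm_of_nonneg (Real.sqrt_nonneg _)]
  refine le_mul_of_one_le_left (norm_nonneg _) (Real.one_le_sqrt.mpr ?_)
  linarith [Real.rpow_nonneg (abs_nonneg (2 * Real.pi * ξ)) (2 * s)]

lemma μinvθ3_pos (β ξ : ℝ) : 0 < (μ β ξ)⁻¹ * θ ξ ^ 3 :=
  mul_pos (inv_pos.mpr (μ_pos β ξ)) (pow_pos (θ_pos ξ) 3)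

lemma exists_phase (β : ℝ) : ∃ K, 0 ≤ K ∧ ∀ (f g : L2) (R : ℝ≥0), IsRealValued f →
    IsRealValued g → hsNorm (9 / 2) f ≤ R → hsNorm 3 g ≤ R →
    ∃ x : Phase, posL β (rough x) = f ∧ velL (rough x) = g ∧ ‖x‖ ≤ K * R := by
  obtain ⟨K₁, hK₁, h₁⟩ := exists_le_position_weight β
  obtain ⟨K₂, hK₂, h₂⟩ := exists_le_velocity_weight
  refine ⟨K₁ + K₂, by positivity, fun f g R hf hg hfR hgR => ?_⟩
  rw [isRealValued_iff] at hf hg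
  obtain ⟨A, hA, hAR⟩ := exists_symH_eq_of_hsNorm_le (isSym_μinvθ3 β) (μinvθ3_pos β) hK₁ h₁ hf hfR
  obtain ⟨B, hB, hBR⟩ := exists_symH_eq_of_hsNorm_le isSym_θ3 (fun ξ => pow_pos (θ_pos ξ) 3) hK₂ h₂
    hg hgR
  refine ⟨WithLp.toLp 2 (A, B), ?_, ?_, ?_⟩
  · rw [posL_rough, synth_eq_iff, hA]; rfl
  · rw [velL_rough, synth_eq_iff, hB]; rfl
  · refine (Phase.norm_le_add _).trans ?_
    rw [add_mul]
    exact add_le_add hAR hBR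

lemma exists_hsNorm_posL_le {β : ℝ} (hβ : 0 < β) : ∃ K, ∀ (x : Phase) (R : ℝ), ‖x‖ ≤ R →
    hsNorm (9 / 2) (posL β (rough x)) ≤ ENNReal.ofReal (K * R) := by
  obtain ⟨K, hK⟩ := exists_position_weight_le hβ
  have hK0 : 0 ≤ K := (mul_nonneg (Real.sqrt_nonneg _) (μinvθ3_pos β 0).le).trans (hK 0)
  refine ⟨K, fun x R hx => ?_⟩
  refine (hsNorm_le_of_eq_symH (isSym_μinvθ3 β) (μinvθ3_pos β) hK (A := x.fst)
    (by rw [posL_rough, FT_synth])).trans (ENNReal.ofReal_le_ofReal ?_)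
  exact mul_le_mul_of_nonneg_left ((Phase.norm_fst_le x).trans hx) hK0

lemma exists_hsNorm_velL_le : ∃ K, ∀ (x : Phase) (R : ℝ), ‖x‖ ≤ R →
    hsNorm 3 (velL (rough x)) ≤ ENNReal.ofReal (K * R) := by
  obtain ⟨K, hK⟩ := exists_velocity_weight_le
  have hpos : ∀ ξ, 0 < θ ξ ^ 3 := fun ξ => pow_pos (θ_pos ξ) 3
  have hK0 : 0 ≤ K := (mul_nonneg (Real.sqrt_nonneg _) (hpos 0).le).trans (hK 0)
  refine ⟨K, fun x R hx => ?_⟩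
  refine (hsNorm_le_of_eq_symH isSym_θ3 hpos hK (A := x.snd)
    (by rw [velL_rough, FT_synth])).trans (ENNReal.ofReal_le_ofReal ?_)
  exact mul_le_mul_of_nonneg_left ((Phase.norm_snd_le x).trans hx) hK0

lemma aestronglyMeasurable_of_synth {ν : Measure ℝ} {F : ℝ → Hm}
    (h : AEStronglyMeasurable (fun t => synth (F t)) ν) : AEStronglyMeasurable F ν := by
  have h1 : AEStronglyMeasurable (fun t => (F t : L2)) ν := by
    have := FT.continuous.comp_aestronglyMeasurable h
    simpa only [Function.comp_def, FT_synth] using this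
  exact (Topology.IsEmbedding.subtypeVal.aestronglyMeasurable_comp_iff).mp h1

/-- The smooth state is not a continuous function of the rough one, but its frequency truncations
are, and they converge pointwise. -/
lemma aestronglyMeasurable_phase {ν : Measure ℝ} {β : ℝ} {x : ℝ → Phase}
    (h₁ : AEStronglyMeasurable (fun t => posL β (rough (x t))) ν)
    (h₂ : AEStronglyMeasurable (fun t => velL (rough (x t))) ν) : AEStronglyMeasurable x ν := by
  simp only [posL_rough] at h₁
  simp only [velL_rough] at h₂
  have hA := aestronglyMeasurable_of_synth h₁
  have hB := aestronglyMeasurable_of_synth h₂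
  -- Multiplication by `μ` is available as the bounded symbol `μ θ³`. One factor `cutW` undoes that
  -- `θ³`, the other the `θ³` of the rough state.
  have e₁ : ∀ n (F : Hm), symH (isSym_cut n) F = symH (isSym_μθ3 β) (symH (isSym_cutW n)
      (symH (isSym_cutW n) (symH (isSym_μinvθ3 β) F))) := fun n F => by
    rw [symH_comp (isSym_cutW n) (isSym_μinvθ3 β) ((isSym_cutW n).mul (isSym_μinvθ3 β))
      (fun _ => rfl), symH_comp (isSym_cutW n) _ ((isSym_cutW n).mul
      ((isSym_cutW n).mul (isSym_μinvθ3 β))) (fun _ => rfl), symH_comp (isSym_μθ3 β) _ (isSym_cut n)]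
    intro ξ
    have h1 := cut_mul_cut (le_refl n) ξ
    have h2 := θ_mul_pow 3 ξ
    have h3 := mul_inv_cancel₀ (μ_pos β ξ).ne'
    calc _ = (cut n ξ * cut n ξ) * (θ ξ ^ 3 * (1 + |ξ|) ^ 3) * (θ ξ ^ 3 * (1 + |ξ|) ^ 3) *
          (μ β ξ * (μ β ξ)⁻¹) := by ring
      _ = _ := by rw [h1, h2, h3]; ring
  have e₂ : ∀ n (F : Hm), symH (isSym_cut n) F = symH (isSym_cutW n) (symH isSym_θ3 F) :=
    fun n F => by
      rw [symH_comp (isSym_cutW n) isSym_θ3 (isSym_cut n)]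
      intro ξ
      rw [mul_assoc, mul_comm _ (θ ξ ^ 3), θ_mul_pow, mul_one]
  have hA' : AEStronglyMeasurable (fun t => (x t).fst) ν := by
    refine aestronglyMeasurable_of_tendsto_ae atTop
      (f := fun n t => symH (isSym_cut n) (x t).fst) (fun n => ?_)
      (ae_of_all _ fun t => tendsto_symH_cut _)
    simp only [e₁]
    exact (ContinuousLinearMap.continuous _).comp_aestronglyMeasurable
      ((ContinuousLinearMap.continuous _).comp_aestronglyMeasurable
        ((ContinuousLinearMap.continuous _).comp_aestronglyMeasurable hA))
  have hB' : AEStronglyMeasurable (fun t => (x t).snd) ν := by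
    refine aestronglyMeasurable_of_tendsto_ae atTop
      (f := fun n t => symH (isSym_cut n) (x t).snd) (fun n => ?_)
      (ae_of_all _ fun t => tendsto_symH_cut _)
    simp only [e₂]
    exact (ContinuousLinearMap.continuous _).comp_aestronglyMeasurable hB
  exact (WithLp.prod_continuous_toLp 2 Hm Hm).comp_aestronglyMeasurable (hA'.prodMk hB')

section Solutions

variable {α β ε T : ℝ} {f₀ f₁ : L2} {f g : ℝ → L2} {x₀ : Phase}

/-- Reality of `f` passes to its weak derivative, since the real functions are the kernel of the
bounded operator `conjL - id`. -/
lemma IsSolution.ae_real_velocity (h : IsSolution α β ε T f₀ f₁ f g)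
    (hf : IntegrableOn f (Ioo 0 T)) (hg : IntegrableOn g (Ioo 0 T)) :
    ∀ᵐ t ∂(volume.restrict (Ioo 0 T)), IsRealValued (g t) := by
  have := ae_eq_zero_of_hasWeakTimeDeriv (conjL - ContinuousLinearMap.id ℝ L2) hf hg h.deriv_f (by
    filter_upwards [h.real_valued] with t ht
    simpa [sub_eq_zero] using isRealValued_iff_conjL.mp ht)
  filter_upwards [this] with t ht
  rw [isRealValued_iff_conjL]
  simpa [sub_eq_zero] using ht

lemma MemLinftyHs.exists_bound {s : ℝ} {u : ℝ → L2} (h : MemLinftyHs T s u) :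
    ∃ C : ℝ, ∀ᵐ t ∂(volume.restrict (Ioo 0 T)), ‖u t‖ ≤ C := by
  obtain ⟨-, C, hC⟩ := h
  refine ⟨C, ?_⟩
  filter_upwards [hC] with t ht
  have := (ofReal_norm_le_hsNorm s (u t)).trans ht
  rw [← ENNReal.ofReal_coe_nnreal] at this
  exact (ENNReal.ofReal_le_ofReal_iff C.2).mp this

/-- The Sobolev bounds allow division by the weights for almost every time. The two weak equations,
in integrated form, are then the two components of one equation in phase space. -/
lemma IsSolution.exists_phase (hβ : 0 < β) (hT : 0 < T) (h : IsSolution α β ε T f₀ f₁ f g)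
    (hx₀ : posL β (rough x₀) = f₀) (hx₁ : velL (rough x₀) = f₁) :
    ∃ (x : ℝ → Phase) (R : ℝ), AEStronglyMeasurable x (volume.restrict (Ioo 0 T)) ∧
      (∀ᵐ t ∂(volume.restrict (Ioo 0 T)), ‖x t‖ ≤ R) ∧
      (∀ᵐ t ∂(volume.restrict (Ioo 0 T)), f t = posL β (rough (x t)) ∧ g t = velL (rough (x t))) ∧
      ∀ᵐ t ∂(volume.restrict (Ioo 0 T)),
        rough (x t) = rough x₀ + ∫ s in (0 : ℝ)..t, flow α β ε (x s) := by
  have hq := isQuasilinear_flow α ε hβ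
  obtain ⟨hfm, C₁, hC₁⟩ := h.mem_f
  obtain ⟨hgm, C₂, hC₂⟩ := h.mem_g
  obtain ⟨N₁, hN₁⟩ := h.mem_f.exists_bound
  obtain ⟨N₂, hN₂⟩ := h.mem_g.exists_bound
  have hgr := h.ae_real_velocity (Integrable.of_bound hfm N₁ hN₁) (Integrable.of_bound hgm N₂ hN₂)
  obtain ⟨K, hK, hex⟩ := OddWaves.exists_phase β
  have hex' : ∀ᵐ t ∂(volume.restrict (Ioo 0 T)), ∃ x : Phase, posL β (rough x) = f t ∧
      velL (rough x) = g t ∧ ‖x‖ ≤ K * ((C₁ + C₂ : ℝ≥0) : ℝ) := by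
    filter_upwards [hC₁, hC₂, h.real_valued, hgr] with t h1 h2 h3 h4
    exact hex (f t) (g t) (C₁ + C₂) h3 h4
      (h1.trans (by exact_mod_cast le_self_add)) (h2.trans (by exact_mod_cast le_add_self))
  -- The state is chosen for every `t`, with value `0` on the null set where no bounded state
  -- exists; measurability is recovered afterwards from that of `f` and `g`.
  have hch : ∀ t, ∃ x : Phase, (∃ x : Phase, posL β (rough x) = f t ∧
      velL (rough x) = g t ∧ ‖x‖ ≤ K * ((C₁ + C₂ : ℝ≥0) : ℝ)) → posL β (rough x) = f t ∧
      velL (rough x) = g t ∧ ‖x‖ ≤ K * ((C₁ + C₂ : ℝ≥0) : ℝ) := fun t => by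
    by_cases hp : ∃ x : Phase, posL β (rough x) = f t ∧
      velL (rough x) = g t ∧ ‖x‖ ≤ K * ((C₁ + C₂ : ℝ≥0) : ℝ)
    · exact ⟨hp.choose, fun _ => hp.choose_spec⟩
    · exact ⟨0, fun h => absurd h hp⟩
  choose x hx using hch
  have hxt : ∀ᵐ t ∂(volume.restrict (Ioo 0 T)), posL β (rough (x t)) = f t ∧
      velL (rough (x t)) = g t ∧ ‖x t‖ ≤ K * ((C₁ + C₂ : ℝ≥0) : ℝ) := by
    filter_upwards [hex'] with t ht using hx t ht
  set R := K * ((C₁ + C₂ : ℝ≥0) : ℝ)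
  have hxm : AEStronglyMeasurable x (volume.restrict (Ioo 0 T)) :=
    aestronglyMeasurable_phase
      (hfm.congr (by filter_upwards [hxt] with t ht using ht.1.symm))
      (hgm.congr (by filter_upwards [hxt] with t ht using ht.2.1.symm))
  obtain ⟨M, hM0, hM⟩ := hq.exists_bound R
  have hGm : AEStronglyMeasurable (fun t => flow α β ε (x t)) (volume.restrict (Ioo 0 T)) :=
    hq.continuous.comp_aestronglyMeasurable hxm
  have hGb : ∀ᵐ t ∂(volume.restrict (Ioo 0 T)), ‖flow α β ε (x t)‖ ≤ M := by
    filter_upwards [hxt] with t ht using hM _ ht.2.2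
  have hGi := intervalIntegrable_of_ae_bound hT.le hGm hGb
  have hg' : ∀ᵐ t ∂(volume.restrict (Ioo 0 T)), g t = posL β (flow α β ε (x t)) := by
    filter_upwards [hxt] with t ht
    rw [posL_flow, ht.2.1]
  have hr' : ∀ᵐ t ∂(volume.restrict (Ioo 0 T)),
      rhs α β ε (f t) (g t) = velL (flow α β ε (x t)) := by
    filter_upwards [hxt] with t ht
    rw [velL_flow α ε hβ, ht.1, ht.2.1]
  have hrb : ∀ᵐ t ∂(volume.restrict (Ioo 0 T)),
      ‖rhs α β ε (f t) (g t)‖ ≤ ‖velL‖ * M := by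
    filter_upwards [hr', hGb] with t h1 h2
    rw [h1]
    exact (velL.le_opNorm _).trans (by gcongr)
  have i₁ := ae_eq_integral_of_hasWeakTimeDeriv hT hfm hN₁ hgm hN₂ h.deriv_f
  have i₂ := ae_eq_integral_of_hasWeakTimeDeriv hT hgm hN₂ h.integrable_rhs.aestronglyMeasurable
    hrb h.deriv_g
  have hint : ∀ (L : Phase →L[ℝ] L2) (v : ℝ → L2),
      (∀ᵐ t ∂(volume.restrict (Ioo 0 T)), v t = L (flow α β ε (x t))) → ∀ t ∈ Ioo 0 T,
      ∫ s in (0 : ℝ)..t, v s = L (∫ s in (0 : ℝ)..t, flow α β ε (x s)) := by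
    intro L v hv t ht
    rw [← L.intervalIntegral_comp_comm (intervalIntegrable_sub hGi ⟨le_rfl, hT.le⟩
      (Ioo_subset_Icc_self ht))]
    refine intervalIntegral.integral_congr_ae ?_
    rw [ae_restrict_iff' measurableSet_Ioo] at hv
    filter_upwards [hv] with s hs hst
    rw [uIoc_of_le ht.1.le] at hst
    exact hs ⟨hst.1, hst.2.trans_lt ht.2⟩
  refine ⟨x, R, hxm, ?_, ?_, ?_⟩
  · filter_upwards [hxt] with t ht using ht.2.2
  · filter_upwards [hxt] with t ht using ⟨ht.1.symm, ht.2.1.symm⟩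
  · filter_upwards [hxt, i₁, i₂, ae_restrict_mem measurableSet_Ioo] with t ht h1 h2 hm
    refine Phase.ext_posL_velL (β := β) ?_ ?_
    · rw [map_add, ht.1, hx₀, h1, hint _ _ hg' t hm]
    · rw [map_add, ht.2.1, hx₁, h2, hint _ _ hr' t hm]

lemma isSolution_of_phase (hβ : 0 < β) (hT : 0 < T) {x : ℝ → Phase} {R : ℝ}
    (hR : ∀ t ∈ Icc 0 T, ‖x t‖ ≤ R) (hc : ContinuousOn (fun t => rough (x t)) (Icc 0 T))
    (hG : ContinuousOn (fun t => flow α β ε (x t)) (Icc 0 T))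
    (hx : ∀ t ∈ Icc 0 T, rough (x t) = rough x₀ + ∫ s in (0 : ℝ)..t, flow α β ε (x s)) :
    IsSolution α β ε T (posL β (rough x₀)) (velL (rough x₀)) (fun t => posL β (rough (x t)))
      (fun t => velL (rough (x t))) := by
  have hm : ∀ {u : ℝ → L2}, ContinuousOn u (Icc 0 T) →
      AEStronglyMeasurable u (volume.restrict (Ioo 0 T)) := fun hu =>
    (hu.mono Ioo_subset_Icc_self).aestronglyMeasurable measurableSet_Ioo
  have hb : ∀ {u : ℝ → L2}, ContinuousOn u (Icc 0 T) →
      ∃ M, ∀ᵐ t ∂(volume.restrict (Ioo 0 T)), ‖u t‖ ≤ M := fun {u} hu => by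
    obtain ⟨M, hM⟩ := (isCompact_Icc (a := (0 : ℝ)) (b := T)).exists_bound_of_continuousOn hu
    refine ⟨M, ?_⟩
    filter_upwards [ae_restrict_mem measurableSet_Ioo] with t ht using hM t (Ioo_subset_Icc_self ht)
  have hpc : ContinuousOn (fun t => posL β (rough (x t))) (Icc 0 T) :=
    (posL β).continuous.comp_continuousOn hc
  have hvc : ContinuousOn (fun t => velL (rough (x t))) (Icc 0 T) :=
    velL.continuous.comp_continuousOn hc
  have hrc : ContinuousOn (fun t => rhs α β ε (posL β (rough (x t))) (velL (rough (x t))))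
      (Icc 0 T) := by
    simp only [← velL_flow α ε hβ]
    exact velL.continuous.comp_continuousOn hG
  have hint : ∀ (L : Phase →L[ℝ] L2), ∀ᵐ t ∂(volume.restrict (Ioo 0 T)),
      L (rough (x t)) = L (rough x₀) + ∫ s in (0 : ℝ)..t, L (flow α β ε (x s)) := by
    intro L
    filter_upwards [ae_restrict_mem measurableSet_Ioo] with t ht
    have ht' := Ioo_subset_Icc_self ht
    rw [hx t ht', map_add, L.intervalIntegral_comp_comm]
    refine ContinuousOn.intervalIntegrable (hG.mono ?_)
    rw [uIcc_of_le ht'.1]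
    exact Icc_subset_Icc_right ht'.2
  obtain ⟨K₁, hK₁⟩ := exists_hsNorm_posL_le hβ
  obtain ⟨K₂, hK₂⟩ := exists_hsNorm_velL_le
  obtain ⟨M₁, hM₁⟩ := hb hvc
  obtain ⟨M₂, hM₂⟩ := hb hrc
  constructor
  · refine ae_of_all _ fun t => ?_
    rw [posL_apply]
    exact isRealValued_synth _
  · refine ⟨hm hpc, (K₁ * R).toNNReal, ?_⟩
    filter_upwards [ae_restrict_mem measurableSet_Ioo] with t ht
    exact hK₁ _ _ (hR t (Ioo_subset_Icc_self ht))
  · refine ⟨hm hvc, (K₂ * R).toNNReal, ?_⟩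
    filter_upwards [ae_restrict_mem measurableSet_Ioo] with t ht
    exact hK₂ _ _ (hR t (Ioo_subset_Icc_self ht))
  · refine hasWeakTimeDeriv_of_integral hT (hm hvc) hM₁ ?_
    simpa only [posL_flow] using hint (posL β)
  · exact hrc.integrableOn_Icc.mono_set Ioo_subset_Icc_self
  · refine hasWeakTimeDeriv_of_integral hT (hm hrc) hM₂ ?_
    simpa only [velL_flow α ε hβ] using hint velL

end Solutions

end

end OddWaves

end

theorem theorem2 (α β ε : ℝ) (hβ : 0 < β) (f₀ f₁ : OddWaves.L2)
    (hr₀ : OddWaves.IsRealValued f₀) (hr₁ : OddWaves.IsRealValued f₁)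
    (h₀ : OddWaves.MemHs (9 / 2) f₀) (h₁ : OddWaves.MemHs 3 f₁) :
    ∃ T : ℝ, 0 < T ∧
      (∃ f g : ℝ → OddWaves.L2, OddWaves.IsSolution α β ε T f₀ f₁ f g) ∧
      ∀ f g f' g' : ℝ → OddWaves.L2,
        OddWaves.IsSolution α β ε T f₀ f₁ f g → OddWaves.IsSolution α β ε T f₀ f₁ f' g' →
          (f =ᵐ[MeasureTheory.volume.restrict (Set.Ioo 0 T)] f') ∧
            (g =ᵐ[MeasureTheory.volume.restrict (Set.Ioo 0 T)] g') := by
  obtain ⟨K, -, hex⟩ := OddWaves.exists_phase β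
  have hle : ∀ {a : ENNReal} (b : NNReal), a < ⊤ → a ≤ ((a.toNNReal + b : NNReal) : ENNReal) :=
    fun b ha => by
      rw [ENNReal.coe_add, ENNReal.coe_toNNReal ha.ne]
      exact le_self_add
  obtain ⟨x₀, hx₀, hx₁, -⟩ := hex f₀ f₁
    ((OddWaves.hsNorm (9 / 2) f₀).toNNReal + (OddWaves.hsNorm 3 f₁).toNNReal) hr₀ hr₁
    (hle _ h₀) (by rw [add_comm]; exact hle _ h₁)
  have hq := OddWaves.isQuasilinear_flow α ε hβ
  obtain ⟨T, hT, R, x, hR, hc, hG, hx⟩ := hq.exists_solution x₀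
  refine ⟨T, hT, ?_, fun f g f' g' h h' => ?_⟩
  · rw [← hx₀, ← hx₁]
    exact ⟨_, _, OddWaves.isSolution_of_phase hβ hT hR hc hG hx⟩
  · obtain ⟨y, S, hym, hyb, hyf, hy⟩ := h.exists_phase hβ hT hx₀ hx₁
    obtain ⟨y', S', hym', hyb', hyf', hy'⟩ := h'.exists_phase hβ hT hx₀ hx₁
    -- The two solutions may come with different bounds, and uniqueness holds in the larger ball.
    have key := hq.unique (R := max S S') hT.le hym hym'
      (hyb.mono fun t ht => ht.trans (le_max_left _ _))
      (hyb'.mono fun t ht => ht.trans (le_max_right _ _)) hy hy'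
    constructor
    · filter_upwards [key, hyf, hyf'] with t e h1 h2
      rw [h1.1, h2.1, e]
    · filter_upwards [key, hyf, hyf'] with t e h1 h2
      rw [h1.2, h2.2, e]
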